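/- Let $M$ be a connected smooth surface without boundary (Hausdorff, second countable) and let $X\colon M\to\mathbb{R}^3$ be a smooth immersion with zero mean curvature and finite total curvature, $\int_M|K|\,dA<\infty$. Assume that $M$ has exactly three ends and that each of them is asymptotic to a catenoid, in the following sense. For every end $\varepsilon$ of $M$ there are an orthonormal frame $(e_1,e_2,e_3)$ of $\mathbb{R}^3$, a point $o\in\mathbb{R}^3$ and a number $c>0$ such that, for some radius $r>0$, a neighbourhood of $\varepsilon$ in $M$ is mapped by $X$ as a smooth graph $$\{\,o+x_1e_1+x_2e_2+u(x)e_3 : x\in\mathbb{R}^2,\ |x|>r\,\},\qquad u(x)=c\,\operatorname{arcosh}\frac{|x|}{c}+o\Big(\frac1{|x|}\Big)\quad(|x|\to\infty),$$ that is, the end is asymptotic to one half of the catenoid with axis $L_\varepsilon=o+\mathbb{R}e_3$, and its horizontal distance from this catenoid tends to $0$. The line $L_\varepsilon$ is called the axis of the end $\varepsilon$. Then the axes of the three ends lie in one plane, and they are either all parallel to each other (equal lines being parallel) or all pass through one common point. -/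

import Mathlib

open scoped Manifold ContDiff ENNReal Topology

noncomputable section

/-- The Euclidean plane. -/
abbrev Plane : Type := EuclideanSpace ℝ (Fin 2)

/-- Euclidean three-space. -/
abbrev Space : Type := EuclideanSpace ℝ (Fin 3)

/-! ### Local geometry of a parametrized surface `Y : Plane → Space` -/

/-- The partial derivative of `Y` with respect to the `i`-th coordinate of the plane. -/
def partialDeriv (Y : Plane → Space) (i : Fin 2) (p : Plane) : Space :=
  fderiv ℝ Y p (EuclideanSpace.single i 1)

/-- The cross product of the two coordinate vector fields. Its norm is the area density. -/
def normalField (Y : Plane → Space) (p : Plane) : Space :=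
  WithLp.toLp 2
    (crossProduct (WithLp.ofLp (partialDeriv Y 0 p)) (WithLp.ofLp (partialDeriv Y 1 p)))

/-- The unit normal. -/
def unitNormal (Y : Plane → Space) (p : Plane) : Space :=
  ‖normalField Y p‖⁻¹ • normalField Y p

/-- Coefficients of the first fundamental form. -/
def firstForm (Y : Plane → Space) (i j : Fin 2) (p : Plane) : ℝ :=
  inner ℝ (partialDeriv Y i p) (partialDeriv Y j p)

/-- Coefficients of the second fundamental form. -/
def secondForm (Y : Plane → Space) (i j : Fin 2) (p : Plane) : ℝ :=
  inner ℝ (partialDeriv (partialDeriv Y i) j p) (unitNormal Y p)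

/-- The determinant of the first fundamental form. -/
def firstFormDet (Y : Plane → Space) (p : Plane) : ℝ :=
  firstForm Y 0 0 p * firstForm Y 1 1 p - firstForm Y 0 1 p ^ 2

/-- The mean curvature: one half of the trace of the second fundamental form with respect to
the first one. -/
def meanCurvature (Y : Plane → Space) (p : Plane) : ℝ :=
  (secondForm Y 0 0 p * firstForm Y 1 1 p - 2 * secondForm Y 0 1 p * firstForm Y 0 1 p
    + secondForm Y 1 1 p * firstForm Y 0 0 p) / (2 * firstFormDet Y p)

/-- The Gauss curvature. -/
def gaussCurvature (Y : Plane → Space) (p : Plane) : ℝ :=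
  (secondForm Y 0 0 p * secondForm Y 1 1 p - secondForm Y 0 1 p ^ 2) / firstFormDet Y p

/-! ### Minimal surfaces -/

/-- `X : M → Space` is a smooth immersion of the surface `M` whose mean curvature vanishes
(in every chart of the atlas). -/
structure IsMinimalImmersion {M : Type*} [TopologicalSpace M] [ChartedSpace Plane M]
    (X : M → Space) : Prop where
  contMDiff : ContMDiff 𝓘(ℝ, Plane) 𝓘(ℝ, Space) ∞ X
  injective_mfderiv : ∀ m : M, Function.Injective (mfderiv 𝓘(ℝ, Plane) 𝓘(ℝ, Space) X m)
  meanCurvature_eq_zero : ∀ c ∈ atlas Plane M, ∀ p ∈ c.target,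
    meanCurvature (X ∘ c.symm) p = 0

/-- The integral `∫ |K| dA` over the part of the surface that corresponds to the set `A` of
parameters. -/
def patchCurvature (Y : Plane → Space) (A : Set Plane) : ℝ≥0∞ :=
  ∫⁻ p in A, ENNReal.ofReal (|gaussCurvature Y p| * ‖normalField Y p‖)

/-- The total absolute curvature `∫_M |K| dA` of the immersion `X`: the supremum of the
integrals over finite unions of pairwise disjoint compact sets, each contained in the
domain of a chart. -/
def totalAbsCurvature {M : Type*} [TopologicalSpace M] [ChartedSpace Plane M]
    (X : M → Space) : ℝ≥0∞ :=
  ⨆ (n : ℕ) (c : Fin n → OpenPartialHomeomorph M Plane) (S : Fin n → Set M)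
    (_ : ∀ i, c i ∈ atlas Plane M ∧ IsCompact (S i) ∧ S i ⊆ (c i).source)
    (_ : Pairwise fun i j => Disjoint (S i) (S j)),
    ∑ i, patchCurvature (X ∘ (c i).symm) (c i '' S i)

/-! ### Ends -/

/-- An end of a topological space (Freudenthal): a choice, for every compact set `K`, of a
connected component of the complement of `K`, in a way compatible with inclusions. -/
@[ext]
structure TopologicalEnd (M : Type*) [TopologicalSpace M] where
  component : TopologicalSpace.Compacts M → Set M
  isComponent : ∀ K : TopologicalSpace.Compacts M, ∃ x ∈ (K : Set M)ᶜ, component K = connectedComponentIn (K : Set M)ᶜ x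
  antitone : ∀ K K' : TopologicalSpace.Compacts M, K ≤ K' → component K' ⊆ component K

/-- A catenoid: in the orthonormal frame `frame` at the point `center` it is the surface of
revolution `√(x² + y²) = waist * cosh (z / waist)` about the third axis of the frame. -/
structure Catenoid where
  center : Space
  frame : OrthonormalBasis (Fin 3) ℝ Space
  waist : ℝ
  waist_pos : 0 < waist

namespace Catenoid

/-- The axis of revolution of a catenoid. -/
def axis (C : Catenoid) : AffineSubspace ℝ Space :=
  AffineSubspace.mk' C.center (Submodule.span ℝ {C.frame 2})

/-- The point with coordinates `(x, z)` in the frame of the catenoid. -/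
def point (C : Catenoid) (x : Plane) (z : ℝ) : Space :=
  C.center + (x 0 • C.frame 0 + x 1 • C.frame 1 + z • C.frame 2)

/-- The half of the catenoid with `0 ≤ z` is the graph of this function over
`waist ≤ ‖x‖`. (The other half is obtained by reversing the last vector of the frame.) -/
def height (C : Catenoid) (x : Plane) : ℝ :=
  C.waist * Real.arcosh (‖x‖ / C.waist)

end Catenoid

/-- The end `ε` of the immersed surface `X : M → Space` is asymptotic to (the half with
`0 ≤ z` of) the catenoid `C`: a neighbourhood of `ε` is a smooth graph, over the exterior of
a disk in the plane orthogonal to the axis of `C` through its center, of a function `u` with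
`u x = C.height x + o(1 / ‖x‖)`. Equivalently, the horizontal distance between the
end and the catenoid tends to `0`; this determines the axis.

The chart `e` is the projection of the end to the plane. Its domain contains the part of the
end over the bounding circle, which is a compact subset of the surface. -/
def IsAsymptoticTo {M : Type*} [TopologicalSpace M] [ChartedSpace Plane M]
    (X : M → Space) (ε : TopologicalEnd M) (C : Catenoid) : Prop :=
  ∃ (r : ℝ) (e : OpenPartialHomeomorph M Plane) (K : TopologicalSpace.Compacts M)
    (u : Plane → ℝ),
    0 < r ∧
    e ∈ IsManifold.maximalAtlas 𝓘(ℝ, Plane) ∞ M ∧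
    {x | r ≤ ‖x‖} ⊆ e.target ∧
    ε.component K = e.symm '' {x | r < ‖x‖} ∧
    (∀ x, r < ‖x‖ → X (e.symm x) = C.point x (u x)) ∧
    (fun x => u x - C.height x) =o[Bornology.cobounded Plane] fun x => ‖x‖⁻¹

end

/-! The theorem is the statics of three forces. On a minimal surface the tangential part of a
Killing field `v + A x` of space (`A` skew) is divergence free, so its flux through the boundary of
a compact piece vanishes. When the boundary moves to infinity the flux splits into one contribution
per end, and an end asymptotic to the catenoid with center `o`, waist `c` and axis vector `n`
contributes a fixed positive multiple of `c * ⟪n, v + A o⟫`: it acts as the force `c • n` applied at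
`o`. Translations make the forces add up to zero, rotations the torques
(`sum_waist_mul_inner_eq_zero`). Three nonzero forces in equilibrium have coplanar lines of action
that are parallel or concurrent (`coplanar_and_parallel_or_concurrent_of_balanced`).

No curve integrals occur. The flux is tested with a function that is `1` on a compact core and `0`
far out, so that it becomes an area integral over the annuli `R ≤ ‖x‖ ≤ 2 * R` of the ends. In one
chart its vanishing is integration by parts combined with `fluxCoeff_divergence_eq_zero`;
`IsMinimalImmersion.sum_chartFlux_eq_zero` globalises this by a partition of unity. The test
function has compact support because neighbourhoods of all ends together have a compact complement
(`isCompact_compl_iUnion_component`).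

The analytic difficulty is the torque: rotation fields grow linearly, while only the height
difference `u - h = o(1 / ‖x‖)` is controlled, not its gradient. Monotonicity of the minimal surface
operator gives a Caccioppoli inequality (`integral_gradientDefect_le`), hence an energy of the
difference of order `o(R⁻²)` on the annulus, and `Catenoid.abs_integral_graphFlux_sub_le` turns this
into a flux error `o(1)`. The limit is then the flux of the exact catenoid, which is computed by
symmetry. -/

noncomputable section

/-! ### Ends of a surface and their neighbourhoods. -/

section

-- The frontier of a compact neighbourhood `K'` of `K` is compact, so finitely many components of
-- `Kᶜ` cover it. A component that leaves `K'` without meeting this frontier would be closed as well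
-- as open, hence everything, which is absurd when `K` is nonempty.
open Set Filter in
theorem exists_compact_compl_subset_iUnion_connectedComponentIn {M : Type*} [TopologicalSpace M]
    [T2Space M] [ConnectedSpace M] [LocallyConnectedSpace M] [LocallyCompactSpace M] {K : Set M}
    (hK : IsCompact K) :
    ∃ (K' : Set M) (t : Set M), IsCompact K' ∧ t.Finite ∧ t ⊆ Kᶜ ∧
      K'ᶜ ⊆ ⋃ x ∈ t, connectedComponentIn Kᶜ x := by
  rcases K.eq_empty_or_nonempty with rfl | hne
  · obtain ⟨x⟩ := (inferInstance : Nonempty M)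
    refine ⟨∅, {x}, isCompact_empty, finite_singleton x, by simp, ?_⟩
    simp [connectedComponentIn_univ, PreconnectedSpace.connectedComponent_eq_univ]
  obtain ⟨K', hK', hKK'⟩ := exists_compact_superset hK
  have hopen : ∀ x, IsOpen (connectedComponentIn Kᶜ x) := fun x =>
    hK.isClosed.isOpen_compl.connectedComponentIn
  have hfr : frontier K' ⊆ Kᶜ := fun x hx hxK => hx.2 (hKK' hxK)
  obtain ⟨t, ht, htf, hcov⟩ := (hK'.of_isClosed_subset isClosed_frontier
    hK'.isClosed.frontier_subset).elim_finite_subcover_image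
    (b := frontier K') (c := fun x => connectedComponentIn Kᶜ x) (fun x _ => hopen x)
    (fun x hx => mem_biUnion hx (mem_connectedComponentIn (hfr hx)))
  refine ⟨K', t, hK', htf, ht.trans hfr, fun m hm => ?_⟩
  have hmK : m ∈ Kᶜ := fun h => hm (interior_subset (hKK' h))
  by_cases h : (connectedComponentIn Kᶜ m ∩ frontier K').Nonempty
  · obtain ⟨y, hym, hyf⟩ := h
    obtain ⟨x, hx, hyx⟩ := mem_iUnion₂.1 (hcov hyf)
    refine mem_biUnion hx ?_
    rw [connectedComponentIn_eq hyx, ← connectedComponentIn_eq hym]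
    exact mem_connectedComponentIn hmK
  exfalso
  have hsub : connectedComponentIn Kᶜ m ⊆ K'ᶜ := by
    refine isPreconnected_connectedComponentIn.subset_left_of_subset_union
      hK'.isClosed.isOpen_compl isOpen_interior
      (disjoint_left.2 fun y hy hy' => hy (interior_subset hy')) (fun y hy => ?_)
      ⟨m, mem_connectedComponentIn hmK, hm⟩
    by_contra hc
    rw [mem_union, not_or, notMem_compl_iff] at hc
    exact h ⟨y, hy, subset_closure hc.1, hc.2⟩
  have hclosed : IsClosed (connectedComponentIn Kᶜ m) := by
    refine isClosed_of_closure_subset fun y hy => ?_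
    have hyK : y ∈ Kᶜ := by
      have := closure_mono hsub hy
      rw [closure_compl] at this
      exact fun h => this (hKK' h)
    obtain ⟨z, hzy, hzm⟩ := mem_closure_iff.1 hy _ (hopen y) (mem_connectedComponentIn hyK)
    rw [connectedComponentIn_eq hzm, ← connectedComponentIn_eq hzy]
    exact mem_connectedComponentIn hyK
  have huniv : connectedComponentIn Kᶜ m = univ :=
    IsClopen.eq_univ ⟨hclosed, hopen m⟩ ⟨m, mem_connectedComponentIn hmK⟩
  obtain ⟨x, hx⟩ := hne
  exact connectedComponentIn_subset Kᶜ m (huniv ▸ mem_univ x) hx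

open Set Filter in
/-- Every closed set that is not compact accumulates at an end. -/
theorem TopologicalEnd.exists_inter_nonempty {M : Type*} [TopologicalSpace M]
    [T2Space M] [ConnectedSpace M] [LocallyConnectedSpace M] [LocallyCompactSpace M] {A : Set M}
    (hA : IsClosed A) (hnc : ¬ IsCompact A) :
    ∃ ε : TopologicalEnd M, ∀ K, (ε.component K ∩ A).Nonempty := by
  have hne : (cocompact M ⊓ 𝓟 A).NeBot := by
    refine inf_principal_neBot_iff.2 fun U hU => ?_
    obtain ⟨K, hK, hKU⟩ := mem_cocompact.1 hU
    by_contra hemp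
    rw [not_nonempty_iff_eq_empty] at hemp
    refine hnc (hK.of_isClosed_subset hA fun x hx => ?_)
    by_contra hxK
    exact hemp.subset ⟨hKU hxK, hx⟩
  -- An ultrafilter escaping to infinity within `A` selects one of the finitely many relevant
  -- components for each `K`; the choices are nested because two members of an ultrafilter meet.
  let F : Ultrafilter M := Ultrafilter.of (cocompact M ⊓ 𝓟 A)
  have hF : (F : Filter M) ≤ cocompact M ⊓ 𝓟 A := Ultrafilter.of_le _
  have hAF : A ∈ F := (hF.trans inf_le_right) (mem_principal_self A)
  have key : ∀ K : TopologicalSpace.Compacts M, ∃ x ∈ (K : Set M)ᶜ,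
      connectedComponentIn (K : Set M)ᶜ x ∈ F := fun K => by
    obtain ⟨K', t, hK', htf, ht, hcov⟩ :=
      exists_compact_compl_subset_iUnion_connectedComponentIn K.isCompact
    have h1 : K'ᶜ ∈ F := (hF.trans inf_le_left) hK'.compl_mem_cocompact
    obtain ⟨x, hx, hxF⟩ := (Ultrafilter.finite_biUnion_mem_iff htf).1
      (mem_of_superset h1 hcov)
    exact ⟨x, ht hx, hxF⟩
  choose x hx hxF using key
  refine ⟨⟨fun K => connectedComponentIn (K : Set M)ᶜ (x K), fun K => ⟨x K, hx K, rfl⟩,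
    fun K K' hKK' => ?_⟩, fun K => F.nonempty_of_mem (inter_mem (hxF K) hAF)⟩
  obtain ⟨y, hy, hy'⟩ := F.nonempty_of_mem (inter_mem (hxF K) (hxF K'))
  rw [connectedComponentIn_eq hy, connectedComponentIn_eq hy']
  exact connectedComponentIn_mono y (compl_subset_compl.2 hKK')

theorem TopologicalEnd.isOpen_component {M : Type*} [TopologicalSpace M] [T2Space M]
    [LocallyConnectedSpace M] (ε : TopologicalEnd M) (K : TopologicalSpace.Compacts M) :
    IsOpen (ε.component K) := by
  obtain ⟨x, -, hx⟩ := ε.isComponent K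
  rw [hx]
  exact K.isCompact.isClosed.isOpen_compl.connectedComponentIn

-- If this closed set were not compact, it would accumulate at some end and so meet that end's own
-- neighbourhood.
open Set Filter in
theorem isCompact_compl_iUnion_component {M : Type*} [TopologicalSpace M]
    [T2Space M] [ConnectedSpace M] [LocallyConnectedSpace M] [LocallyCompactSpace M]
    (K : TopologicalEnd M → TopologicalSpace.Compacts M) :
    IsCompact (⋃ ε : TopologicalEnd M, ε.component (K ε))ᶜ := by
  by_contra h
  have hopen : ∀ ε : TopologicalEnd M, IsOpen (ε.component (K ε)) := fun ε =>
    ε.isOpen_component (K ε)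
  obtain ⟨ε, hε⟩ := TopologicalEnd.exists_inter_nonempty
    (isOpen_iUnion hopen).isClosed_compl h
  obtain ⟨x, hx, hx'⟩ := hε (K ε)
  exact hx' (mem_iUnion.2 ⟨ε, hx⟩)

theorem TopologicalEnd.component_subset_compl {M : Type*} [TopologicalSpace M]
    (ε : TopologicalEnd M) (K : TopologicalSpace.Compacts M) : ε.component K ⊆ (K : Set M)ᶜ := by
  obtain ⟨x, -, hx⟩ := ε.isComponent K
  rw [hx]
  exact connectedComponentIn_subset _ _

theorem TopologicalEnd.component_nonempty {M : Type*} [TopologicalSpace M]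
    (ε : TopologicalEnd M) (K : TopologicalSpace.Compacts M) : (ε.component K).Nonempty := by
  obtain ⟨x, hx, h⟩ := ε.isComponent K
  rw [h]
  exact ⟨x, mem_connectedComponentIn hx⟩

theorem TopologicalEnd.subset_component {M : Type*} [TopologicalSpace M]
    (ε : TopologicalEnd M) (K : TopologicalSpace.Compacts M) {S : Set M} (hS : IsPreconnected S)
    (hSK : S ⊆ (K : Set M)ᶜ) (h : (S ∩ ε.component K).Nonempty) : S ⊆ ε.component K := by
  obtain ⟨x, hx, hc⟩ := ε.isComponent K
  obtain ⟨y, hyS, hy⟩ := h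
  rw [hc] at hy ⊢
  rw [connectedComponentIn_eq hy]
  exact hS.subset_connectedComponentIn hyS hSK

theorem TopologicalEnd.exists_disjoint_component {M : Type*} [TopologicalSpace M]
    {ε ε' : TopologicalEnd M} (h : ε ≠ ε') :
    ∃ K, Disjoint (ε.component K) (ε'.component K) := by
  by_contra! hc
  refine h (TopologicalEnd.ext (funext fun K => ?_))
  obtain ⟨y, hy, hy'⟩ := Set.not_disjoint_iff.1 (hc K)
  obtain ⟨x, -, hx⟩ := ε.isComponent K
  obtain ⟨x', -, hx'⟩ := ε'.isComponent K
  rw [hx] at hy ⊢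
  rw [hx'] at hy' ⊢
  rw [connectedComponentIn_eq hy, connectedComponentIn_eq hy']

theorem isPreconnected_exterior {R : ℝ} (hR : 0 < R) :
    IsPreconnected {x : Plane | R < ‖x‖} := by
  have h1 : IsPreconnected ({0}ᶜ : Set Plane) :=
    (isConnected_compl_singleton_of_one_lt_rank (by
      rw [← Module.finrank_eq_rank]; norm_num [finrank_euclideanSpace]) 0).isPreconnected
  -- Pushing every point outwards by `R` along its ray maps the punctured plane onto the exterior.
  have h2 : {x : Plane | R < ‖x‖} = (fun x : Plane => (1 + R / ‖x‖) • x) '' {0}ᶜ := by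
    ext y
    simp only [Set.mem_ofPred_eq, Set.mem_image, Set.mem_compl_iff, Set.mem_singleton_iff]
    constructor
    · intro hy
      have hy0 : 0 < ‖y‖ := hR.trans hy
      have hc : 0 < 1 - R / ‖y‖ := by rw [sub_pos, div_lt_one hy0]; exact hy
      refine ⟨(1 - R / ‖y‖) • y, smul_ne_zero hc.ne' (norm_pos_iff.1 hy0), ?_⟩
      rw [norm_smul, Real.norm_of_nonneg hc.le, smul_smul]
      have : (1 + R / ((1 - R / ‖y‖) * ‖y‖)) * (1 - R / ‖y‖) = 1 := by
        have h3 : ‖y‖ - R ≠ 0 := (sub_pos.2 hy).ne'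
        have h4 : (1 - R / ‖y‖) * ‖y‖ = ‖y‖ - R := by field_simp
        rw [h4]
        field_simp
        ring
      rw [this, one_smul]
    · rintro ⟨x, hx, rfl⟩
      have hx0 : 0 < ‖x‖ := norm_pos_iff.2 hx
      rw [norm_smul, Real.norm_of_nonneg (by positivity), add_mul, div_mul_cancel₀ _ hx0.ne']
      linarith
  rw [h2]
  refine h1.image _ (ContinuousOn.fun_smul ?_ continuousOn_id)
  exact continuousOn_const.add (continuousOn_const.div continuous_norm.continuousOn
    fun x hx => norm_ne_zero_iff.2 hx)

open Filter in
/-- A chart onto a neighbourhood of infinity that grows at least linearly under `X`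
maps the far exteriors to closed sets. -/
theorem isClosed_image_exterior {M : Type*} [TopologicalSpace M] [T2Space M]
    {e : OpenPartialHomeomorph M Plane} {X : M → Space} (hX : Continuous X) {r : ℝ} {o : Space}
    (hr : {x | r ≤ ‖x‖} ⊆ e.target) (hXe : ∀ x, r < ‖x‖ → ‖x‖ ≤ ‖X (e.symm x) - o‖)
    {R : ℝ} (hR : r < R) : IsClosed (e.symm '' {x | R ≤ ‖x‖}) := by
  have hsub : {x : Plane | R ≤ ‖x‖} ⊆ e.target := fun x hx => hr (hR.le.trans hx)
  have hcl : IsClosed {x : Plane | R ≤ ‖x‖} := isClosed_le continuous_const continuous_norm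
  let f : {x : Plane | R ≤ ‖x‖} → M := fun x => e.symm x
  have hf : Continuous f := (e.continuousOn_symm.mono hsub).domRestrict
  -- Properness is inherited from the composite with `X`, whose norm tends to infinity with `‖x‖`.
  have hp : IsProperMap (fun x => X (f x)) := by
    rw [isProperMap_iff_tendsto_cocompact]
    refine ⟨hX.comp hf, ?_⟩
    rw [← Metric.cobounded_eq_cocompact (α := Space), ← tendsto_norm_atTop_iff_cobounded]
    have h1 : Tendsto (fun x : {x : Plane | R ≤ ‖x‖} => ‖(x : Plane)‖ - ‖o‖)
        (cocompact _) atTop :=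
      tendsto_atTop_add_const_right _ _
        ((tendsto_norm_cocompact_atTop (E := Plane)).comp hcl.isClosedEmbedding_subtypeVal.tendsto_cocompact)
    refine tendsto_atTop_mono (fun x => ?_) h1
    have := hXe x (hR.trans_le x.2)
    have := norm_sub_le (X (f x)) o
    linarith
  have := (isProperMap_of_comp_of_t2 hf hX hp).isClosedMap.isClosed_range
  convert this using 1
  ext y
  simp [f]

/-- The far exteriors avoid every given compact set. -/
theorem exists_image_exterior_subset_compl {M : Type*} [TopologicalSpace M]
    {e : OpenPartialHomeomorph M Plane} {X : M → Space} (hX : Continuous X) {r : ℝ} {o : Space}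
    (hXe : ∀ x, r < ‖x‖ → ‖x‖ ≤ ‖X (e.symm x) - o‖) {K : Set M} (hK : IsCompact K) :
    ∃ R₀, ∀ R, R₀ ≤ R → e.symm '' {x | R < ‖x‖} ⊆ Kᶜ := by
  obtain ⟨B, hB⟩ := (hK.image (f := fun m => ‖X m - o‖) (by fun_prop)).bddAbove
  refine ⟨max r B, ?_⟩
  rintro R hR _ ⟨x, hx, rfl⟩ hxK
  have hx' : R < ‖x‖ := hx
  have h1 := hXe x ((le_max_left r B).trans_lt (hR.trans_lt hx'))
  have h2 := hB ⟨_, hxK, rfl⟩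
  have h3 := le_max_right r B
  dsimp only at h2
  linarith

theorem TopologicalEnd.exists_image_exterior_subset_component {M : Type*} [TopologicalSpace M]
    [T2Space M] (ε : TopologicalEnd M)
    {e : OpenPartialHomeomorph M Plane} {X : M → Space} (hX : Continuous X) {r : ℝ} {o : Space}
    (hr0 : 0 < r) (hr : {x | r ≤ ‖x‖} ⊆ e.target)
    (hXe : ∀ x, r < ‖x‖ → ‖x‖ ≤ ‖X (e.symm x) - o‖) {K₀ : TopologicalSpace.Compacts M}
    (hK₀ : ε.component K₀ = e.symm '' {x | r < ‖x‖}) (K : TopologicalSpace.Compacts M) :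
    ∃ R₀, ∀ R, R₀ ≤ R → e.symm '' {x | R < ‖x‖} ⊆ ε.component K := by
  obtain ⟨R₁, hR₁⟩ := exists_image_exterior_subset_compl hX hXe K.isCompact
  refine ⟨max r R₁, fun R hR => ?_⟩
  have hrR : r ≤ R := (le_max_left _ _).trans hR
  have hsub : {x : Plane | R < ‖x‖} ⊆ e.target := fun x hx => hr (hrR.trans (le_of_lt hx))
  have hann : IsCompact (e.symm '' {x : Plane | r ≤ ‖x‖ ∧ ‖x‖ ≤ R}) := by
    refine IsCompact.image_of_continuousOn ?_ (e.continuousOn_symm.mono fun x hx => hr hx.1)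
    refine (isCompact_closedBall (0 : Plane) R).of_isClosed_subset ?_ fun x hx => by simpa using hx.2
    exact (isClosed_le continuous_const continuous_norm).inter
      (isClosed_le continuous_norm continuous_const)
  refine ε.subset_component K
    ((isPreconnected_exterior (hr0.trans_le hrR)).image _ (e.continuousOn_symm.mono hsub))
    (hR₁ R ((le_max_right _ _).trans hR)) ?_
  -- Adding `K₀` and the closed annulus to `K` forces a point of the end beyond `K'` to lie over the
  -- exterior of radius `R`. This identifies the component of the complement of `K` that contains
  -- the exterior.
  let K' : TopologicalSpace.Compacts M := K₀ ⊔ K ⊔ ⟨_, hann⟩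
  obtain ⟨m, hm⟩ := ε.component_nonempty K'
  have hm₀ : m ∈ ε.component K₀ := ε.antitone K₀ K' (le_sup_left.trans le_sup_left) hm
  rw [hK₀] at hm₀
  obtain ⟨x, hx, rfl⟩ := hm₀
  refine ⟨e.symm x, ⟨x, ?_, rfl⟩, ε.antitone K K' (le_sup_right.trans le_sup_left) hm⟩
  by_contra hxR
  refine ε.component_subset_compl K' hm (Or.inr ⟨x, ⟨le_of_lt hx, not_lt.1 hxR⟩, rfl⟩)

end

/-! ### The flux density and its pointwise divergence. -/

section

open MeasureTheory

/-- The partial derivative of a scalar function on the plane. -/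
def scalarPartial (f : Plane → ℝ) (i : Fin 2) (p : Plane) : ℝ :=
  fderiv ℝ f p (EuclideanSpace.single i 1)

/-- The Dirichlet pairing `⟨∇f, k⟩ dA` of a covector `(l₀, l₁)` with the tangential part of a
vector `k`, in terms of the tangent vectors `a`, `b` of the coordinate lines. -/
def fluxForm (a b k : Space) (l₀ l₁ : ℝ) : ℝ :=
  ((l₀ * inner ℝ b b - l₁ * inner ℝ a b) * inner ℝ a k
    + (l₁ * inner ℝ a a - l₀ * inner ℝ a b) * inner ℝ b k)
    / √(inner ℝ a a * inner ℝ b b - inner ℝ a b ^ 2)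

/-- The density of the flux of the vector field `k` along the surface `Y`, tested with `f`. -/
def fluxDensity (Y : Plane → Space) (f : Plane → ℝ) (k : Plane → Space) (p : Plane) : ℝ :=
  fluxForm (partialDeriv Y 0 p) (partialDeriv Y 1 p) (k p) (scalarPartial f 0 p)
    (scalarPartial f 1 p)

/-- The component of the tangential part of `k` along `a`, as a vector density. -/
def fluxCoeff (a b k : Space) : ℝ :=
  (inner ℝ b b * inner ℝ a k - inner ℝ a b * inner ℝ b k)
    / √(inner ℝ a a * inner ℝ b b - inner ℝ a b ^ 2)

theorem fluxForm_eq (a b k : Space) (l₀ l₁ : ℝ) :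
    fluxForm a b k l₀ l₁ = l₀ * fluxCoeff a b k + l₁ * fluxCoeff b a k := by
  have h : inner ℝ b b * inner ℝ a a - inner ℝ b a ^ 2
      = inner ℝ a a * inner ℝ b b - inner ℝ a b ^ 2 := by
    rw [real_inner_comm a b]; ring
  unfold fluxForm fluxCoeff
  rw [h, real_inner_comm a b]
  ring

/-- The numerator scales with the square of the determinant and the area element with its absolute
value. The flux form is therefore a density and can be integrated independently of charts. -/
theorem fluxForm_change_basis (a b k : Space) (l₀ l₁ α β γ δ : ℝ) :
    fluxForm (α • a + β • b) (γ • a + δ • b) k (α * l₀ + β * l₁) (γ * l₀ + δ * l₁)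
      = |α * δ - β * γ| * fluxForm a b k l₀ l₁ := by
  have hs : inner ℝ (α • a + β • b) (α • a + β • b) * inner ℝ (γ • a + δ • b) (γ • a + δ • b)
      - inner ℝ (α • a + β • b) (γ • a + δ • b) ^ 2
      = (α * δ - β * γ) ^ 2 * (inner ℝ a a * inner ℝ b b - inner ℝ a b ^ 2) := by
    simp only [inner_add_left, inner_add_right, real_inner_smul_left, real_inner_smul_right]
    rw [real_inner_comm a b]
    ring
  have hn : ∀ x y z : ℝ, (x ^ 2 * y) / (|x| * z) = |x| * (y / z) := fun x y z => by
    rcases eq_or_ne x 0 with rfl | hx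
    · simp
    · rw [← sq_abs]; field_simp
  unfold fluxForm
  rw [hs, Real.sqrt_mul (sq_nonneg _), Real.sqrt_sq_eq_abs, ← hn]
  congr 1
  simp only [inner_add_left, inner_add_right, real_inner_smul_left, real_inner_smul_right]
  rw [real_inner_comm a b]
  ring

theorem gram_pos {a b : Space} (h : LinearIndependent ℝ ![a, b]) :
    0 < inner ℝ a a * inner ℝ b b - inner ℝ a b ^ 2 := by
  have ha : a ≠ 0 := by simpa using h.ne_zero 0
  have haa : 0 < inner ℝ a a := real_inner_self_pos.2 ha
  have hne : inner ℝ a a • b - inner ℝ a b • a ≠ 0 := by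
    intro h0
    rw [LinearIndependent.pair_iff] at h
    have := h (-inner ℝ a b) (inner ℝ a a) (by rw [← h0, neg_smul]; abel)
    exact haa.ne' this.2
  have h2 := real_inner_self_pos.2 hne
  simp only [inner_sub_left, inner_sub_right, real_inner_smul_left, real_inner_smul_right] at h2
  rw [real_inner_comm a b] at h2
  by_contra hc
  nlinarith

/-- The cross product in Euclidean space. -/
def spaceCross (a b : Space) : Space := WithLp.toLp 2 (crossProduct (WithLp.ofLp a) (WithLp.ofLp b))

/-- This is the expansion of `⟪y, k⟫` in the basis `a`, `b`, `a × b`, multiplied by the Gram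
determinant, which equals `‖a × b‖ ^ 2`. Applied to the second derivatives `y`, it separates the
second fundamental form from the Christoffel terms. -/
theorem gram_mul_inner (a b y k : Space) :
    (inner ℝ a a * inner ℝ b b - inner ℝ a b ^ 2) * inner ℝ y k
      = inner ℝ y (spaceCross a b) * inner ℝ (spaceCross a b) k
        + (inner ℝ b b * inner ℝ y a - inner ℝ a b * inner ℝ y b) * inner ℝ a k
        + (inner ℝ a a * inner ℝ y b - inner ℝ a b * inner ℝ y a) * inner ℝ b k := by
  simp only [PiLp.inner_apply, Fin.sum_univ_three, RCLike.inner_apply, conj_trivial, spaceCross,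
    cross_apply, Matrix.cons_val]
  ring

theorem hasDerivAt_fluxCoeff {a b k : ℝ → Space} {a' b' k' : Space} {t : ℝ}
    (ha : HasDerivAt a a' t) (hb : HasDerivAt b b' t) (hk : HasDerivAt k k' t)
    (hs : 0 < inner ℝ (a t) (a t) * inner ℝ (b t) (b t) - inner ℝ (a t) (b t) ^ 2) :
    HasDerivAt (fun t => fluxCoeff (a t) (b t) (k t))
      (((2 * inner ℝ b' (b t) * inner ℝ (a t) (k t)
        + inner ℝ (b t) (b t) * (inner ℝ a' (k t) + inner ℝ (a t) k')
        - (inner ℝ a' (b t) + inner ℝ b' (a t)) * inner ℝ (b t) (k t)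
        - inner ℝ (a t) (b t) * (inner ℝ b' (k t) + inner ℝ (b t) k'))
        * (inner ℝ (a t) (a t) * inner ℝ (b t) (b t) - inner ℝ (a t) (b t) ^ 2)
        - (inner ℝ (b t) (b t) * inner ℝ (a t) (k t) - inner ℝ (a t) (b t) * inner ℝ (b t) (k t))
        * (inner ℝ a' (a t) * inner ℝ (b t) (b t) + inner ℝ (a t) (a t) * inner ℝ b' (b t)
          - inner ℝ (a t) (b t) * (inner ℝ a' (b t) + inner ℝ b' (a t))))
        / √(inner ℝ (a t) (a t) * inner ℝ (b t) (b t) - inner ℝ (a t) (b t) ^ 2) ^ 3) t := by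
  have hss := Real.sq_sqrt hs.le
  have hsp := Real.sqrt_pos.2 hs
  have h := (((hb.inner ℝ hb).mul (ha.inner ℝ hk)).sub ((ha.inner ℝ hb).mul (hb.inner ℝ hk))).div
    ((((ha.inner ℝ ha).mul (hb.inner ℝ hb)).sub ((ha.inner ℝ hb).pow 2)).sqrt hs.ne') hsp.ne'
  refine h.congr_deriv ?_
  simp only [Pi.sub_apply, Pi.mul_apply, Pi.pow_apply]
  rw [real_inner_comm b' (b t), real_inner_comm b' (a t), real_inner_comm a' (a t)]
  set s := √(inner ℝ (a t) (a t) * inner ℝ (b t) (b t) - inner ℝ (a t) (b t) ^ 2) with hsdef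
  rw [← hss]
  field_simp
  ring

/-- Horizontal and vertical contributions of the second derivatives cancel when the mean
curvature vanishes. -/
theorem flux_divergence_identity {E F G ak bk aA0 bA0 aA1 bA1 y00a y00b y00k y00n y01a y01b y01k
    y01n y11a y11b y11k y11n nk : ℝ}
    (h00 : (E * G - F ^ 2) * y00k = y00n * nk + (G * y00a - F * y00b) * ak
      + (E * y00b - F * y00a) * bk)
    (h01 : (E * G - F ^ 2) * y01k = y01n * nk + (G * y01a - F * y01b) * ak
      + (E * y01b - F * y01a) * bk)
    (h11 : (E * G - F ^ 2) * y11k = y11n * nk + (G * y11a - F * y11b) * ak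
      + (E * y11b - F * y11a) * bk)
    (hH : y00n * G - 2 * y01n * F + y11n * E = 0)
    (h0 : aA0 = 0) (h1 : bA1 = 0) (h2 : aA1 = -bA0) :
    ((2 * y01b * ak + G * (y00k + aA0) - (y00b + y01a) * bk - F * (y01k + bA0)) * (E * G - F ^ 2)
      - (G * ak - F * bk) * (y00a * G + E * y01b - F * (y00b + y01a)))
    + ((2 * y01a * bk + E * (y11k + bA1) - (y11a + y01b) * ak - F * (y01k + aA1))
      * (E * G - F ^ 2)
      - (E * bk - F * ak) * (y11b * E + G * y01a - F * (y11a + y01b))) = 0 := by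
  subst h0 h1 h2
  -- The weights `G`, `-2F`, `E` form the trace with respect to the first fundamental form. The
  -- tangential parts cancel against the derivatives of the metric, and the normal part is the mean
  -- curvature numerator times `nk`.
  linear_combination G * h00 - 2 * F * h01 + E * h11 + nk * hH

end

/-! ### Killing fields on a minimal surface: zero divergence, integration by parts. -/

section

open MeasureTheory

theorem ContDiffOn.partialDeriv {Y : Plane → Space} {Ω : Set Plane} (hΩ : IsOpen Ω)
    (hY : ContDiffOn ℝ ∞ Y Ω) (i : Fin 2) : ContDiffOn ℝ ∞ (_root_.partialDeriv Y i) Ω :=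
  (hY.fderiv_of_isOpen hΩ (by simp)).clm_apply contDiffOn_const

theorem ContDiffOn.scalarPartial {f : Plane → ℝ} {Ω : Set Plane} (hΩ : IsOpen Ω)
    (hf : ContDiffOn ℝ ∞ f Ω) (i : Fin 2) : ContDiffOn ℝ ∞ (_root_.scalarPartial f i) Ω :=
  (hf.fderiv_of_isOpen hΩ (by simp)).clm_apply contDiffOn_const

theorem contDiffOn_fluxCoeff {a b k : Plane → Space} {Ω : Set Plane} (ha : ContDiffOn ℝ ∞ a Ω)
    (hb : ContDiffOn ℝ ∞ b Ω) (hk : ContDiffOn ℝ ∞ k Ω)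
    (hpos : ∀ p ∈ Ω, 0 < inner ℝ (a p) (a p) * inner ℝ (b p) (b p) - inner ℝ (a p) (b p) ^ 2) :
    ContDiffOn ℝ ∞ (fun p => _root_.fluxCoeff (a p) (b p) (k p)) Ω := by
  unfold _root_.fluxCoeff
  exact (((hb.inner ℝ hb).mul (ha.inner ℝ hk)).sub ((ha.inner ℝ hb).mul (hb.inner ℝ hk))).div
    (ContDiffOn.sqrt (((ha.inner ℝ ha).mul (hb.inner ℝ hb)).sub ((ha.inner ℝ hb).pow 2))
      fun p hp => (hpos p hp).ne') fun p hp => (Real.sqrt_pos.2 (hpos p hp)).ne'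

theorem ContDiffOn.fluxCoeff_zero_one {Y k : Plane → Space} {Ω : Set Plane} (hΩ : IsOpen Ω)
    (hY : ContDiffOn ℝ ∞ Y Ω) (hk : ContDiffOn ℝ ∞ k Ω) (hpos : ∀ p ∈ Ω, 0 < firstFormDet Y p) :
    ContDiffOn ℝ ∞ (fun p => _root_.fluxCoeff (_root_.partialDeriv Y 0 p)
      (_root_.partialDeriv Y 1 p) (k p)) Ω :=
  contDiffOn_fluxCoeff (hY.partialDeriv hΩ 0) (hY.partialDeriv hΩ 1) hk hpos

theorem ContDiffOn.fluxCoeff_one_zero {Y k : Plane → Space} {Ω : Set Plane} (hΩ : IsOpen Ω)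
    (hY : ContDiffOn ℝ ∞ Y Ω) (hk : ContDiffOn ℝ ∞ k Ω) (hpos : ∀ p ∈ Ω, 0 < firstFormDet Y p) :
    ContDiffOn ℝ ∞ (fun p => _root_.fluxCoeff (_root_.partialDeriv Y 1 p)
      (_root_.partialDeriv Y 0 p) (k p)) Ω := by
  refine contDiffOn_fluxCoeff (hY.partialDeriv hΩ 1) (hY.partialDeriv hΩ 0) hk fun p hp => ?_
  have := hpos p hp
  unfold firstFormDet firstForm at this
  rw [real_inner_comm, mul_comm] at this
  convert this using 3
  exact real_inner_comm _ _

theorem fderiv_partialDeriv_symm {Y : Plane → Space} {Ω : Set Plane} (hΩ : IsOpen Ω)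
    (hY : ContDiffOn ℝ ∞ Y Ω) {p : Plane} (hp : p ∈ Ω) :
    fderiv ℝ (partialDeriv Y 1) p (EuclideanSpace.single 0 1)
      = fderiv ℝ (partialDeriv Y 0) p (EuclideanSpace.single 1 1) := by
  have hYp : ContDiffAt ℝ ∞ Y p := hY.contDiffAt (hΩ.mem_nhds hp)
  have hd : DifferentiableAt ℝ (fderiv ℝ Y) p :=
    ((hYp.fderiv_right (m := 1) (by norm_cast)).differentiableAt (by simp))
  have h := hYp.isSymmSndFDerivAt (by simp; norm_cast)
  have hv : ∀ i : Fin 2, HasFDerivAt (partialDeriv Y i)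
      ((ContinuousLinearMap.apply ℝ Space (EuclideanSpace.single i (1 : ℝ))).comp
        (fderiv ℝ (fderiv ℝ Y) p)) p := fun i =>
    (ContinuousLinearMap.apply ℝ Space (EuclideanSpace.single i (1 : ℝ))).hasFDerivAt.comp p
      hd.hasFDerivAt
  rw [(hv 0).fderiv, (hv 1).fderiv]
  exact h _ _

/-- Normalising the normal only contributes a nonzero factor. The unnormalised cross product is the
one that occurs in `gram_mul_inner`. -/
theorem mean_curvature_numerator_eq_zero {Y : Plane → Space} {p : Plane}
    (hpos : 0 < firstFormDet Y p) (hH : meanCurvature Y p = 0) :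
    inner ℝ (partialDeriv (partialDeriv Y 0) 0 p) (normalField Y p) * firstForm Y 1 1 p
      - 2 * inner ℝ (partialDeriv (partialDeriv Y 0) 1 p) (normalField Y p) * firstForm Y 0 1 p
      + inner ℝ (partialDeriv (partialDeriv Y 1) 1 p) (normalField Y p) * firstForm Y 0 0 p
      = 0 := by
  rcases eq_or_ne (normalField Y p) 0 with h0 | h0
  · simp [h0]
  have h1 : 2 * firstFormDet Y p ≠ 0 := by positivity
  unfold meanCurvature at hH
  rw [div_eq_zero_iff, or_iff_left h1] at hH
  simp only [secondForm, unitNormal, real_inner_smul_right] at hH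
  have hn : ‖normalField Y p‖⁻¹ ≠ 0 := inv_ne_zero (norm_ne_zero_iff.2 h0)
  refine (mul_eq_zero.1 (?_ : ‖normalField Y p‖⁻¹ * _ = 0)).resolve_left hn
  rw [← hH]
  ring

/-- On a minimal surface, the tangential part of a Killing field of Euclidean space has zero
divergence. -/
theorem fluxCoeff_divergence_eq_zero {Y : Plane → Space} {Ω : Set Plane} (hΩ : IsOpen Ω)
    (hY : ContDiffOn ℝ ∞ Y Ω) (hpos : ∀ p ∈ Ω, 0 < firstFormDet Y p)
    (hH : ∀ p ∈ Ω, meanCurvature Y p = 0) {A : Space →L[ℝ] Space} (hA : ∀ x, inner ℝ x (A x) = 0)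
    (v : Space) {p : Plane} (hp : p ∈ Ω) :
    scalarPartial (fun q => fluxCoeff (partialDeriv Y 0 q) (partialDeriv Y 1 q) (v + A (Y q))) 0 p
    + scalarPartial (fun q => fluxCoeff (partialDeriv Y 1 q) (partialDeriv Y 0 q) (v + A (Y q))) 1 p
      = 0 := by
  have hk : ContDiffOn ℝ ∞ (fun q => v + A (Y q)) Ω :=
    contDiffOn_const.add (A.contDiff.comp_contDiffOn hY)
  have line : ∀ {E : Type} [NormedAddCommGroup E] [NormedSpace ℝ E] {g : Plane → E} (i : Fin 2),
      ContDiffOn ℝ ∞ g Ω → HasDerivAt (fun t : ℝ => g (p + t • EuclideanSpace.single i 1))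
        (fderiv ℝ g p (EuclideanSpace.single i 1)) 0 := fun i hg =>
    ((hg.contDiffAt (hΩ.mem_nhds hp)).differentiableAt (by simp)).hasFDerivAt.hasLineDerivAt _
  have e0 : ∀ i : Fin 2, p + (0 : ℝ) • EuclideanSpace.single i (1 : ℝ) = p := by simp
  have hk' : ∀ i : Fin 2, fderiv ℝ (fun q => v + A (Y q)) p (EuclideanSpace.single i 1)
      = A (partialDeriv Y i p) := fun i => by
    have := (A.hasFDerivAt.comp p ((hY.contDiffAt (hΩ.mem_nhds hp)).differentiableAt
      (by simp)).hasFDerivAt).const_add v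
    have h2 : HasFDerivAt (fun q => v + A (Y q)) (A.comp (fderiv ℝ Y p)) p := this
    rw [h2.fderiv]; rfl
  have hp0 := hpos p hp
  have hpos' : 0 < inner ℝ (partialDeriv Y 1 p) (partialDeriv Y 1 p)
      * inner ℝ (partialDeriv Y 0 p) (partialDeriv Y 0 p)
      - inner ℝ (partialDeriv Y 1 p) (partialDeriv Y 0 p) ^ 2 := by
    have := hp0
    unfold firstFormDet firstForm at this
    rw [real_inner_comm (partialDeriv Y 0 p) (partialDeriv Y 1 p), mul_comm]
    exact this
  have d0 := hasDerivAt_fluxCoeff (line 0 (hY.partialDeriv hΩ 0)) (line 0 (hY.partialDeriv hΩ 1))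
    (line 0 hk) (by rw [e0]; exact hp0)
  have d1 := hasDerivAt_fluxCoeff (line 1 (hY.partialDeriv hΩ 1)) (line 1 (hY.partialDeriv hΩ 0))
    (line 1 hk) (by rw [e0]; exact hpos')
  have u0 := (line 0 (hY.fluxCoeff_zero_one hΩ hk hpos)).unique d0
  have u1 := (line 1 (hY.fluxCoeff_one_zero hΩ hk hpos)).unique d1
  unfold scalarPartial
  rw [u0, u1]
  simp only [e0, hk']
  rw [fderiv_partialDeriv_symm hΩ hY hp]
  have hm := mean_curvature_numerator_eq_zero hp0 (hH p hp)
  unfold firstForm at hm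
  rw [show partialDeriv (partialDeriv Y 0) 1 p = fderiv ℝ (partialDeriv Y 0) p
    (EuclideanSpace.single 1 1) from rfl, show partialDeriv (partialDeriv Y 0) 0 p =
    fderiv ℝ (partialDeriv Y 0) p (EuclideanSpace.single 0 1) from rfl,
    show partialDeriv (partialDeriv Y 1) 1 p =
    fderiv ℝ (partialDeriv Y 1) p (EuclideanSpace.single 1 1) from rfl,
    show normalField Y p = spaceCross (partialDeriv Y 0 p) (partialDeriv Y 1 p) from rfl] at hm
  generalize fderiv ℝ (partialDeriv Y 0) p (EuclideanSpace.single 0 1) = y00 at *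
  generalize fderiv ℝ (partialDeriv Y 0) p (EuclideanSpace.single 1 1) = y01 at *
  generalize fderiv ℝ (partialDeriv Y 1) p (EuclideanSpace.single 1 1) = y11 at *
  unfold firstFormDet firstForm at hp0
  generalize partialDeriv Y 0 p = a at *
  generalize partialDeriv Y 1 p = b at *
  generalize v + A (Y p) = k at *
  -- Polarisation of `⟪x, A x⟫ = 0`.
  have hskew : inner ℝ a (A b) = - inner ℝ b (A a) := by
    have := hA (a + b)
    simp only [map_add, inner_add_left, inner_add_right, hA] at this
    linarith
  have key := flux_divergence_identity (gram_mul_inner a b y00 k) (gram_mul_inner a b y01 k)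
    (gram_mul_inner a b y11 k) hm (hA a) (hA b) hskew
  rw [real_inner_comm a b, mul_comm (inner ℝ b b) (inner ℝ a a), ← add_div, div_eq_zero_iff]
  left
  linear_combination key

theorem integrable_of_continuousOn_of_eq_zero {f : Plane → ℝ} {Ω S : Set Plane} (hΩ : IsOpen Ω)
    (hf : ContinuousOn f Ω) (hS : IsCompact S) (hSΩ : S ⊆ Ω) (h0 : ∀ x ∉ S, f x = 0) :
    Continuous f ∧ Integrable f := by
  have hc : Continuous f := by
    rw [continuous_iff_continuousAt]
    intro x
    by_cases hx : x ∈ Ω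
    · exact hf.continuousAt (hΩ.mem_nhds hx)
    · have : f =ᶠ[𝓝 x] fun _ => 0 := by
        filter_upwards [hS.isClosed.isOpen_compl.mem_nhds fun h => hx (hSΩ h)] with y hy
        exact h0 y hy
      exact continuousAt_const.congr this.symm
  exact ⟨hc, hc.integrable_of_hasCompactSupport (HasCompactSupport.intro hS h0)⟩

/-- The divergence theorem for a vector field that has zero divergence on an open set, tested with a function of
compact support in that set. -/
theorem integral_gradient_divergence_free {V₀ V₁ ψ : Plane → ℝ} {Ω : Set Plane} (hΩ : IsOpen Ω)
    (hV₀ : ContDiffOn ℝ ∞ V₀ Ω) (hV₁ : ContDiffOn ℝ ∞ V₁ Ω)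
    (hdiv : ∀ p ∈ Ω, scalarPartial V₀ 0 p + scalarPartial V₁ 1 p = 0) (hψ : ContDiff ℝ ∞ ψ)
    (hc : HasCompactSupport ψ) (hs : tsupport ψ ⊆ Ω) :
    ∫ p, (scalarPartial ψ 0 p * V₀ p + scalarPartial ψ 1 p * V₁ p) = 0 := by
  have hψ' : ∀ i, Continuous (scalarPartial ψ i) := fun i =>
    continuousOn_univ.1
      ((hψ.contDiffOn (s := Set.univ)).scalarPartial isOpen_univ i).continuousOn
  have hz : ∀ x ∉ tsupport ψ, ψ x = 0 := fun x hx => image_eq_zero_of_notMem_tsupport hx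
  have hz' : ∀ i, ∀ x ∉ tsupport ψ, scalarPartial ψ i x = 0 := fun i x hx => by
    unfold scalarPartial
    rw [fderiv_of_notMem_tsupport ℝ hx]; rfl
  have parts : ∀ (i : Fin 2) {V : Plane → ℝ}, ContDiffOn ℝ ∞ V Ω →
      Integrable (fun p => scalarPartial ψ i p * V p) ∧
      Integrable (fun p => ψ p * scalarPartial V i p) ∧
      ∫ p, ψ p * scalarPartial V i p = - ∫ p, scalarPartial ψ i p * V p := by
    intro i V hV
    have i1 := (integrable_of_continuousOn_of_eq_zero hΩ
      ((hψ' i).continuousOn.mul hV.continuousOn) hc.isCompact hs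
      fun x hx => by simp [hz' i x hx]).2
    have i2 := (integrable_of_continuousOn_of_eq_zero hΩ
      (hψ.continuous.continuousOn.mul (hV.scalarPartial hΩ i).continuousOn) hc.isCompact hs
      fun x hx => by simp [hz x hx]).2
    have i3 := (integrable_of_continuousOn_of_eq_zero hΩ
      (hψ.continuous.continuousOn.mul hV.continuousOn) hc.isCompact hs
      fun x hx => by simp [hz x hx]).2
    exact ⟨i1, i2, integral_mul_fderiv_eq_neg_fderiv_mul_of_integrable i1 i2 i3
      (fun x _ => hψ.differentiable (by simp) x)
      (fun x hx => (hV.contDiffAt (hΩ.mem_nhds (hs hx))).differentiableAt (by simp))⟩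
  obtain ⟨a1, a2, a3⟩ := parts 0 hV₀
  obtain ⟨b1, b2, b3⟩ := parts 1 hV₁
  rw [integral_add a1 b1, ← neg_eq_zero, neg_add, ← a3, ← b3, ← integral_add a2 b2]
  refine integral_eq_zero_of_ae (Filter.Eventually.of_forall fun p => ?_)
  by_cases hp : p ∈ tsupport ψ
  · simp only [Pi.zero_apply]
    rw [← mul_add, hdiv p (hs hp), mul_zero]
  · simp [hz p hp]

end

/-! ### Independence of the flux from the chart. -/

section

open MeasureTheory

theorem fluxDensity_congr {Y Y' : Plane → Space} {f f' : Plane → ℝ} {k k' : Plane → Space}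
    {p : Plane} (hY : Y =ᶠ[𝓝 p] Y') (hf : f =ᶠ[𝓝 p] f') (hk : k p = k' p) :
    fluxDensity Y f k p = fluxDensity Y' f' k' p := by
  unfold fluxDensity partialDeriv scalarPartial
  rw [hY.fderiv_eq, hf.fderiv_eq, hk]

theorem continuousLinearMap_single (L : Plane →L[ℝ] Plane) (i : Fin 2) :
    L (EuclideanSpace.single i 1) = L (EuclideanSpace.single i 1) 0 • EuclideanSpace.single 0 1
      + L (EuclideanSpace.single i 1) 1 • EuclideanSpace.single 1 1 := by
  ext j
  fin_cases j <;> simp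

theorem det_eq_of_plane (L : Plane →L[ℝ] Plane) :
    L.det = L (EuclideanSpace.single 0 1) 0 * L (EuclideanSpace.single 1 1) 1
      - L (EuclideanSpace.single 0 1) 1 * L (EuclideanSpace.single 1 1) 0 := by
  rw [ContinuousLinearMap.det, ← LinearMap.det_toMatrix (EuclideanSpace.basisFun (Fin 2) ℝ).toBasis,
    Matrix.det_fin_two]
  simp [LinearMap.toMatrix_apply]
  ring

/-- By the chain rule the partial derivatives of `Y` and of `f` undergo the same change of basis,
with the matrix of `fderiv ℝ τ p`, so `fluxForm_change_basis` applies. -/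
theorem fluxDensity_comp {Y : Plane → Space} {f : Plane → ℝ} {τ : Plane → Plane} {p : Plane}
    (k : Plane → Space) (hY : DifferentiableAt ℝ Y (τ p)) (hf : DifferentiableAt ℝ f (τ p))
    (hτ : DifferentiableAt ℝ τ p) :
    fluxDensity (Y ∘ τ) (f ∘ τ) (k ∘ τ) p
      = |(fderiv ℝ τ p).det| * fluxDensity Y f k (τ p) := by
  unfold fluxDensity partialDeriv scalarPartial
  rw [fderiv_comp p hY hτ, fderiv_comp p hf hτ, det_eq_of_plane, ← fluxForm_change_basis]
  simp only [ContinuousLinearMap.comp_apply, Function.comp_apply]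
  rw [continuousLinearMap_single (fderiv ℝ τ p) 0, continuousLinearMap_single (fderiv ℝ τ p) 1]
  simp only [map_add, map_smul, smul_eq_mul, PiLp.add_apply, PiLp.smul_apply, mul_comm]
  simp

theorem transition_image {M : Type*} [TopologicalSpace M] (c c' : OpenPartialHomeomorph M Plane) :
    (c' ∘ c.symm) '' (c.symm.trans c').source = (c'.symm.trans c).source :=
  (c.symm.trans c').image_source_eq_target

section Manifold

set_option linter.unusedSectionVars false

variable {M : Type*} [TopologicalSpace M] [ChartedSpace Plane M]

theorem contDiffOn_comp_symm {E : Type*} [NormedAddCommGroup E] [NormedSpace ℝ E] {f : M → E}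
    (hf : ContMDiff 𝓘(ℝ, Plane) 𝓘(ℝ, E) ∞ f) {c : OpenPartialHomeomorph M Plane}
    (hc : c ∈ IsManifold.maximalAtlas 𝓘(ℝ, Plane) ∞ M) :
    ContDiffOn ℝ ∞ (f ∘ c.symm) c.target := by
  rw [← contMDiffOn_iff_contDiffOn]
  exact hf.comp_contMDiffOn (contMDiffOn_symm_of_mem_maximalAtlas hc)

theorem contDiffOn_transition {c c' : OpenPartialHomeomorph M Plane}
    (hc : c ∈ IsManifold.maximalAtlas 𝓘(ℝ, Plane) ∞ M)
    (hc' : c' ∈ IsManifold.maximalAtlas 𝓘(ℝ, Plane) ∞ M) :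
    ContDiffOn ℝ ∞ (c' ∘ c.symm) (c.symm.trans c').source := by
  rw [← contMDiffOn_iff_contDiffOn, OpenPartialHomeomorph.trans_source]
  exact (contMDiffOn_of_mem_maximalAtlas hc').comp
    ((contMDiffOn_symm_of_mem_maximalAtlas hc).mono Set.inter_subset_left) fun x hx => hx.2

/-- The density of the flux of the field `k` along `X`, in the chart `c`. -/
def chartDensity (X : M → Space) (k : Space → Space) (f : M → ℝ)
    (c : OpenPartialHomeomorph M Plane) (y : Plane) : ℝ :=
  fluxDensity (X ∘ c.symm) (f ∘ c.symm) (fun y => k (X (c.symm y))) y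

/-- The part in the chart `c`, with weight `w`, of the flux of `k` tested with `f`. -/
def chartFlux (X : M → Space) (k : Space → Space) (w f : M → ℝ)
    (c : OpenPartialHomeomorph M Plane) : ℝ :=
  ∫ y in c.target, w (c.symm y) * chartDensity X k f c y

/-- Integrability of the integrand of `chartFlux`. -/
def ChartFluxIntegrable (X : M → Space) (k : Space → Space) (w f : M → ℝ)
    (c : OpenPartialHomeomorph M Plane) : Prop :=
  IntegrableOn (fun y => w (c.symm y) * chartDensity X k f c y) c.target

variable {X : M → Space} {k : Space → Space} {w f : M → ℝ} {c c' : OpenPartialHomeomorph M Plane}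

theorem chartDensity_transition (hX : ContMDiff 𝓘(ℝ, Plane) 𝓘(ℝ, Space) ∞ X)
    (hf : ContMDiff 𝓘(ℝ, Plane) 𝓘(ℝ, ℝ) ∞ f)
    (hc : c ∈ IsManifold.maximalAtlas 𝓘(ℝ, Plane) ∞ M)
    (hc' : c' ∈ IsManifold.maximalAtlas 𝓘(ℝ, Plane) ∞ M) {y : Plane}
    (hy : y ∈ (c.symm.trans c').source) :
    chartDensity X k f c y
      = |(fderiv ℝ (c' ∘ c.symm) y).det| * chartDensity X k f c' ((c' ∘ c.symm) y) := by
  have hy' := hy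
  rw [OpenPartialHomeomorph.trans_source] at hy'
  have hev : ∀ᶠ z in 𝓝 y, c'.symm (c' (c.symm z)) = c.symm z := by
    filter_upwards [(c.symm.trans c').open_source.mem_nhds hy] with z hz
    rw [OpenPartialHomeomorph.trans_source] at hz
    exact c'.left_inv hz.2
  have ht : (c' ∘ c.symm) y ∈ c'.target := c'.map_source hy'.2
  have hn := c'.open_target.mem_nhds ht
  unfold chartDensity
  rw [← fluxDensity_comp (fun y => k (X (c'.symm y)))
    (((contDiffOn_comp_symm hX hc').contDiffAt hn).differentiableAt (by simp))
    (((contDiffOn_comp_symm hf hc').contDiffAt hn).differentiableAt (by simp))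
    (((contDiffOn_transition hc hc').contDiffAt
      ((c.symm.trans c').open_source.mem_nhds hy)).differentiableAt (by simp))]
  refine fluxDensity_congr ?_ ?_ ?_
  · filter_upwards [hev] with z hz
    simp [hz]
  · filter_upwards [hev] with z hz
    simp [hz]
  · simp [hev.self_of_nhds]

/-- The weight restricts both integrals to the overlap of the charts, where the factor `|det|` in
`chartDensity_transition` is the Jacobian of the change of variables. -/
theorem chart_change (hX : ContMDiff 𝓘(ℝ, Plane) 𝓘(ℝ, Space) ∞ X)
    (hf : ContMDiff 𝓘(ℝ, Plane) 𝓘(ℝ, ℝ) ∞ f)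
    (hc : c ∈ IsManifold.maximalAtlas 𝓘(ℝ, Plane) ∞ M)
    (hc' : c' ∈ IsManifold.maximalAtlas 𝓘(ℝ, Plane) ∞ M)
    (hw : ∀ m, m ∉ c.source ∩ c'.source → w m = 0) :
    chartFlux X k w f c = chartFlux X k w f c' ∧
      (ChartFluxIntegrable X k w f c → ChartFluxIntegrable X k w f c') := by
  have hsub : ∀ {c c' : OpenPartialHomeomorph M Plane},
      (c.symm.trans c').source ⊆ c.target := fun {c c'} y hy => by
    rw [OpenPartialHomeomorph.trans_source] at hy; exact hy.1
  have hzero : ∀ {c c' : OpenPartialHomeomorph M Plane}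
      (_ : ∀ m, m ∉ c.source ∩ c'.source → w m = 0),
      ∀ y ∈ c.target \ (c.symm.trans c').source,
      w (c.symm y) * chartDensity X k f c y = 0 := fun {c c'} hw y hy => by
    rw [hw, zero_mul]
    intro h
    exact hy.2 (by rw [OpenPartialHomeomorph.trans_source]; exact ⟨hy.1, h.2⟩)
  have hw' : ∀ m, m ∉ c'.source ∩ c.source → w m = 0 := fun m hm => hw m fun h => hm ⟨h.2, h.1⟩
  have hS := (c.symm.trans c').open_source
  have hd : ∀ y ∈ (c.symm.trans c').source, HasFDerivWithinAt (c' ∘ c.symm)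
      (fderiv ℝ (c' ∘ c.symm) y) (c.symm.trans c').source y := fun y hy =>
    (((contDiffOn_transition hc hc').contDiffAt (hS.mem_nhds hy)).differentiableAt
      (by simp)).hasFDerivAt.hasFDerivWithinAt
  have hinj : Set.InjOn (c' ∘ c.symm) (c.symm.trans c').source := (c.symm.trans c').injOn
  have heq : ∀ y ∈ (c.symm.trans c').source,
      |(fderiv ℝ (c' ∘ c.symm) y).det| • (w (c'.symm ((c' ∘ c.symm) y))
        * chartDensity X k f c' ((c' ∘ c.symm) y)) = w (c.symm y) * chartDensity X k f c y := by
    intro y hy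
    rw [chartDensity_transition hX hf hc hc' hy]
    rw [OpenPartialHomeomorph.trans_source] at hy
    rw [Function.comp_apply, c'.left_inv hy.2, smul_eq_mul]
    ring
  constructor
  · unfold chartFlux
    rw [setIntegral_eq_of_subset_of_forall_sdiff_eq_zero c.open_target.measurableSet hsub (hzero hw),
      setIntegral_eq_of_subset_of_forall_sdiff_eq_zero c'.open_target.measurableSet hsub
        (hzero hw'), ← transition_image c c',
      integral_image_eq_integral_abs_det_fderiv_smul volume hS.measurableSet hd hinj]
    exact (setIntegral_congr_fun hS.measurableSet heq).symm
  · intro h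
    unfold ChartFluxIntegrable at h ⊢
    have h1 : IntegrableOn (fun y => w (c'.symm y) * chartDensity X k f c' y)
        (c'.symm.trans c).source := by
      rw [← transition_image c c',
        integrableOn_image_iff_integrableOn_abs_det_fderiv_smul volume hS.measurableSet hd hinj]
      exact (h.mono_set hsub).congr_fun (fun y hy => (heq y hy).symm) hS.measurableSet
    exact h1.of_forall_sdiff_eq_zero c'.open_target.measurableSet (hzero hw')

end Manifold

end

/-! ### Flux of a Killing field within one chart. -/

section

open MeasureTheory

section Manifold

set_option linter.unusedSectionVars false

variable {M : Type*} [TopologicalSpace M] [ChartedSpace Plane M]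

theorem IsMinimalImmersion.firstFormDet_pos [IsManifold 𝓘(ℝ, Plane) ∞ M] {X : M → Space}
    (hX : IsMinimalImmersion X) {c : OpenPartialHomeomorph M Plane} (hc : c ∈ atlas Plane M)
    {y : Plane} (hy : y ∈ c.target) : 0 < firstFormDet (X ∘ c.symm) y := by
  have : IsManifold 𝓘(ℝ, Plane) 1 M := IsManifold.of_le (n := ∞) (by norm_cast)
  have hmd := mdifferentiable_of_mem_atlas (I := 𝓘(ℝ, Plane)) hc
  have hinj : Function.Injective (fderiv ℝ (X ∘ c.symm) y) := by
    rw [← mfderiv_eq_fderiv, mfderiv_comp y (hX.contMDiff.mdifferentiableAt (by simp))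
      (hmd.mdifferentiableAt_symm hy)]
    exact (hX.injective_mfderiv (c.symm y)).comp (hmd.symm.mfderiv_injective hy)
  refine gram_pos ?_
  have h1 : LinearIndependent ℝ ![(EuclideanSpace.single 0 1 : Plane), EuclideanSpace.single 1 1] := by
    rw [LinearIndependent.pair_iff]
    intro s t h
    exact ⟨by simpa using congrArg (fun v : Plane => v 0) h,
      by simpa using congrArg (fun v : Plane => v 1) h⟩
  have h2 := h1.map' (fderiv ℝ (X ∘ c.symm) y).toLinearMap (LinearMap.ker_eq_bot.2 hinj)
  have h3 : ![partialDeriv (X ∘ c.symm) 0 y, partialDeriv (X ∘ c.symm) 1 y]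
      = (fderiv ℝ (X ∘ c.symm) y).toLinearMap
        ∘ ![(EuclideanSpace.single 0 1 : Plane), EuclideanSpace.single 1 1] := by
    funext i
    fin_cases i <;> rfl
  rw [h3]
  exact h2

variable {X : M → Space} {k : Space → Space} {w f : M → ℝ} {c c' : OpenPartialHomeomorph M Plane}

theorem chartDensity_eq_zero {y : Plane} (hy : y ∈ c.target)
    (hf : ∀ᶠ m in 𝓝 (c.symm y), f m = f (c.symm y)) : chartDensity X k f c y = 0 := by
  have h : f ∘ c.symm =ᶠ[𝓝 y] fun _ => f (c.symm y) :=
    (c.continuousAt_symm hy).eventually hf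
  have h' : ∀ i, scalarPartial (f ∘ c.symm) i y = 0 := fun i => by
    unfold scalarPartial
    rw [h.fderiv_eq]
    simp
  unfold chartDensity fluxDensity
  rw [fluxForm_eq, h', h', zero_mul, zero_mul, zero_add]

theorem chartDensity_eq_zero_of_notMem_tsupport {y : Plane} (hy : y ∈ c.target)
    (hf : c.symm y ∉ tsupport f) : chartDensity X k f c y = 0 := by
  refine chartDensity_eq_zero hy ?_
  have h := notMem_tsupport_iff_eventuallyEq.1 hf
  filter_upwards [h] with m hm
  rw [hm, h.self_of_nhds, Pi.zero_apply, Pi.zero_apply]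

theorem chartDensity_sum {ι : Type*} (s : Finset ι) {g : ι → M → ℝ}
    (hg : ∀ i ∈ s, ContMDiff 𝓘(ℝ, Plane) 𝓘(ℝ, ℝ) ∞ (g i))
    (hc : c ∈ IsManifold.maximalAtlas 𝓘(ℝ, Plane) ∞ M) {y : Plane} (hy : y ∈ c.target) :
    chartDensity X k (fun m => ∑ i ∈ s, g i m) c y = ∑ i ∈ s, chartDensity X k (g i) c y := by
  have h : ∀ j, scalarPartial ((fun m => ∑ i ∈ s, g i m) ∘ c.symm) j y
      = ∑ i ∈ s, scalarPartial (g i ∘ c.symm) j y := fun j => by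
    have := HasFDerivAt.fun_sum (u := s) (A := fun i => g i ∘ c.symm) (x := y)
      fun i hi => (((contDiffOn_comp_symm (hg i hi) hc).contDiffAt
        (c.open_target.mem_nhds hy)).differentiableAt (by simp)).hasFDerivAt
    unfold scalarPartial
    rw [show ((fun m => ∑ i ∈ s, g i m) ∘ c.symm) = fun x => ∑ i ∈ s, (g i ∘ c.symm) x from rfl,
      this.fderiv, sum_apply]
  unfold chartDensity fluxDensity
  simp only [fluxForm_eq, h, Finset.sum_mul, Finset.sum_add_distrib]

theorem continuousOn_chartDensity (hX : ContMDiff 𝓘(ℝ, Plane) 𝓘(ℝ, Space) ∞ X)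
    (hk : ContDiff ℝ ∞ k) (hf : ContMDiff 𝓘(ℝ, Plane) 𝓘(ℝ, ℝ) ∞ f)
    (hc : c ∈ IsManifold.maximalAtlas 𝓘(ℝ, Plane) ∞ M)
    (hpos : ∀ y ∈ c.target, 0 < firstFormDet (X ∘ c.symm) y) :
    ContinuousOn (chartDensity X k f c) c.target := by
  have hY := contDiffOn_comp_symm hX hc
  have hkY : ContDiffOn ℝ ∞ (fun y => k (X (c.symm y))) c.target := hk.comp_contDiffOn hY
  have hf' := contDiffOn_comp_symm hf hc
  unfold chartDensity fluxDensity
  simp only [fluxForm_eq]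
  exact ((hf'.scalarPartial c.open_target 0).continuousOn.mul
    (hY.fluxCoeff_zero_one c.open_target hkY hpos).continuousOn).add
    ((hf'.scalarPartial c.open_target 1).continuousOn.mul
    (hY.fluxCoeff_one_zero c.open_target hkY hpos).continuousOn)

theorem chartFluxIntegrable_of_compact (hX : ContMDiff 𝓘(ℝ, Plane) 𝓘(ℝ, Space) ∞ X)
    (hk : ContDiff ℝ ∞ k) (hf : ContMDiff 𝓘(ℝ, Plane) 𝓘(ℝ, ℝ) ∞ f) (hw : Continuous w)
    (hc : c ∈ IsManifold.maximalAtlas 𝓘(ℝ, Plane) ∞ M)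
    (hpos : ∀ y ∈ c.target, 0 < firstFormDet (X ∘ c.symm) y)
    {S : Set M} (hS : IsCompact S) (hSc : S ⊆ c.source)
    (h0 : ∀ m ∈ c.source, m ∉ S → w m = 0 ∨ m ∉ tsupport f) :
    ChartFluxIntegrable X k w f c := by
  have hS' : IsCompact (c '' S) := hS.image_of_continuousOn (c.continuousOn.mono hSc)
  have hcont : ContinuousOn (fun y => w (c.symm y) * chartDensity X k f c y) c.target :=
    (hw.comp_continuousOn c.continuousOn_symm).mul (continuousOn_chartDensity hX hk hf hc hpos)
  refine ((hcont.mono ?_).integrableOn_compact hS').of_forall_sdiff_eq_zero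
    c.open_target.measurableSet fun y hy => ?_
  · rintro _ ⟨m, hm, rfl⟩
    exact c.map_source (hSc hm)
  · have hyS : c.symm y ∉ S := fun h => hy.2 ⟨_, h, c.right_inv hy.1⟩
    rcases h0 _ (c.map_target hy.1) hyS with h | h
    · simp [h]
    · simp [chartDensity_eq_zero_of_notMem_tsupport hy.1 h]

theorem ChartFluxIntegrable.indicator (h : ChartFluxIntegrable X k w f c) {V : Set M}
    (hV : IsOpen V) : ChartFluxIntegrable X k (V.indicator w) f c := by
  have hm : MeasurableSet (c.target ∩ c.symm ⁻¹' V) :=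
    (c.continuousOn_symm.isOpen_inter_preimage c.open_target hV).measurableSet
  refine ((h.mono_set Set.inter_subset_left : IntegrableOn _ (c.target ∩ c.symm ⁻¹' V)).congr_fun
    (fun y hy => ?_) hm).of_forall_sdiff_eq_zero c.open_target.measurableSet fun y hy => ?_
  · simp only [Set.indicator_of_mem (show c.symm y ∈ V from hy.2)]
  · rw [Set.indicator_of_notMem (s := V) (fun h' => hy.2 ⟨hy.1, h'⟩), zero_mul]

theorem chartFlux_congr {w' f' : M → ℝ} (h : ∀ y ∈ c.target,
    w (c.symm y) * chartDensity X k f c y = w' (c.symm y) * chartDensity X k f' c y) :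
    chartFlux X k w f c = chartFlux X k w' f' c :=
  setIntegral_congr_fun c.open_target.measurableSet h

theorem chartFlux_eq_sum {ι : Type*} {s : Finset ι} {w' f' : ι → M → ℝ}
    (hi : ∀ i ∈ s, ChartFluxIntegrable X k (w' i) (f' i) c)
    (h : ∀ y ∈ c.target, w (c.symm y) * chartDensity X k f c y
      = ∑ i ∈ s, w' i (c.symm y) * chartDensity X k (f' i) c y) :
    chartFlux X k w f c = ∑ i ∈ s, chartFlux X k (w' i) (f' i) c := by
  unfold chartFlux
  rw [setIntegral_congr_fun c.open_target.measurableSet h, integral_finsetSum _ hi]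

/-- The flux of a Killing field of Euclidean space, tested with a function supported in one
chart, vanishes. -/
theorem IsMinimalImmersion.chartFlux_eq_zero [T2Space M] [IsManifold 𝓘(ℝ, Plane) ∞ M]
    (hX : IsMinimalImmersion X)
    {A : Space →L[ℝ] Space} (hA : ∀ x, inner ℝ x (A x) = 0) (v : Space)
    (hc : c ∈ atlas Plane M) (hf : ContMDiff 𝓘(ℝ, Plane) 𝓘(ℝ, ℝ) ∞ f)
    (hfc : HasCompactSupport f) (hfs : tsupport f ⊆ c.source) :
    chartFlux X (fun x => v + A x) (fun _ => 1) f c = 0 := by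
  have hcm := IsManifold.subset_maximalAtlas (I := 𝓘(ℝ, Plane)) (n := ∞) hc
  have hpos : ∀ y ∈ c.target, 0 < firstFormDet (X ∘ c.symm) y := fun y hy =>
    hX.firstFormDet_pos hc hy
  have hY := contDiffOn_comp_symm hX.contMDiff hcm
  have hkY : ContDiffOn ℝ ∞ (fun y => v + A ((X ∘ c.symm) y)) c.target :=
    contDiffOn_const.add (A.contDiff.comp_contDiffOn hY)
  have hS' : IsCompact (c '' tsupport f) :=
    hfc.isCompact.image_of_continuousOn (c.continuousOn.mono hfs)
  have hST : c '' tsupport f ⊆ c.target := by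
    rintro _ ⟨m, hm, rfl⟩
    exact c.map_source (hfs hm)
  -- Outside the chart's image the test function is continued by zero. This is smooth because its
  -- support is compact inside the image.
  let ψ : Plane → ℝ := c.target.indicator (f ∘ c.symm)
  have hψ0 : ∀ y ∉ c '' tsupport f, ψ y = 0 := fun y hy => by
    by_cases hyt : y ∈ c.target
    · refine (Set.indicator_of_mem hyt _).trans ?_
      exact image_eq_zero_of_notMem_tsupport (f := f) fun h => hy ⟨_, h, c.right_inv hyt⟩
    · exact Set.indicator_of_notMem hyt _
  have hψe : ∀ y ∈ c.target, ψ =ᶠ[𝓝 y] f ∘ c.symm := fun y hy => by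
    filter_upwards [c.open_target.mem_nhds hy] with z hz
    exact Set.indicator_of_mem hz _
  have hψ : ContDiff ℝ ∞ ψ := by
    rw [contDiff_iff_contDiffAt]
    intro y
    by_cases hyt : y ∈ c.target
    · exact ((contDiffOn_comp_symm hf hcm).contDiffAt
        (c.open_target.mem_nhds hyt)).congr_of_eventuallyEq (hψe y hyt)
    · refine contDiffAt_const (c := (0 : ℝ)) |>.congr_of_eventuallyEq ?_
      filter_upwards [hS'.isClosed.isOpen_compl.mem_nhds fun h => hyt (hST h)] with z hz
      exact hψ0 z hz
  have hts : tsupport ψ ⊆ c '' tsupport f :=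
    closure_minimal (fun y hy => by_contra fun h => hy (hψ0 y h)) hS'.isClosed
  have key := integral_gradient_divergence_free c.open_target
    (hY.fluxCoeff_zero_one c.open_target hkY hpos) (hY.fluxCoeff_one_zero c.open_target hkY hpos)
    (fun p hp => fluxCoeff_divergence_eq_zero c.open_target hY hpos
      (hX.meanCurvature_eq_zero c hc) hA v hp) hψ (HasCompactSupport.intro hS' hψ0)
    (hts.trans hST)
  rw [← key, ← setIntegral_eq_integral_of_forall_compl_eq_zero (s := c.target)]
  · refine setIntegral_congr_fun c.open_target.measurableSet fun y hy => ?_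
    have hp : ∀ i, scalarPartial ψ i y = scalarPartial (f ∘ c.symm) i y := fun i => by
      unfold scalarPartial
      rw [(hψe y hy).fderiv_eq]
    simp only [hp, one_mul, chartDensity, fluxDensity, fluxForm_eq, Function.comp_apply]
  · intro y hy
    have hp : ∀ i, scalarPartial ψ i y = 0 := fun i => by
      unfold scalarPartial
      rw [fderiv_of_notMem_tsupport ℝ fun h => hy (hST (hts h))]
      rfl
    simp [hp]

end Manifold

end

/-! ### Flux balancing on the whole surface. -/

section

open MeasureTheory

section Manifold

variable {M : Type*} [TopologicalSpace M] [T2Space M] [SecondCountableTopology M]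
  [ChartedSpace Plane M] [IsManifold 𝓘(ℝ, Plane) ∞ M]

/-- A finite smooth partition of unity along a compact set, subordinate to charts. -/
theorem exists_finite_partitionOfUnity {T : Set M} (hT : IsCompact T) :
    ∃ (s : Finset M) (ρ : M → M → ℝ), (∀ i, ContMDiff 𝓘(ℝ, Plane) 𝓘(ℝ, ℝ) ∞ (ρ i)) ∧
      (∀ i, HasCompactSupport (ρ i)) ∧ (∀ i, tsupport (ρ i) ⊆ (chartAt Plane i).source) ∧
      ∀ m ∈ T, ∑ i ∈ s, ρ i m = 1 := by
  have : LocallyCompactSpace M := ChartedSpace.locallyCompactSpace Plane M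
  -- Subordination to the interiors of compact sets `N i` gives the members of the partition compact
  -- supports inside chart domains.
  have hN : ∀ i : M, ∃ N, IsCompact N ∧ i ∈ interior N ∧ N ⊆ (chartAt Plane i).source := fun i =>
    exists_compact_subset (chartAt Plane i).open_source (mem_chart_source Plane i)
  choose N hNc hNi hNs using hN
  obtain ⟨ρ, hρ⟩ := SmoothPartitionOfUnity.exists_isSubordinate 𝓘(ℝ, Plane) (s := Set.univ)
    isClosed_univ (fun i => interior (N i)) (fun i => isOpen_interior)
    (fun i _ => Set.mem_iUnion.2 ⟨i, hNi i⟩)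
  have hfin := ρ.locallyFinite.finite_nonempty_inter_compact hT
  have hsub : ∀ i, tsupport (ρ i) ⊆ N i := fun i => (hρ i).trans interior_subset
  refine ⟨hfin.toFinset, fun i => ρ i, fun i => (ρ i).contMDiff,
    fun i => (hNc i).of_isClosed_subset (isClosed_tsupport _) (hsub i),
    fun i => (hsub i).trans (hNs i), fun m hm => ?_⟩
  rw [← ρ.sum_eq_one (Set.mem_univ m)]
  refine (finsum_eq_sum_of_support_subset _ fun i hi => ?_).symm
  rw [Set.Finite.coe_toFinset]
  exact ⟨m, hi, hm⟩

/-- Flux balancing: the flux of a Killing field of Euclidean space tested with a compactly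
supported function vanishes. The flux is computed in disjoint open sets `V i` that contain the
support of the differential of that function, each in a chart `e i`. -/
theorem IsMinimalImmersion.sum_chartFlux_eq_zero {X : M → Space} (hX : IsMinimalImmersion X)
    {A : Space →L[ℝ] Space} (hA : ∀ x, inner ℝ x (A x) = 0) (v : Space) {φ : M → ℝ}
    (hφ : ContMDiff 𝓘(ℝ, Plane) 𝓘(ℝ, ℝ) ∞ φ) (hφc : HasCompactSupport φ)
    {ι : Type*} [Fintype ι] {e : ι → OpenPartialHomeomorph M Plane}
    (he : ∀ i, e i ∈ IsManifold.maximalAtlas 𝓘(ℝ, Plane) ∞ M) {V : ι → Set M}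
    (hV : ∀ i, IsOpen (V i)) (hVe : ∀ i, V i ⊆ (e i).source)
    (hdisj : Pairwise fun i j => Disjoint (V i) (V j))
    (hloc : ∀ m, (∀ i, m ∉ V i) → ∀ᶠ m' in 𝓝 m, φ m' = φ m) :
    ∑ i, chartFlux X (fun x => v + A x) ((V i).indicator fun _ => 1) φ (e i) = 0 := by
  obtain ⟨s, ρ, hρ, hρc, hρs, hρ1⟩ := exists_finite_partitionOfUnity hφc.isCompact
  have hk : ContDiff ℝ ∞ (fun x => v + A x) := contDiff_const.add A.contDiff
  set k : Space → Space := fun x => v + A x with hkdef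
  have hXs := hX.contMDiff
  have hm : ∀ j : M, chartAt Plane j ∈ IsManifold.maximalAtlas 𝓘(ℝ, Plane) ∞ M := fun j =>
    IsManifold.chart_mem_maximalAtlas j
  have hpos : ∀ j : M, ∀ y ∈ (chartAt Plane j).target,
      0 < firstFormDet (X ∘ (chartAt Plane j).symm) y := fun j y hy =>
    hX.firstFormDet_pos (chart_mem_atlas Plane j) hy
  have hg : ∀ i, ContMDiff 𝓘(ℝ, Plane) 𝓘(ℝ, ℝ) ∞ (fun m => ρ i m * φ m) := fun i =>
    (hρ i).mul hφ
  have hgt : ∀ i, tsupport (fun m => ρ i m * φ m) ⊆ tsupport (ρ i) := fun i =>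
    tsupport_mul_subset_left
  have hgφ : ∀ i, tsupport (fun m => ρ i m * φ m) ⊆ tsupport φ := fun i =>
    tsupport_mul_subset_right
  have hρz : ∀ i, ∀ m ∉ (chartAt Plane i).source, ρ i m = 0 := fun i m h =>
    image_eq_zero_of_notMem_tsupport fun h' => h (hρs i h')
  -- The partition of unity is used twice. As `ρ i * φ` it localises the test function, whose flux
  -- then vanishes in chart `i`; as the weight `ρ j` it localises the integral, so that the double
  -- sum can be regrouped in chart `j`.
  have h1 : ∀ i, ∑ j ∈ s, chartFlux X k (ρ j) (fun m => ρ i m * φ m) (chartAt Plane i) = 0 := by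
    intro i
    rw [← hX.chartFlux_eq_zero hA v (chart_mem_atlas Plane i) (hg i)
      ((hρc i).mono' ((subset_tsupport _).trans (hgt i))) ((hgt i).trans (hρs i))]
    refine (chartFlux_eq_sum (fun j _ => chartFluxIntegrable_of_compact hXs hk (hg i)
      (hρ j).continuous (hm i) (hpos i) (hρc i).isCompact (hρs i) fun m _ hmS =>
        Or.inr fun h => hmS (hgt i h)) fun y hy => ?_).symm
    rw [← Finset.sum_mul]
    by_cases hyφ : (chartAt Plane i).symm y ∈ tsupport φ
    · rw [hρ1 _ hyφ]
    · rw [chartDensity_eq_zero_of_notMem_tsupport hy fun h => hyφ (hgφ i h), mul_zero, mul_zero]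
  -- The product of weight and density lives where both charts are defined. Cutting the weight off
  -- outside the source of chart `i` makes this explicit without changing either integral.
  have h2 : ∀ i j, chartFlux X k (ρ j) (fun m => ρ i m * φ m) (chartAt Plane i)
      = chartFlux X k (ρ j) (fun m => ρ i m * φ m) (chartAt Plane j) := by
    intro i j
    have hw : ∀ m, m ∉ (chartAt Plane i).source ∩ (chartAt Plane j).source →
        (chartAt Plane i).source.indicator (ρ j) m = 0 := fun m h => by
      by_cases hmi : m ∈ (chartAt Plane i).source
      · rw [Set.indicator_of_mem hmi]
        exact hρz j m fun h' => h ⟨hmi, h'⟩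
      · exact Set.indicator_of_notMem hmi _
    rw [chartFlux_congr (w' := (chartAt Plane i).source.indicator (ρ j))
      (f' := fun m => ρ i m * φ m) fun y hy => ?_, (chart_change hXs (hg i) (hm i) (hm j) hw).1]
    · refine chartFlux_congr fun y hy => ?_
      by_cases hmi : (chartAt Plane j).symm y ∈ (chartAt Plane i).source
      · rw [Set.indicator_of_mem hmi]
      · rw [chartDensity_eq_zero_of_notMem_tsupport hy fun h => hmi (hρs i (hgt i h)), mul_zero,
          mul_zero]
    · rw [Set.indicator_of_mem ((chartAt Plane i).map_target hy)]
  have h3 : ∀ j, chartFlux X k (ρ j) φ (chartAt Plane j)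
      = ∑ i ∈ s, chartFlux X k (ρ j) (fun m => ρ i m * φ m) (chartAt Plane j) := by
    intro j
    refine chartFlux_eq_sum (fun i _ => chartFluxIntegrable_of_compact hXs hk (hg i)
      (hρ j).continuous (hm j) (hpos j) (hρc j).isCompact (hρs j) fun m _ hmS =>
        Or.inl (image_eq_zero_of_notMem_tsupport hmS)) fun y hy => ?_
    rw [← Finset.mul_sum, ← chartDensity_sum s (fun i _ => hg i) (hm j) hy]
    have : (fun m => ∑ i ∈ s, ρ i m * φ m) = φ := by
      funext m
      rw [← Finset.sum_mul]
      by_cases hmφ : m ∈ tsupport φ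
      · rw [hρ1 m hmφ, one_mul]
      · rw [image_eq_zero_of_notMem_tsupport hmφ, mul_zero]
    rw [this]
  have hint : ∀ j i, ChartFluxIntegrable X k ((V i).indicator (ρ j)) φ (chartAt Plane j) :=
    fun j i => (chartFluxIntegrable_of_compact hXs hk hφ (hρ j).continuous (hm j) (hpos j)
      (hρc j).isCompact (hρs j) fun m _ hmS =>
        Or.inl (image_eq_zero_of_notMem_tsupport hmS)).indicator (hV i)
  -- Off the sets `V i` the function `φ` is locally constant and its density vanishes.
  have h4 : ∀ j, chartFlux X k (ρ j) φ (chartAt Plane j)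
      = ∑ i, chartFlux X k ((V i).indicator (ρ j)) φ (chartAt Plane j) := by
    intro j
    refine chartFlux_eq_sum (fun i _ => hint j i) fun y hy => ?_
    by_cases h : ∃ i, (chartAt Plane j).symm y ∈ V i
    · obtain ⟨i, hi⟩ := h
      rw [Finset.sum_eq_single i, Set.indicator_of_mem hi]
      · intro i' _ hne
        rw [Set.indicator_of_notMem fun h' => Set.disjoint_left.1 (hdisj hne) h' hi, zero_mul]
      · exact fun h => absurd (Finset.mem_univ i) h
    · push Not at h
      simp [chartDensity_eq_zero hy (hloc _ h)]
  have hw5 : ∀ j i, ∀ m, m ∉ (chartAt Plane j).source ∩ (e i).source →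
      (V i).indicator (ρ j) m = 0 := fun j i m h => by
    by_cases hmi : m ∈ V i
    · rw [Set.indicator_of_mem hmi]
      exact hρz j m fun h' => h ⟨h', hVe i hmi⟩
    · exact Set.indicator_of_notMem hmi _
  have h6 : ∀ i, chartFlux X k ((V i).indicator fun _ => 1) φ (e i)
      = ∑ j ∈ s, chartFlux X k ((V i).indicator (ρ j)) φ (e i) := by
    intro i
    refine chartFlux_eq_sum (fun j _ => (chart_change hXs hφ (hm j) (he i) (hw5 j i)).2
      (hint j i)) fun y hy => ?_
    rw [← Finset.sum_mul]
    by_cases hyφ : (e i).symm y ∈ tsupport φ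
    · congr 1
      by_cases hyV : (e i).symm y ∈ V i
      · simp only [Set.indicator_of_mem hyV, hρ1 _ hyφ]
      · simp only [Set.indicator_of_notMem hyV, Finset.sum_const_zero]
    · rw [chartDensity_eq_zero_of_notMem_tsupport hy hyφ, mul_zero, mul_zero]
  calc ∑ i, chartFlux X k ((V i).indicator fun _ => 1) φ (e i)
      = ∑ i, ∑ j ∈ s, chartFlux X k ((V i).indicator (ρ j)) φ (chartAt Plane j) := by
        refine Finset.sum_congr rfl fun i _ => ?_
        rw [h6 i]
        exact Finset.sum_congr rfl fun j _ => (chart_change hXs hφ (hm j) (he i) (hw5 j i)).1.symm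
    _ = ∑ j ∈ s, ∑ i ∈ s, chartFlux X k (ρ j) (fun m => ρ i m * φ m) (chartAt Plane j) := by
        rw [Finset.sum_comm]
        exact Finset.sum_congr rfl fun j _ => by rw [← h4 j, h3 j]
    _ = ∑ i ∈ s, ∑ j ∈ s, chartFlux X k (ρ j) (fun m => ρ i m * φ m) (chartAt Plane i) := by
        rw [Finset.sum_comm]
        exact Finset.sum_congr rfl fun i _ => Finset.sum_congr rfl fun j _ => (h2 i j).symm
    _ = 0 := Finset.sum_eq_zero fun i _ => h1 i

end Manifold

end

/-! ### Pointwise estimates for the minimal surface operator. -/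

section

/-- The flux form of a graph with gradient `(p₀, p₁)`, in orthonormal coordinates. -/
def graphForm (p₀ p₁ l₀ l₁ k₀ k₁ k₂ : ℝ) : ℝ :=
  ((l₀ * (1 + p₁ ^ 2) - l₁ * (p₀ * p₁)) * (k₀ + p₀ * k₂)
    + (l₁ * (1 + p₀ ^ 2) - l₀ * (p₀ * p₁)) * (k₁ + p₁ * k₂)) / √(1 + p₀ ^ 2 + p₁ ^ 2)

theorem fluxForm_graph (f : OrthonormalBasis (Fin 3) ℝ Space) (p₀ p₁ l₀ l₁ : ℝ) (k : Space) :
    fluxForm (f 0 + p₀ • f 2) (f 1 + p₁ • f 2) k l₀ l₁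
      = graphForm p₀ p₁ l₀ l₁ (inner ℝ (f 0) k) (inner ℝ (f 1) k) (inner ℝ (f 2) k) := by
  have h : ∀ i j, inner ℝ (f i) (f j) = if i = j then (1 : ℝ) else 0 :=
    orthonormal_iff_ite.1 f.orthonormal
  unfold fluxForm graphForm
  simp only [inner_add_left, inner_add_right, real_inner_smul_left, real_inner_smul_right, h]
  simp only [Fin.reduceEq, if_true, if_false]
  congr 1
  · ring
  · congr 1; ring

theorem graphForm_vertical (p₀ p₁ l₀ l₁ : ℝ) :
    graphForm p₀ p₁ l₀ l₁ 0 0 1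
      = l₀ * (p₀ / √(1 + p₀ ^ 2 + p₁ ^ 2)) + l₁ * (p₁ / √(1 + p₀ ^ 2 + p₁ ^ 2)) := by
  unfold graphForm
  ring

/-- In terms of the horizontal normal components the coefficients are bounded apart from the factor
`s`, which suits difference estimates; it uses `1 + p₁ ^ 2 = s ^ 2 * (1 - n₀ ^ 2)` and its analogue.
-/
theorem graphForm_eq (p₀ p₁ l₀ l₁ k₀ k₁ k₂ : ℝ) {s n₀ n₁ : ℝ} (hs : s = √(1 + p₀ ^ 2 + p₁ ^ 2))
    (h₀ : n₀ = p₀ / s) (h₁ : n₁ = p₁ / s) :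
    graphForm p₀ p₁ l₀ l₁ k₀ k₁ k₂
      = (l₀ * (s * (1 - n₀ ^ 2)) - l₁ * (s * (n₀ * n₁))) * k₀
        + (l₁ * (s * (1 - n₁ ^ 2)) - l₀ * (s * (n₀ * n₁))) * k₁ + (l₀ * n₀ + l₁ * n₁) * k₂ := by
  have hpos : 0 < 1 + p₀ ^ 2 + p₁ ^ 2 := by positivity
  have hs0 : 0 < s := hs ▸ Real.sqrt_pos.2 hpos
  have hss : s ^ 2 = 1 + p₀ ^ 2 + p₁ ^ 2 := hs ▸ Real.sq_sqrt hpos.le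
  unfold graphForm
  rw [← hs, h₀, h₁]
  field_simp
  linear_combination (-(l₀ * k₀) - l₁ * k₁) * hss

/-- The monotonicity defect of the minimal surface operator at the gradients `p` and `q`. -/
def gradientDefect (p₀ p₁ q₀ q₁ : ℝ) : ℝ :=
  (p₀ / √(1 + p₀ ^ 2 + p₁ ^ 2) - q₀ / √(1 + q₀ ^ 2 + q₁ ^ 2)) * (p₀ - q₀)
    + (p₁ / √(1 + p₀ ^ 2 + p₁ ^ 2) - q₁ / √(1 + q₀ ^ 2 + q₁ ^ 2)) * (p₁ - q₁)

/-- Let `N`, `N'` be the unit normals `(-p, 1) / s` and `(-q, 1) / t`. Since `s • N - t • N'` is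
horizontal, the defect is `⟪N - N', s • N - t • N'⟫ = (s + t) * (1 - ⟪N, N'⟫)`, and `1 - ⟪N, N'⟫` is
half of `‖N - N'‖ ^ 2`. -/
theorem gradientDefect_eq (p₀ p₁ q₀ q₁ : ℝ) {s t : ℝ} (hs : s = √(1 + p₀ ^ 2 + p₁ ^ 2))
    (ht : t = √(1 + q₀ ^ 2 + q₁ ^ 2)) :
    gradientDefect p₀ p₁ q₀ q₁ = ((p₀ / s - q₀ / t) ^ 2 + (p₁ / s - q₁ / t) ^ 2
      + (1 / s - 1 / t) ^ 2) * ((s + t) / 2) := by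
  have hp : 0 < 1 + p₀ ^ 2 + p₁ ^ 2 := by positivity
  have hq : 0 < 1 + q₀ ^ 2 + q₁ ^ 2 := by positivity
  have hs0 : 0 < s := hs ▸ Real.sqrt_pos.2 hp
  have ht0 : 0 < t := ht ▸ Real.sqrt_pos.2 hq
  have hss : s ^ 2 = 1 + p₀ ^ 2 + p₁ ^ 2 := hs ▸ Real.sq_sqrt hp.le
  have htt : t ^ 2 = 1 + q₀ ^ 2 + q₁ ^ 2 := ht ▸ Real.sq_sqrt hq.le
  unfold gradientDefect
  rw [← hs, ← ht]
  have e1 : p₀ ^ 2 = s ^ 2 - 1 - p₁ ^ 2 := by linarith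
  have e2 : q₀ ^ 2 = t ^ 2 - 1 - q₁ ^ 2 := by linarith
  field_simp
  ring_nf
  rw [e1, e2]
  ring

theorem one_le_graphArea (p₀ p₁ : ℝ) : 1 ≤ √(1 + p₀ ^ 2 + p₁ ^ 2) := by
  rw [Real.one_le_sqrt]; nlinarith [sq_nonneg p₀, sq_nonneg p₁]

theorem sq_add_sq_add_sq_le_gradientDefect (p₀ p₁ q₀ q₁ : ℝ) {s t : ℝ}
    (hs : s = √(1 + p₀ ^ 2 + p₁ ^ 2)) (ht : t = √(1 + q₀ ^ 2 + q₁ ^ 2)) :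
    (p₀ / s - q₀ / t) ^ 2 + (p₁ / s - q₁ / t) ^ 2 + (1 / s - 1 / t) ^ 2
      ≤ gradientDefect p₀ p₁ q₀ q₁ := by
  rw [gradientDefect_eq p₀ p₁ q₀ q₁ hs ht]
  have h1 := one_le_graphArea p₀ p₁
  have h2 := one_le_graphArea q₀ q₁
  rw [← hs] at h1
  rw [← ht] at h2
  exact le_mul_of_one_le_right (by positivity) (by linarith)

theorem gradientDefect_nonneg (p₀ p₁ q₀ q₁ : ℝ) : 0 ≤ gradientDefect p₀ p₁ q₀ q₁ :=
  le_trans (by positivity) (sq_add_sq_add_sq_le_gradientDefect p₀ p₁ q₀ q₁ rfl rfl)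

theorem abs_div_graphArea_le (p₀ p₁ : ℝ) :
    |p₀ / √(1 + p₀ ^ 2 + p₁ ^ 2)| ≤ 1 ∧ |p₁ / √(1 + p₀ ^ 2 + p₁ ^ 2)| ≤ 1 := by
  have h1 := one_le_graphArea p₀ p₁
  constructor <;>
  · rw [abs_div, abs_of_nonneg (by linarith : 0 ≤ √(1 + p₀ ^ 2 + p₁ ^ 2)),
      div_le_one (by linarith)]
    exact Real.abs_le_sqrt (by nlinarith [sq_nonneg p₀, sq_nonneg p₁])

/-- No bound on `s` is available. If `s ≤ 4`, the difference is at most `8` times that of the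
reciprocals. If `s > 4`, the reciprocals differ by at least `1 / 4`, so the defect itself is at
least `(s + t) / 32`. -/
theorem abs_graphArea_sub_le {p₀ p₁ q₀ q₁ s t : ℝ} (hs : s = √(1 + p₀ ^ 2 + p₁ ^ 2))
    (ht : t = √(1 + q₀ ^ 2 + q₁ ^ 2)) (ht2 : t ≤ 2) :
    |s - t| ≤ 8 * √(gradientDefect p₀ p₁ q₀ q₁) + 32 * gradientDefect p₀ p₁ q₀ q₁ := by
  have h1 : 1 ≤ s := hs ▸ one_le_graphArea p₀ p₁
  have h2 : 1 ≤ t := ht ▸ one_le_graphArea q₀ q₁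
  have hT := gradientDefect_nonneg p₀ p₁ q₀ q₁
  have hle := sq_add_sq_add_sq_le_gradientDefect p₀ p₁ q₀ q₁ hs ht
  have heq := gradientDefect_eq p₀ p₁ q₀ q₁ hs ht
  set T := gradientDefect p₀ p₁ q₀ q₁
  have hsq := Real.sqrt_nonneg T
  rcases le_or_gt s 4 with h4 | h4
  · have hd : |1 / s - 1 / t| ≤ √T := Real.abs_le_sqrt
      (by nlinarith [sq_nonneg (p₀ / s - q₀ / t), sq_nonneg (p₁ / s - q₁ / t)])
    have he : |s - t| = s * t * |1 / s - 1 / t| := by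
      rw [← abs_of_pos (by positivity : 0 < s * t), ← abs_mul, abs_sub_comm]
      congr 1
      field_simp
    rw [he]
    have : s * t ≤ 8 := by nlinarith
    nlinarith [abs_nonneg (1 / s - 1 / t)]
  · have h5 : 1 / s ≤ 1 / 4 := one_div_le_one_div_of_le (by norm_num) h4.le
    have h6 : 1 / 2 ≤ 1 / t := one_div_le_one_div_of_le (by linarith) ht2
    have h7 : 1 / 16 ≤ (1 / s - 1 / t) ^ 2 := by nlinarith
    have h8 : 1 / 16 * ((s + t) / 2) ≤ T := by
      rw [heq]
      exact mul_le_mul_of_nonneg_right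
        (by nlinarith [sq_nonneg (p₀ / s - q₀ / t), sq_nonneg (p₁ / s - q₁ / t)]) (by linarith)
    rw [abs_of_nonneg (by linarith)]
    linarith

theorem abs_bilinear_le {a b c d e f l₀ l₁ k₀ k₁ k₂ B : ℝ} (ha : |a| ≤ B) (hb : |b| ≤ B)
    (hc : |c| ≤ B) (hd : |d| ≤ B) (he : |e| ≤ B) (hf : |f| ≤ B) :
    |(l₀ * a - l₁ * b) * k₀ + (l₁ * c - l₀ * d) * k₁ + (l₀ * e + l₁ * f) * k₂|
      ≤ B * (|l₀| + |l₁|) * (|k₀| + |k₁| + |k₂|) := by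
  have key : ∀ x y z w : ℝ, |z| ≤ B → |w| ≤ B → |x * z + y * w| ≤ B * (|x| + |y|) := by
    intro x y z w hz hw
    calc |x * z + y * w| ≤ |x| * |z| + |y| * |w| := by
          rw [← abs_mul, ← abs_mul]; exact abs_add_le _ _
      _ ≤ |x| * B + |y| * B := by gcongr
      _ = _ := by ring
  have h1 := key l₀ l₁ a (-b) ha (by rwa [abs_neg])
  have h2 := key l₁ l₀ c (-d) hc (by rwa [abs_neg])
  have h3 := key l₀ l₁ e f he hf
  rw [mul_neg, ← sub_eq_add_neg] at h1 h2
  rw [add_comm |l₁|] at h2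
  calc _ ≤ |(l₀ * a - l₁ * b)| * |k₀| + |(l₁ * c - l₀ * d)| * |k₁| + |(l₀ * e + l₁ * f)| * |k₂| := by
        rw [← abs_mul, ← abs_mul, ← abs_mul]; exact abs_add_three _ _ _
    _ ≤ B * (|l₀| + |l₁|) * |k₀| + B * (|l₀| + |l₁|) * |k₁| + B * (|l₀| + |l₁|) * |k₂| := by gcongr
    _ = _ := by ring

/-- Only the comparison gradient `q` has to be bounded. A large `p` is paid for by the linear term
in the defect, which the energy inequality controls. -/
theorem abs_graphForm_sub_le {p₀ p₁ q₀ q₁ : ℝ} (l₀ l₁ k₀ k₁ k₂ : ℝ)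
    (hq : √(1 + q₀ ^ 2 + q₁ ^ 2) ≤ 2) :
    |graphForm p₀ p₁ l₀ l₁ k₀ k₁ k₂ - graphForm q₀ q₁ l₀ l₁ k₀ k₁ k₂|
      ≤ 32 * (√(gradientDefect p₀ p₁ q₀ q₁) + gradientDefect p₀ p₁ q₀ q₁) * (|l₀| + |l₁|)
        * (|k₀| + |k₁| + |k₂|) := by
  have hT := gradientDefect_nonneg p₀ p₁ q₀ q₁
  have hle := sq_add_sq_add_sq_le_gradientDefect p₀ p₁ q₀ q₁ rfl rfl
  have hE := abs_graphArea_sub_le (p₀ := p₀) (p₁ := p₁) rfl rfl hq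
  obtain ⟨hn₀, hn₁⟩ := abs_div_graphArea_le p₀ p₁
  obtain ⟨hm₀, hm₁⟩ := abs_div_graphArea_le q₀ q₁
  rw [graphForm_eq p₀ p₁ l₀ l₁ k₀ k₁ k₂ rfl rfl rfl, graphForm_eq q₀ q₁ l₀ l₁ k₀ k₁ k₂ rfl rfl rfl]
  have ht1 := one_le_graphArea q₀ q₁
  set T := gradientDefect p₀ p₁ q₀ q₁
  set s := √(1 + p₀ ^ 2 + p₁ ^ 2)
  set t := √(1 + q₀ ^ 2 + q₁ ^ 2)
  have hd₀ : |p₀ / s - q₀ / t| ≤ √T := Real.abs_le_sqrt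
    (by nlinarith [sq_nonneg (1 / s - 1 / t), sq_nonneg (p₁ / s - q₁ / t)])
  have hd₁ : |p₁ / s - q₁ / t| ≤ √T := Real.abs_le_sqrt
    (by nlinarith [sq_nonneg (1 / s - 1 / t), sq_nonneg (p₀ / s - q₀ / t)])
  generalize p₀ / s = n₀ at *
  generalize p₁ / s = n₁ at *
  generalize q₀ / t = m₀ at *
  generalize q₁ / t = m₁ at *
  have hr := Real.sqrt_nonneg T
  have prod : ∀ a b a' b' : ℝ, |a| ≤ 1 → |b| ≤ 1 → |a'| ≤ 1 → |b'| ≤ 1 → |a - a'| ≤ √T →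
      |b - b'| ≤ √T → |a * b - a' * b'| ≤ 2 * √T := by
    intro a b a' b' h1 h2 h3 h4 h5 h6
    rw [show a * b - a' * b' = (a - a') * b + a' * (b - b') by ring]
    refine (abs_add_le _ _).trans ?_
    rw [abs_mul, abs_mul]
    nlinarith [abs_nonneg b, abs_nonneg a', abs_nonneg (a - a'), abs_nonneg (b - b')]
  -- The error is at most `8 * √T + 32 * T` from the area factor, plus `2 * (2 * √T)` from the
  -- normals.
  have scale : ∀ y z : ℝ, |y| ≤ 1 → |y - z| ≤ 2 * √T → |s * y - t * z| ≤ 32 * (√T + T) := by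
    intro y z hy hyz
    rw [show s * y - t * z = (s - t) * y + t * (y - z) by ring]
    refine (abs_add_le _ _).trans ?_
    rw [abs_mul, abs_mul, abs_of_pos (by linarith : 0 < t)]
    nlinarith [abs_nonneg y, abs_nonneg (s - t), abs_nonneg (y - z)]
  have one_sub : ∀ a : ℝ, |a| ≤ 1 → |1 - a ^ 2| ≤ 1 := fun a ha => by
    rw [abs_le] at ha ⊢
    constructor <;> nlinarith
  have absmul : ∀ a b : ℝ, |a| ≤ 1 → |b| ≤ 1 → |a * b| ≤ 1 := fun a b ha hb => by
    rw [abs_mul]; exact mul_le_one₀ ha (abs_nonneg _) hb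
  have h00 : |1 - n₀ ^ 2 - (1 - m₀ ^ 2)| ≤ 2 * √T := by
    have := prod n₀ n₀ m₀ m₀ hn₀ hn₀ hm₀ hm₀ hd₀ hd₀
    rw [show 1 - n₀ ^ 2 - (1 - m₀ ^ 2) = -(n₀ * n₀ - m₀ * m₀) by ring, abs_neg]
    exact this
  have h11 : |1 - n₁ ^ 2 - (1 - m₁ ^ 2)| ≤ 2 * √T := by
    have := prod n₁ n₁ m₁ m₁ hn₁ hn₁ hm₁ hm₁ hd₁ hd₁
    rw [show 1 - n₁ ^ 2 - (1 - m₁ ^ 2) = -(n₁ * n₁ - m₁ * m₁) by ring, abs_neg]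
    exact this
  have h01 := scale _ _ (absmul n₀ n₁ hn₀ hn₁) (prod n₀ n₁ m₀ m₁ hn₀ hn₁ hm₀ hm₁ hd₀ hd₁)
  have key := abs_bilinear_le (l₀ := l₀) (l₁ := l₁) (k₀ := k₀) (k₁ := k₁) (k₂ := k₂)
    (scale _ _ (one_sub n₀ hn₀) h00) h01 (scale _ _ (one_sub n₁ hn₁) h11) h01
    (by linarith : |n₀ - m₀| ≤ 32 * (√T + T)) (by linarith : |n₁ - m₁| ≤ 32 * (√T + T))
  refine le_trans (le_of_eq ?_) key
  congr 1
  ring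

theorem abs_graphForm_le {q₀ q₁ : ℝ} (l₀ l₁ k₀ k₁ k₂ : ℝ) (hq : √(1 + q₀ ^ 2 + q₁ ^ 2) ≤ 2) :
    |graphForm q₀ q₁ l₀ l₁ k₀ k₁ k₂| ≤ 2 * (|l₀| + |l₁|) * (|k₀| + |k₁| + |k₂|) := by
  obtain ⟨hm₀, hm₁⟩ := abs_div_graphArea_le q₀ q₁
  rw [graphForm_eq q₀ q₁ l₀ l₁ k₀ k₁ k₂ rfl rfl rfl]
  have ht1 := one_le_graphArea q₀ q₁
  set t := √(1 + q₀ ^ 2 + q₁ ^ 2)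
  generalize q₀ / t = m₀ at *
  generalize q₁ / t = m₁ at *
  have scale : ∀ y : ℝ, |y| ≤ 1 → |t * y| ≤ 2 := fun y hy => by
    rw [abs_mul, abs_of_pos (by linarith : 0 < t)]
    nlinarith [abs_nonneg y]
  have one_sub : ∀ a : ℝ, |a| ≤ 1 → |1 - a ^ 2| ≤ 1 := fun a ha => by
    rw [abs_le] at ha ⊢
    constructor <;> nlinarith
  have absmul : |m₀ * m₁| ≤ 1 := by
    rw [abs_mul]; exact mul_le_one₀ hm₀ (abs_nonneg _) hm₁
  exact abs_bilinear_le (scale _ (one_sub _ hm₀)) (scale _ absmul) (scale _ (one_sub _ hm₁))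
    (scale _ absmul) (by linarith) (by linarith)

theorem graphForm_sub_field (p₀ p₁ l₀ l₁ k₀ k₁ k₂ k₀' k₁' k₂' : ℝ) :
    graphForm p₀ p₁ l₀ l₁ k₀ k₁ k₂ - graphForm p₀ p₁ l₀ l₁ k₀' k₁' k₂'
      = graphForm p₀ p₁ l₀ l₁ (k₀ - k₀') (k₁ - k₁') (k₂ - k₂') := by
  unfold graphForm
  ring

end

/-! ### Radial and annular cutoff functions. -/

section

open MeasureTheory

theorem scalarPartial_mul {f g : Plane → ℝ} {x : Plane} (hf : DifferentiableAt ℝ f x)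
    (hg : DifferentiableAt ℝ g x) (i : Fin 2) :
    scalarPartial (fun y => f y * g y) i x = f x * scalarPartial g i x + g x * scalarPartial f i x := by
  unfold scalarPartial
  rw [fderiv_fun_mul hf hg]
  simp

theorem scalarPartial_sub {f g : Plane → ℝ} {x : Plane} (hf : DifferentiableAt ℝ f x)
    (hg : DifferentiableAt ℝ g x) (i : Fin 2) :
    scalarPartial (fun y => f y - g y) i x = scalarPartial f i x - scalarPartial g i x := by
  unfold scalarPartial
  rw [fderiv_fun_sub hf hg]
  simp

theorem scalarPartial_const_sub (a : ℝ) (f : Plane → ℝ) (x : Plane) (i : Fin 2) :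
    scalarPartial (fun y => a - f y) i x = - scalarPartial f i x := by
  unfold scalarPartial
  rw [fderiv_const_sub]
  simp

theorem continuous_scalarPartial {f : Plane → ℝ} (hf : ContDiff ℝ ∞ f) (i : Fin 2) :
    Continuous (scalarPartial f i) :=
  continuousOn_univ.1 ((hf.contDiffOn (s := Set.univ)).scalarPartial isOpen_univ i).continuousOn

theorem scalarPartial_comp_norm_sq {g : ℝ → ℝ} {g' : ℝ} {x : Plane} (hg : HasDerivAt g g' (‖x‖ ^ 2))
    (i : Fin 2) : scalarPartial (fun y => g (‖y‖ ^ 2)) i x = 2 * g' * x i := by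
  have h := hg.comp_hasFDerivAt x (hasStrictFDerivAt_norm_sq x).hasFDerivAt
  unfold scalarPartial
  rw [show (fun y : Plane => g (‖y‖ ^ 2)) = g ∘ fun y => ‖y‖ ^ 2 from rfl, h.fderiv]
  simp [EuclideanSpace.inner_single_right]
  ring

theorem abs_apply_le_norm (x : Plane) (i : Fin 2) : |x i| ≤ ‖x‖ := by
  rw [← Real.norm_eq_abs]; exact PiLp.norm_apply_le x i

theorem exists_abs_deriv_smoothTransition_le :
    ∃ B : ℝ, 0 ≤ B ∧ ∀ t, |deriv Real.smoothTransition t| ≤ B := by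
  have hc : Continuous (deriv Real.smoothTransition) :=
    Real.smoothTransition.contDiff.continuous_deriv (n := 1) (by simp)
  obtain ⟨B, hB⟩ := (isCompact_Icc (a := (0 : ℝ)) (b := 1)).exists_bound_of_continuousOn
    hc.continuousOn
  refine ⟨B, (norm_nonneg _).trans (hB 0 (by simp)), fun t => ?_⟩
  by_cases ht : t ∈ Set.Icc (0 : ℝ) 1
  · exact hB t ht
  · have h0 : deriv Real.smoothTransition t = 0 := by
      rw [Set.mem_Icc, not_and_or, not_le, not_le] at ht
      rcases ht with ht | ht
      · have : Real.smoothTransition =ᶠ[𝓝 t] fun _ => 0 := by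
          filter_upwards [isOpen_Iio.mem_nhds ht] with y hy
          exact Real.smoothTransition.zero_of_nonpos (le_of_lt hy)
        rw [this.deriv_eq, deriv_const]
      · have : Real.smoothTransition =ᶠ[𝓝 t] fun _ => 1 := by
          filter_upwards [isOpen_Ioi.mem_nhds ht] with y hy
          exact Real.smoothTransition.one_of_one_le (le_of_lt hy)
        rw [this.deriv_eq, deriv_const]
    rw [h0, abs_zero]
    exact (norm_nonneg _).trans (hB 0 (by simp))

/-- A smooth radial function that vanishes for `‖x‖ ≤ R` and is `1` for `‖x‖ ≥ 2 * R`. -/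
def radialCutoff (R : ℝ) (x : Plane) : ℝ := Real.smoothTransition (R⁻¹ ^ 2 * ‖x‖ ^ 2 - 1)

/-- The gradient of `radialCutoff R` at `x` is `radialSlope R x • x`. -/
def radialSlope (R : ℝ) (x : Plane) : ℝ :=
  2 * (R⁻¹ ^ 2 * deriv Real.smoothTransition (R⁻¹ ^ 2 * ‖x‖ ^ 2 - 1))

theorem contDiff_radialCutoff (R : ℝ) : ContDiff ℝ ∞ (radialCutoff R) :=
  Real.smoothTransition.contDiff.comp
    ((contDiff_const.mul (contDiff_norm_sq ℝ)).sub contDiff_const)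

theorem radialCutoff_eq_zero {R : ℝ} (hR : 0 < R) {x : Plane} (hx : ‖x‖ ≤ R) :
    radialCutoff R x = 0 := by
  refine Real.smoothTransition.zero_of_nonpos ?_
  rw [← mul_pow, sub_nonpos]
  refine pow_le_one₀ (by positivity) ?_
  rw [inv_mul_le_iff₀ hR, mul_one]
  exact hx

theorem radialCutoff_eq_one {R : ℝ} (hR : 0 < R) {x : Plane} (hx : 2 * R ≤ ‖x‖) :
    radialCutoff R x = 1 := by
  refine Real.smoothTransition.one_of_one_le ?_
  have : 2 ≤ R⁻¹ * ‖x‖ := by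
    rw [le_inv_mul_iff₀ hR]; linarith
  rw [← mul_pow]
  nlinarith

theorem radialCutoff_nonneg (R : ℝ) (x : Plane) : 0 ≤ radialCutoff R x :=
  Real.smoothTransition.nonneg _

theorem radialCutoff_le_one (R : ℝ) (x : Plane) : radialCutoff R x ≤ 1 :=
  Real.smoothTransition.le_one _

theorem scalarPartial_radialCutoff (R : ℝ) (x : Plane) (i : Fin 2) :
    scalarPartial (radialCutoff R) i x = radialSlope R x * x i := by
  have hd : Differentiable ℝ Real.smoothTransition :=
    (Real.smoothTransition.contDiff (n := 1)).differentiable (by simp)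
  have h1 : HasDerivAt (fun t : ℝ => Real.smoothTransition (R⁻¹ ^ 2 * t - 1))
      (deriv Real.smoothTransition (R⁻¹ ^ 2 * ‖x‖ ^ 2 - 1) * (R⁻¹ ^ 2 * 1)) (‖x‖ ^ 2) :=
    (hd _).hasDerivAt.comp (‖x‖ ^ 2) (((hasDerivAt_id (‖x‖ ^ 2)).const_mul _).sub_const 1)
  have := scalarPartial_comp_norm_sq h1 i
  unfold radialSlope
  refine this.trans ?_
  ring

theorem continuous_radialSlope (R : ℝ) : Continuous (radialSlope R) := by
  have hc : Continuous (deriv Real.smoothTransition) :=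
    Real.smoothTransition.contDiff.continuous_deriv (n := 1) (by simp)
  unfold radialSlope
  fun_prop

theorem radialSlope_nonneg (R : ℝ) (x : Plane) : 0 ≤ radialSlope R x := by
  have : Monotone Real.smoothTransition := Real.smoothTransition.monotone
  have := this.deriv_nonneg (x := R⁻¹ ^ 2 * ‖x‖ ^ 2 - 1)
  unfold radialSlope
  positivity

theorem radialSlope_neg (R : ℝ) (x : Plane) : radialSlope R (-x) = radialSlope R x := by
  unfold radialSlope
  rw [norm_neg]

theorem radialSlope_eq_zero {R : ℝ} (hR : 0 < R) {x : Plane} (hx : ‖x‖ < R ∨ 2 * R < ‖x‖) :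
    radialSlope R x = 0 := by
  have h0 : deriv Real.smoothTransition (R⁻¹ ^ 2 * ‖x‖ ^ 2 - 1) = 0 := by
    rw [← mul_pow]
    rcases hx with hx | hx
    · have ht : (R⁻¹ * ‖x‖) ^ 2 - 1 < 0 := by
        rw [sub_neg]
        refine pow_lt_one₀ (by positivity) ?_ two_ne_zero
        rw [inv_mul_lt_iff₀ hR, mul_one]
        exact hx
      have : Real.smoothTransition =ᶠ[𝓝 ((R⁻¹ * ‖x‖) ^ 2 - 1)] fun _ => 0 := by
        filter_upwards [isOpen_Iio.mem_nhds ht] with y hy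
        exact Real.smoothTransition.zero_of_nonpos (le_of_lt hy)
      rw [this.deriv_eq, deriv_const]
    · have h2 : 2 < R⁻¹ * ‖x‖ := by
        rw [lt_inv_mul_iff₀ hR]; linarith
      have ht : 1 < (R⁻¹ * ‖x‖) ^ 2 - 1 := by nlinarith
      have : Real.smoothTransition =ᶠ[𝓝 ((R⁻¹ * ‖x‖) ^ 2 - 1)] fun _ => 1 := by
        filter_upwards [isOpen_Ioi.mem_nhds ht] with y hy
        exact Real.smoothTransition.one_of_one_le (le_of_lt hy)
      rw [this.deriv_eq, deriv_const]
  unfold radialSlope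
  rw [h0, mul_zero, mul_zero]

/-- The closed annulus of radii `a` and `b`. -/
def annulus (a b : ℝ) : Set Plane := {x | a ≤ ‖x‖ ∧ ‖x‖ ≤ b}

theorem isCompact_annulus (a b : ℝ) : IsCompact (annulus a b) :=
  (isCompact_closedBall (0 : Plane) b).of_isClosed_subset
    ((isClosed_le continuous_const continuous_norm).inter
      (isClosed_le continuous_norm continuous_const)) fun x hx => by simpa using hx.2

theorem radialSlope_eq_zero_of_notMem {R : ℝ} (hR : 0 < R) {x : Plane}
    (hx : x ∉ annulus R (2 * R)) : radialSlope R x = 0 := by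
  refine radialSlope_eq_zero hR ?_
  by_contra! h
  exact hx h

theorem volume_annulus_le {a b : ℝ} (hb : 0 ≤ b) :
    volume.real (annulus a b) ≤ b ^ 2 * volume.real (Metric.closedBall (0 : Plane) 1) := by
  calc volume.real (annulus a b) ≤ volume.real (Metric.closedBall (0 : Plane) b) :=
        measureReal_mono (fun x hx => by simpa using hx.2) (isCompact_closedBall _ _).measure_lt_top.ne
    _ = _ := by
        have h := Measure.addHaar_closedBall' (volume : Measure Plane) 0 hb
        rw [finrank_euclideanSpace_fin] at h
        unfold Measure.real
        rw [h, ENNReal.toReal_mul, ENNReal.toReal_ofReal (by positivity)]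

theorem exists_abs_scalarPartial_radialCutoff_le :
    ∃ L : ℝ, 0 ≤ L ∧ ∀ R, 0 < R → ∀ x i, |scalarPartial (radialCutoff R) i x| ≤ L / R := by
  obtain ⟨B, hB0, hB⟩ := exists_abs_deriv_smoothTransition_le
  refine ⟨4 * B, by positivity, fun R hR x i => ?_⟩
  rw [scalarPartial_radialCutoff]
  by_cases hx : x ∈ annulus R (2 * R)
  · have h1 : |radialSlope R x| ≤ 2 * (R⁻¹ ^ 2 * B) := by
      unfold radialSlope
      rw [abs_mul, abs_mul, abs_of_pos (by norm_num : (0 : ℝ) < 2),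
        abs_of_pos (by positivity : 0 < R⁻¹ ^ 2)]
      gcongr
      exact hB _
    have h2 := (abs_apply_le_norm x i).trans hx.2
    rw [abs_mul]
    calc |radialSlope R x| * |x i| ≤ 2 * (R⁻¹ ^ 2 * B) * (2 * R) := by gcongr
      _ = 4 * B / R := by field_simp; ring
  · rw [radialSlope_eq_zero_of_notMem hR hx, zero_mul, abs_zero]
    positivity

/-- A smooth function that is `1` for `R ≤ ‖x‖ ≤ 2 * R` and vanishes unless
`R / 2 ≤ ‖x‖ ≤ 4 * R`. -/
def annularCutoff (R : ℝ) (x : Plane) : ℝ := radialCutoff (R / 2) x * (1 - radialCutoff (2 * R) x)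

theorem contDiff_annularCutoff (R : ℝ) : ContDiff ℝ ∞ (annularCutoff R) :=
  (contDiff_radialCutoff _).mul (contDiff_const.sub (contDiff_radialCutoff _))

theorem annularCutoff_eq_one {R : ℝ} (hR : 0 < R) {x : Plane} (hx : x ∈ annulus R (2 * R)) :
    annularCutoff R x = 1 := by
  unfold annularCutoff
  rw [radialCutoff_eq_one (by positivity) (by linarith [hx.1]),
    radialCutoff_eq_zero (by positivity) hx.2, sub_zero, one_mul]

theorem annularCutoff_eq_zero {R : ℝ} (hR : 0 < R) {x : Plane}
    (hx : x ∉ annulus (R / 2) (4 * R)) : annularCutoff R x = 0 := by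
  unfold annularCutoff
  have : ‖x‖ < R / 2 ∨ 4 * R < ‖x‖ := by
    by_contra! h
    exact hx h
  rcases this with h | h
  · rw [radialCutoff_eq_zero (by positivity) h.le, zero_mul]
  · rw [radialCutoff_eq_one (R := 2 * R) (by positivity) (by linarith), sub_self, mul_zero]

theorem tsupport_annularCutoff_subset {R : ℝ} (hR : 0 < R) :
    tsupport (annularCutoff R) ⊆ annulus (R / 2) (4 * R) :=
  closure_minimal (fun _ hx => by_contra fun h => hx (annularCutoff_eq_zero hR h))
    (isCompact_annulus _ _).isClosed

theorem exists_abs_scalarPartial_annularCutoff_le :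
    ∃ L : ℝ, 0 ≤ L ∧ ∀ R, 0 < R → ∀ x i, |scalarPartial (annularCutoff R) i x| ≤ L / R := by
  obtain ⟨L, hL0, hL⟩ := exists_abs_scalarPartial_radialCutoff_le
  refine ⟨3 * L, by positivity, fun R hR x i => ?_⟩
  have hd : ∀ R, DifferentiableAt ℝ (radialCutoff R) x := fun R =>
    (contDiff_radialCutoff R).differentiable (by simp) x
  have h1 := hL (R / 2) (by positivity) x i
  have h2 := hL (2 * R) (by positivity) x i
  have e : scalarPartial (annularCutoff R) i x = radialCutoff (R / 2) x
      * -scalarPartial (radialCutoff (2 * R)) i x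
      + (1 - radialCutoff (2 * R) x) * scalarPartial (radialCutoff (R / 2)) i x := by
    rw [← scalarPartial_const_sub]
    exact scalarPartial_mul (hd _) ((hd _).const_sub 1) i
  have a1 : |radialCutoff (R / 2) x| ≤ 1 := by
    rw [abs_of_nonneg (radialCutoff_nonneg _ _)]; exact radialCutoff_le_one _ _
  have a2 : |1 - radialCutoff (2 * R) x| ≤ 1 := by
    rw [abs_of_nonneg (sub_nonneg.2 (radialCutoff_le_one _ _))]
    linarith [radialCutoff_nonneg (2 * R) x]
  rw [e]
  calc _ ≤ |radialCutoff (R / 2) x| * |scalarPartial (radialCutoff (2 * R)) i x|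
      + |1 - radialCutoff (2 * R) x| * |scalarPartial (radialCutoff (R / 2)) i x| := by
        rw [← abs_neg (scalarPartial (radialCutoff (2 * R)) i x), ← abs_mul, ← abs_mul]
        exact abs_add_le _ _
    _ ≤ 1 * (L / (2 * R)) + 1 * (L / (R / 2)) := by gcongr
    _ = 5 / 2 * (L / R) := by field_simp; norm_num
    _ ≤ 3 * L / R := by
        rw [mul_div_assoc]
        have : 0 ≤ L / R := by positivity
        linarith

/-- The slope is homogeneous of degree `-2` under dilations of the plane, so its integral is the
same at every radius; it is the normalising constant of the flux. -/
theorem integral_radialSlope {R : ℝ} (hR : 0 < R) :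
    ∫ x, radialSlope R x = ∫ x, radialSlope 1 x := by
  have h : ∀ x : Plane, radialSlope R x = R⁻¹ ^ 2 * radialSlope 1 (R⁻¹ • x) := fun x => by
    unfold radialSlope
    rw [norm_smul, Real.norm_of_nonneg (by positivity)]
    ring_nf
  simp_rw [h]
  rw [integral_const_mul, Measure.integral_comp_inv_smul, finrank_euclideanSpace_fin, smul_eq_mul,
    abs_of_pos (by positivity), ← mul_assoc]
  field_simp

theorem integral_radialSlope_one_pos : 0 < ∫ x, radialSlope 1 x := by
  have hd : Differentiable ℝ Real.smoothTransition :=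
    (Real.smoothTransition.contDiff (n := 1)).differentiable (by simp)
  -- The mean value theorem gives a point of slope `1` in the transition, which is attained where
  -- `‖x‖ ^ 2 = 1 + t`.
  obtain ⟨t, ht, hdt⟩ := exists_deriv_eq_slope Real.smoothTransition (by norm_num : (0 : ℝ) < 1)
    hd.continuous.continuousOn hd.differentiableOn
  rw [Real.smoothTransition.one, Real.smoothTransition.zero] at hdt
  refine (continuous_radialSlope 1).integral_pos_of_hasCompactSupport_nonneg_nonzero
    (HasCompactSupport.intro (isCompact_annulus 1 (2 * 1))
      fun _ hx => radialSlope_eq_zero_of_notMem one_pos hx)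
    (fun x => radialSlope_nonneg 1 x) (x := EuclideanSpace.single 0 √(1 + t)) ?_
  have h : (1 : ℝ)⁻¹ ^ 2 * ‖(EuclideanSpace.single 0 √(1 + t) : Plane)‖ ^ 2 - 1 = t := by
    rw [PiLp.norm_single, Real.norm_of_nonneg (Real.sqrt_nonneg _),
      Real.sq_sqrt (by linarith [ht.1])]
    ring
  unfold radialSlope
  rw [h, hdt]
  norm_num

end

/-! ### The weak minimal surface equation, Caccioppoli's inequality and the catenoid. -/

section

open MeasureTheory

/-- The exterior of a disk. -/
def exterior (R : ℝ) : Set Plane := {x | R < ‖x‖}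

theorem isOpen_exterior (R : ℝ) : IsOpen (exterior R) := isOpen_lt continuous_const continuous_norm

theorem annulus_subset_exterior {R a b : ℝ} (h : R < a) : annulus a b ⊆ exterior R :=
  fun _ hx => h.trans_le hx.1

/-- `u` satisfies the minimal surface equation weakly outside the disk of radius `R`. -/
def IsWeakMinimalGraph (u : Plane → ℝ) (R : ℝ) : Prop :=
  ∀ ψ : Plane → ℝ, ContDiff ℝ ∞ ψ → HasCompactSupport ψ → tsupport ψ ⊆ exterior R →
    ∫ x, graphForm (scalarPartial u 0 x) (scalarPartial u 1 x) (scalarPartial ψ 0 x)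
      (scalarPartial ψ 1 x) 0 0 1 = 0

/-- The sine of the slope of the graph of `u`: the horizontal part of its unit normal. -/
def slopeSine (u : Plane → ℝ) (i : Fin 2) (x : Plane) : ℝ :=
  scalarPartial u i x / √(1 + scalarPartial u 0 x ^ 2 + scalarPartial u 1 x ^ 2)

theorem contDiffOn_slopeSine {u : Plane → ℝ} {Ω : Set Plane} (hΩ : IsOpen Ω)
    (hu : ContDiffOn ℝ ∞ u Ω) (i : Fin 2) : ContDiffOn ℝ ∞ (slopeSine u i) Ω := by
  have h := hu.scalarPartial hΩ
  have hpos : ∀ x, 0 < 1 + scalarPartial u 0 x ^ 2 + scalarPartial u 1 x ^ 2 := fun x => by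
    positivity
  exact (h i).div (((contDiffOn_const.add ((h 0).pow 2)).add ((h 1).pow 2)).sqrt
    fun x _ => (hpos x).ne') fun x _ => (Real.sqrt_pos.2 (hpos x)).ne'

theorem contDiff_of_tsupport_subset {f : Plane → ℝ} {Ω : Set Plane} (hΩ : IsOpen Ω)
    (hf : ContDiffOn ℝ ∞ f Ω) (hs : tsupport f ⊆ Ω) : ContDiff ℝ ∞ f := by
  rw [contDiff_iff_contDiffAt]
  intro x
  by_cases hx : x ∈ Ω
  · exact hf.contDiffAt (hΩ.mem_nhds hx)
  · exact contDiffAt_const.congr_of_eventuallyEq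
      (notMem_tsupport_iff_eventuallyEq.1 fun h => hx (hs h))

/-- Caccioppoli's inequality for the difference of two solutions of the minimal surface
equation. -/
theorem integral_gradientDefect_le {u h η : Plane → ℝ} {R : ℝ}
    (hu : ContDiffOn ℝ ∞ u (exterior R)) (hh : ContDiffOn ℝ ∞ h (exterior R))
    (hu' : IsWeakMinimalGraph u R) (hh' : IsWeakMinimalGraph h R) (hη : ContDiff ℝ ∞ η)
    (hηc : HasCompactSupport η) (hηs : tsupport η ⊆ exterior R) :
    Integrable (fun x => η x ^ 2 * gradientDefect (scalarPartial u 0 x) (scalarPartial u 1 x)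
      (scalarPartial h 0 x) (scalarPartial h 1 x)) ∧
    ∫ x, η x ^ 2 * gradientDefect (scalarPartial u 0 x) (scalarPartial u 1 x)
      (scalarPartial h 0 x) (scalarPartial h 1 x)
    ≤ 4 * ∫ x, (u x - h x) ^ 2 * (scalarPartial η 0 x ^ 2 + scalarPartial η 1 x ^ 2) := by
  have hΩ := isOpen_exterior R
  let w : Plane → ℝ := fun x => u x - h x
  have hw : ContDiffOn ℝ ∞ w (exterior R) := hu.sub hh
  -- The test function `η ^ 2 * (u - h)` is inserted into the difference of the two equations.
  let ψ : Plane → ℝ := fun x => η x * (η x * w x)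
  have hz : ∀ x ∉ tsupport η, η x = 0 := fun x hx => image_eq_zero_of_notMem_tsupport hx
  have hψs : tsupport ψ ⊆ tsupport η := tsupport_mul_subset_left
  have hψ : ContDiff ℝ ∞ ψ := contDiff_of_tsupport_subset hΩ
    (hη.contDiffOn.mul (hη.contDiffOn.mul hw)) (hψs.trans hηs)
  have hψc : HasCompactSupport ψ := hηc.mul_right
  have hz' : ∀ i, ∀ x ∉ tsupport η, scalarPartial η i x = 0 := fun i x hx => by
    unfold scalarPartial
    rw [fderiv_of_notMem_tsupport ℝ hx]; rfl
  have hψz : ∀ i, ∀ x ∉ tsupport η, scalarPartial ψ i x = 0 := fun i x hx => by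
    unfold scalarPartial
    rw [fderiv_of_notMem_tsupport ℝ fun h => hx (hψs h)]; rfl
  have hηp := fun i => (continuous_scalarPartial hη i).continuousOn (s := exterior R)
  have hψp := fun i => (continuous_scalarPartial hψ i).continuousOn (s := exterior R)
  have hup := fun i => (hu.scalarPartial hΩ i).continuousOn
  have hhp := fun i => (hh.scalarPartial hΩ i).continuousOn
  have hus := fun i => (contDiffOn_slopeSine hΩ hu i).continuousOn
  have hhs := fun i => (contDiffOn_slopeSine hΩ hh i).continuousOn
  have hηo : ContinuousOn η (exterior R) := hη.continuous.continuousOn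
  set T : Plane → ℝ := fun x => gradientDefect (scalarPartial u 0 x) (scalarPartial u 1 x)
      (scalarPartial h 0 x) (scalarPartial h 1 x) with hT
  have hTc : ContinuousOn T (exterior R) :=
    (((hus 0).sub (hhs 0)).mul ((hup 0).sub (hhp 0))).add
      (((hus 1).sub (hhs 1)).mul ((hup 1).sub (hhp 1)))
  have int : ∀ {f : Plane → ℝ}, ContinuousOn f (exterior R) → (∀ x ∉ tsupport η, f x = 0) →
      Integrable f := fun hf h0 =>
    (integrable_of_continuousOn_of_eq_zero hΩ hf hηc.isCompact hηs h0).2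
  have iT : Integrable (fun x => η x ^ 2 * T x) :=
    int ((hηo.pow 2).mul hTc) fun x hx => by simp [hz x hx]
  have iw : Integrable (fun x => w x ^ 2 * (scalarPartial η 0 x ^ 2 + scalarPartial η 1 x ^ 2)) :=
    int ((hw.continuousOn.pow 2).mul (((hηp 0).pow 2).add ((hηp 1).pow 2)))
      fun x hx => by simp [hz' _ x hx]
  have weak : ∀ {g : Plane → ℝ}, ContDiffOn ℝ ∞ g (exterior R) → IsWeakMinimalGraph g R →
      Integrable (fun x => scalarPartial ψ 0 x * slopeSine g 0 x
        + scalarPartial ψ 1 x * slopeSine g 1 x) ∧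
      ∫ x, (scalarPartial ψ 0 x * slopeSine g 0 x + scalarPartial ψ 1 x * slopeSine g 1 x) = 0 := by
    intro g hg hg'
    refine ⟨int (((hψp 0).mul (contDiffOn_slopeSine hΩ hg 0).continuousOn).add
      ((hψp 1).mul (contDiffOn_slopeSine hΩ hg 1).continuousOn)) fun x hx => by
        simp [hψz _ x hx], ?_⟩
    have := hg' ψ hψ hψc (hψs.trans hηs)
    simp_rw [graphForm_vertical] at this
    exact this
  obtain ⟨iu, eu⟩ := weak hu hu'
  obtain ⟨ih, eh⟩ := weak hh hh'
  -- The cross term `2 * η * w * ⟪∇η, a - b⟫` is split by Young's inequality. Since `‖a - b‖ ^ 2 ≤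
  -- T`, half of `η ^ 2 * T` absorbs it at the cost of `2 * w ^ 2 * ‖∇η‖ ^ 2`.
  have hpt : ∀ x, 2⁻¹ * (η x ^ 2 * T x)
      - 2 * (w x ^ 2 * (scalarPartial η 0 x ^ 2 + scalarPartial η 1 x ^ 2))
      ≤ (scalarPartial ψ 0 x * slopeSine u 0 x + scalarPartial ψ 1 x * slopeSine u 1 x)
      - (scalarPartial ψ 0 x * slopeSine h 0 x + scalarPartial ψ 1 x * slopeSine h 1 x) := by
    intro x
    by_cases hx : x ∈ tsupport η
    · have hxR := hΩ.mem_nhds (hηs hx)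
      have du := (hu.contDiffAt hxR).differentiableAt (by simp)
      have dh := (hh.contDiffAt hxR).differentiableAt (by simp)
      have dw : DifferentiableAt ℝ w x := du.sub dh
      have dη := hη.differentiable (by simp) x
      have hψi : ∀ i, scalarPartial ψ i x = η x * (η x * (scalarPartial u i x - scalarPartial h i x)
          + w x * scalarPartial η i x) + (η x * w x) * scalarPartial η i x := fun i => by
        rw [← scalarPartial_sub du dh]
        rw [← scalarPartial_mul dη dw]
        exact scalarPartial_mul dη (dη.fun_mul dw) i
      have hle := sq_add_sq_add_sq_le_gradientDefect (scalarPartial u 0 x) (scalarPartial u 1 x)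
        (scalarPartial h 0 x) (scalarPartial h 1 x) rfl rfl
      rw [hψi, hψi]
      have hd : (slopeSine u 0 x - slopeSine h 0 x) ^ 2 + (slopeSine u 1 x - slopeSine h 1 x) ^ 2
          ≤ T x := le_trans (le_add_of_nonneg_right (sq_nonneg _)) hle
      have hTx : T x = (slopeSine u 0 x - slopeSine h 0 x)
          * (scalarPartial u 0 x - scalarPartial h 0 x) + (slopeSine u 1 x - slopeSine h 1 x)
          * (scalarPartial u 1 x - scalarPartial h 1 x) := rfl
      generalize slopeSine u 0 x = a₀ at *
      generalize slopeSine u 1 x = a₁ at *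
      generalize slopeSine h 0 x = b₀ at *
      generalize slopeSine h 1 x = b₁ at *
      have hη2 := mul_le_mul_of_nonneg_left hd (sq_nonneg (η x))
      have e1 := sq_nonneg (η x * (a₀ - b₀) + 2 * (w x * scalarPartial η 0 x))
      have e2 := sq_nonneg (η x * (a₁ - b₁) + 2 * (w x * scalarPartial η 1 x))
      have hTx' : η x ^ 2 * T x = η x ^ 2 * ((a₀ - b₀)
          * (scalarPartial u 0 x - scalarPartial h 0 x) + (a₁ - b₁)
          * (scalarPartial u 1 x - scalarPartial h 1 x)) := by rw [hTx]
      nlinarith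
    · simp [hz x hx, hz' _ x hx, hψz _ x hx]
  have hint := integral_mono ((iT.const_mul 2⁻¹).sub (iw.const_mul 2)) (iu.sub ih) hpt
  simp only [Pi.sub_apply] at hint
  rw [integral_sub (iT.const_mul _) (iw.const_mul _), integral_sub iu ih, eu, eh,
    integral_const_mul, integral_const_mul] at hint
  refine ⟨iT, ?_⟩
  linarith

namespace Catenoid

variable (C : Catenoid)

theorem height_neg (x : Plane) : C.height (-x) = C.height x := by
  unfold height
  rw [norm_neg]

theorem height_nonneg_le {x : Plane} (hx : C.waist < ‖x‖) : 0 ≤ C.height x ∧ C.height x ≤ ‖x‖ := by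
  have hc := C.waist_pos
  have h1 : 1 ≤ ‖x‖ / C.waist := by rw [one_le_div hc]; exact hx.le
  have h2 := Real.arcosh_nonneg h1
  refine ⟨mul_nonneg hc.le h2, ?_⟩
  have h3 : Real.arcosh (‖x‖ / C.waist) ≤ ‖x‖ / C.waist := by
    conv_rhs => rw [← Real.cosh_arcosh h1]
    have e1 := Real.sinh_lt_cosh (x := Real.arcosh (‖x‖ / C.waist))
    have e2 := Real.self_le_sinh_iff.2 h2
    linarith
  calc C.height x ≤ C.waist * (‖x‖ / C.waist) := mul_le_mul_of_nonneg_left h3 hc.le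
    _ = ‖x‖ := by field_simp

theorem contDiffOn_height : ContDiffOn ℝ ∞ C.height (exterior C.waist) := by
  intro x hx
  have hc := C.waist_pos
  have hx' : C.waist < ‖x‖ := hx
  have hx0 : x ≠ 0 := norm_pos_iff.1 (hc.trans hx')
  have h1 : ‖x‖ / C.waist ∈ Set.Ioi (1 : ℝ) := by
    rw [Set.mem_Ioi, one_lt_div hc]; exact hx'
  refine ContDiffAt.contDiffWithinAt (contDiffAt_const.mul ?_)
  exact ContDiffAt.comp x (f := fun x : Plane => ‖x‖ / C.waist) (g := Real.arcosh)
    (Real.contDiffAt_arcosh h1) ((contDiffAt_norm ℝ hx0).div_const _)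

theorem scalarPartial_height {x : Plane} (hx : C.waist < ‖x‖) (i : Fin 2) :
    scalarPartial C.height i x = C.waist / (‖x‖ * √(‖x‖ ^ 2 - C.waist ^ 2)) * x i := by
  have hc := C.waist_pos
  have hx0 : 0 < ‖x‖ := hc.trans hx
  have h1 : ‖x‖ / C.waist ∈ Set.Ioi (1 : ℝ) := by
    rw [Set.mem_Ioi, one_lt_div hc]; exact hx
  have hD : 0 < ‖x‖ ^ 2 - C.waist ^ 2 := by nlinarith
  have hs : √((‖x‖ / C.waist) ^ 2 - 1) = √(‖x‖ ^ 2 - C.waist ^ 2) / C.waist := by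
    rw [show (‖x‖ / C.waist) ^ 2 - 1 = (‖x‖ ^ 2 - C.waist ^ 2) / C.waist ^ 2 by field_simp,
      Real.sqrt_div hD.le, Real.sqrt_sq hc.le]
  have hsq : √(‖x‖ ^ 2) = ‖x‖ := Real.sqrt_sq hx0.le
  have d1 : HasDerivAt (fun t : ℝ => √t / C.waist) (1 / (2 * ‖x‖) / C.waist) (‖x‖ ^ 2) := by
    have := (Real.hasDerivAt_sqrt (pow_pos hx0 2).ne').div_const C.waist
    rwa [hsq] at this
  have d2 : HasDerivAt (fun t : ℝ => C.waist * Real.arcosh (√t / C.waist))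
      (C.waist * ((√((‖x‖ / C.waist) ^ 2 - 1))⁻¹ * (1 / (2 * ‖x‖) / C.waist))) (‖x‖ ^ 2) := by
    refine HasDerivAt.const_mul _ (HasDerivAt.comp (‖x‖ ^ 2) (h₂ := Real.arcosh) ?_ d1)
    rw [hsq]
    exact Real.hasDerivAt_arcosh h1
  have he : C.height = fun y => (fun t : ℝ => C.waist * Real.arcosh (√t / C.waist)) (‖y‖ ^ 2) := by
    funext y
    simp [height, Real.sqrt_sq (norm_nonneg y)]
  have hDs := Real.sqrt_pos.2 hD
  rw [he, scalarPartial_comp_norm_sq d2, hs]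
  field_simp

theorem norm_sq_plane (x : Plane) : ‖x‖ ^ 2 = x 0 ^ 2 + x 1 ^ 2 := by
  rw [EuclideanSpace.real_norm_sq_eq, Fin.sum_univ_two]

theorem graphArea_height {x : Plane} (hx : C.waist < ‖x‖) :
    √(1 + scalarPartial C.height 0 x ^ 2 + scalarPartial C.height 1 x ^ 2)
      = ‖x‖ / √(‖x‖ ^ 2 - C.waist ^ 2) := by
  have hc := C.waist_pos
  have hx0 : 0 < ‖x‖ := hc.trans hx
  have hD : 0 < ‖x‖ ^ 2 - C.waist ^ 2 := by nlinarith
  have hDs := Real.sqrt_pos.2 hD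
  rw [C.scalarPartial_height hx, C.scalarPartial_height hx, Real.sqrt_eq_iff_mul_self_eq_of_pos
    (by positivity)]
  have h2 : √(‖x‖ ^ 2 - C.waist ^ 2) ^ 2 = ‖x‖ ^ 2 - C.waist ^ 2 := Real.sq_sqrt hD.le
  have h3 := norm_sq_plane x
  set D := √(‖x‖ ^ 2 - C.waist ^ 2)
  field_simp
  linear_combination -(‖x‖ ^ 2) * h2 + C.waist ^ 2 * h3

theorem graphArea_height_le {x : Plane} (hx : 2 * C.waist ≤ ‖x‖) :
    √(1 + scalarPartial C.height 0 x ^ 2 + scalarPartial C.height 1 x ^ 2) ≤ 2 := by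
  have hc := C.waist_pos
  have hD : 0 < ‖x‖ ^ 2 - C.waist ^ 2 := by nlinarith
  rw [C.graphArea_height (by linarith), div_le_iff₀ (Real.sqrt_pos.2 hD)]
  have : ‖x‖ / 2 ≤ √(‖x‖ ^ 2 - C.waist ^ 2) := Real.le_sqrt_of_sq_le (by nlinarith)
  linarith

theorem slopeSine_height {x : Plane} (hx : C.waist < ‖x‖) (i : Fin 2) :
    slopeSine C.height i x = C.waist * x i / ‖x‖ ^ 2 := by
  have hc := C.waist_pos
  have hx0 : 0 < ‖x‖ := hc.trans hx
  have hD : 0 < ‖x‖ ^ 2 - C.waist ^ 2 := by nlinarith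
  have hDs := Real.sqrt_pos.2 hD
  unfold slopeSine
  rw [C.graphArea_height hx, C.scalarPartial_height hx]
  field_simp

/-- By `slopeSine_height` the horizontal normal of the catenoid is the gradient of `waist * log
‖x‖`, and the logarithm is harmonic off the origin. -/
theorem isWeakMinimalGraph_height : IsWeakMinimalGraph C.height C.waist := by
  intro ψ hψ hψc hψs
  have hΩ : IsOpen ({0}ᶜ : Set Plane) := isOpen_compl_singleton
  have hx2 : ∀ x ∈ ({0}ᶜ : Set Plane), ‖x‖ ^ 2 ≠ 0 := fun x hx => by
    have : 0 < ‖x‖ := norm_pos_iff.2 hx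
    positivity
  have hV : ∀ i : Fin 2, ContDiffOn ℝ ∞ (fun x : Plane => C.waist * x i / ‖x‖ ^ 2) {0}ᶜ := fun i =>
    ContDiffOn.div (by fun_prop) (contDiff_norm_sq ℝ).contDiffOn hx2
  have hp : ∀ x ∈ ({0}ᶜ : Set Plane), ∀ i : Fin 2,
      scalarPartial (fun x : Plane => C.waist * x i / ‖x‖ ^ 2) i x
      = C.waist / ‖x‖ ^ 2 - 2 * C.waist * x i ^ 2 / (‖x‖ ^ 2) ^ 2 := by
    intro x hx i
    have h1 : HasFDerivAt (fun x : Plane => C.waist * x i)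
        (C.waist • (EuclideanSpace.proj i : Plane →L[ℝ] ℝ)) x :=
      ((EuclideanSpace.proj i : Plane →L[ℝ] ℝ).hasFDerivAt).const_mul C.waist
    have h2 := h1.fun_mul ((hasDerivAt_inv (hx2 x hx)).comp_hasFDerivAt x
      (hasStrictFDerivAt_norm_sq x).hasFDerivAt)
    have hne := hx2 x hx
    unfold scalarPartial
    rw [show (fun x : Plane => C.waist * x i / ‖x‖ ^ 2)
      = fun x : Plane => C.waist * x i * (Inv.inv ∘ fun x => ‖x‖ ^ 2) x from rfl, h2.fderiv]
    simp [EuclideanSpace.inner_single_right]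
    field_simp
    ring
  have key := integral_gradient_divergence_free hΩ (hV 0) (hV 1) (fun x hx => by
    rw [hp x hx, hp x hx]
    have hne := hx2 x hx
    have h3 := norm_sq_plane x
    rw [h3] at hne ⊢
    field_simp
    ring) hψ hψc (fun x hx => norm_pos_iff.1 (C.waist_pos.trans (hψs hx)))
  refine (integral_congr_ae (Filter.Eventually.of_forall fun x => ?_)).trans key
  dsimp only
  by_cases hx : x ∈ tsupport ψ
  · rw [graphForm_vertical]
    have := C.slopeSine_height (hψs hx)
    unfold slopeSine at this
    rw [this, this]
  · have h0 : ∀ i, scalarPartial ψ i x = 0 := fun i => by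
      unfold scalarPartial
      rw [fderiv_of_notMem_tsupport ℝ hx]; rfl
    rw [graphForm_vertical, h0, h0]
    ring

end Catenoid

end

/-! ### The flux of a Killing field through a catenoid. -/

section

open MeasureTheory Filter

namespace Catenoid

/-- The flux density of the field `k` along the graph of `u` in the frame of the catenoid,
tested with `ψ`. -/
def graphFlux (C : Catenoid) (k : Space → Space) (u ψ : Plane → ℝ) (x : Plane) : ℝ :=
  graphForm (scalarPartial u 0 x) (scalarPartial u 1 x) (scalarPartial ψ 0 x) (scalarPartial ψ 1 x)
    (inner ℝ (C.frame 0) (k (C.point x (u x)))) (inner ℝ (C.frame 1) (k (C.point x (u x))))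
    (inner ℝ (C.frame 2) (k (C.point x (u x))))

variable (C : Catenoid)

theorem graphFlux_eq_zero {k : Space → Space} {u : Plane → ℝ} {R : ℝ} (hR : 0 < R) {x : Plane}
    (hx : x ∉ annulus R (2 * R)) : C.graphFlux k u (radialCutoff R) x = 0 := by
  unfold graphFlux graphForm
  rw [scalarPartial_radialCutoff, scalarPartial_radialCutoff,
    radialSlope_eq_zero_of_notMem hR hx]
  ring

theorem integrable_graphFlux {k : Space → Space} (hk : Continuous k) {u : Plane → ℝ} {r R : ℝ}
    (hu : ContDiffOn ℝ ∞ u (exterior r)) (hR : 0 < R) (hrR : r < R) :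
    Integrable (C.graphFlux k u (radialCutoff R)) := by
  refine (integrable_of_continuousOn_of_eq_zero (isOpen_exterior r) ?_
    (isCompact_annulus R (2 * R)) (annulus_subset_exterior hrR)
    fun x hx => C.graphFlux_eq_zero hR hx).2
  have hup := fun i => (hu.scalarPartial (isOpen_exterior r) i).continuousOn
  have hψp := fun i => (continuous_scalarPartial (contDiff_radialCutoff R) i).continuousOn
    (s := exterior r)
  have huc := hu.continuousOn
  have hpt : ContinuousOn (fun x => C.point x (u x)) (exterior r) := by
    unfold point
    fun_prop
  have hkj : ∀ j, ContinuousOn (fun x => inner ℝ (C.frame j) (k (C.point x (u x)))) (exterior r) :=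
    fun j => continuousOn_const.inner (hk.comp_continuousOn hpt)
  have hpos : ∀ x ∈ exterior r, √(1 + scalarPartial u 0 x ^ 2 + scalarPartial u 1 x ^ 2) ≠ 0 :=
    fun x _ => by positivity
  unfold graphFlux graphForm
  have h0 := hup 0
  have h1 := hup 1
  have g0 := hψp 0
  have g1 := hψp 1
  have k0 := hkj 0
  have k1 := hkj 1
  have k2 := hkj 2
  fun_prop (disch := assumption)

theorem inner_frame_field (v : Space) (A : Space →L[ℝ] Space) (x : Plane) (z : ℝ) (j : Fin 3) :
    inner ℝ (C.frame j) (v + A (C.point x z)) = inner ℝ (C.frame j) (v + A C.center)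
      + x 0 * inner ℝ (C.frame j) (A (C.frame 0)) + x 1 * inner ℝ (C.frame j) (A (C.frame 1))
      + z * inner ℝ (C.frame j) (A (C.frame 2)) := by
  unfold point
  simp only [map_add, map_smul, inner_add_right, real_inner_smul_right]
  ring

/-- The gradients of the height and of the cutoff are both radial, so only the radial and vertical
components of `k` survive. -/
theorem graphFlux_height {k : Space → Space} {R : ℝ} {x : Plane} (hx : C.waist < ‖x‖) :
    C.graphFlux k C.height (radialCutoff R) x = radialSlope R x *
      (√(‖x‖ ^ 2 - C.waist ^ 2) / ‖x‖ * (x 0 * inner ℝ (C.frame 0) (k (C.point x (C.height x)))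
        + x 1 * inner ℝ (C.frame 1) (k (C.point x (C.height x))))
        + C.waist * inner ℝ (C.frame 2) (k (C.point x (C.height x)))) := by
  have hc := C.waist_pos
  have hx0 : 0 < ‖x‖ := hc.trans hx
  have hD : 0 < ‖x‖ ^ 2 - C.waist ^ 2 := by nlinarith
  have hDs := Real.sqrt_pos.2 hD
  have h3 := norm_sq_plane x
  unfold graphFlux graphForm
  rw [C.graphArea_height hx, C.scalarPartial_height hx, C.scalarPartial_height hx,
    scalarPartial_radialCutoff, scalarPartial_radialCutoff]
  generalize inner ℝ (C.frame 0) (k (C.point x (C.height x))) = k₀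
  generalize inner ℝ (C.frame 1) (k (C.point x (C.height x))) = k₁
  generalize inner ℝ (C.frame 2) (k (C.point x (C.height x))) = k₂
  generalize √(‖x‖ ^ 2 - C.waist ^ 2) = D at *
  field_simp
  linear_combination (-(radialSlope R x * C.waist * k₂ * ‖x‖ ^ 2 * D ^ 2)) * h3

/-- The flux of a Killing field through the end of a catenoid. -/
theorem integral_graphFlux_height {A : Space →L[ℝ] Space} (hA : ∀ x, inner ℝ x (A x) = 0)
    (v : Space) {R : ℝ} (hR : C.waist < R) :
    ∫ x, C.graphFlux (fun y => v + A y) C.height (radialCutoff R) x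
      = C.waist * inner ℝ (C.frame 2) (v + A C.center) * ∫ x, radialSlope 1 x := by
  have hR0 : 0 < R := C.waist_pos.trans hR
  have hi := C.integrable_graphFlux (k := fun y => v + A y) (by fun_prop) C.contDiffOn_height hR0 hR
  set F := C.graphFlux (fun y => v + A y) C.height (radialCutoff R) with hF
  have hskew : ∀ i j, inner ℝ (C.frame i) (A (C.frame j)) = - inner ℝ (C.frame j) (A (C.frame i)) := by
    intro i j
    have := hA (C.frame i + C.frame j)
    simp only [map_add, inner_add_left, inner_add_right, hA] at this
    linarith
  -- Adding the values at opposite points removes every term odd in `x`; the height is even. The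
  -- quadratic terms `x 0 * x 1` cancel by skewness of `A`, and only the field at the center is
  -- left.
  have hsym : ∀ x, F x + F (-x)
      = 2 * (C.waist * inner ℝ (C.frame 2) (v + A C.center)) * radialSlope R x := by
    intro x
    by_cases hx : x ∈ annulus R (2 * R)
    · have hx' : C.waist < ‖x‖ := hR.trans_le hx.1
      have hx'' : C.waist < ‖-x‖ := by rwa [norm_neg]
      rw [hF, C.graphFlux_height hx', C.graphFlux_height hx'']
      simp only [inner_frame_field, height_neg, radialSlope_neg, norm_neg, PiLp.neg_apply, hA]
      rw [hskew 1 0]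
      ring
    · have hx' : -x ∉ annulus R (2 * R) := fun h => hx (by simpa [annulus] using h)
      rw [hF, C.graphFlux_eq_zero hR0 hx, C.graphFlux_eq_zero hR0 hx',
        radialSlope_eq_zero_of_notMem hR0 hx]
      ring
  have h1 : ∫ x, (F x + F (-x)) = 2 * ∫ x, F x := by
    rw [integral_add hi hi.comp_neg, integral_neg_eq_self F volume]
    ring
  simp_rw [hsym] at h1
  rw [integral_const_mul, integral_radialSlope hR0] at h1
  linarith

theorem exists_field_bound (v : Space) (A : Space →L[ℝ] Space) :
    ∃ B : ℝ, 0 ≤ B ∧ (∀ R, 1 ≤ R → ∀ (x : Plane) (z : ℝ), ‖x‖ ≤ 2 * R → |z| ≤ 3 * R →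
      |inner ℝ (C.frame 0) (v + A (C.point x z))| + |inner ℝ (C.frame 1) (v + A (C.point x z))|
      + |inner ℝ (C.frame 2) (v + A (C.point x z))| ≤ B * R) ∧
      ∀ (x : Plane) (z z' : ℝ),
      |inner ℝ (C.frame 0) (v + A (C.point x z)) - inner ℝ (C.frame 0) (v + A (C.point x z'))|
      + |inner ℝ (C.frame 1) (v + A (C.point x z)) - inner ℝ (C.frame 1) (v + A (C.point x z'))|
      + |inner ℝ (C.frame 2) (v + A (C.point x z)) - inner ℝ (C.frame 2) (v + A (C.point x z'))|
      ≤ B * |z - z'| := by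
  let b : Fin 3 → ℝ := fun j => |inner ℝ (C.frame j) (v + A C.center)|
    + 7 * (|inner ℝ (C.frame j) (A (C.frame 0))| + |inner ℝ (C.frame j) (A (C.frame 1))|
      + |inner ℝ (C.frame j) (A (C.frame 2))|)
  have h1 : ∀ R, 1 ≤ R → ∀ (x : Plane) (z : ℝ), ‖x‖ ≤ 2 * R → |z| ≤ 3 * R → ∀ j,
      |inner ℝ (C.frame j) (v + A (C.point x z))| ≤ b j * R := by
    intro R hR x z hx hz j
    have e0 := (abs_apply_le_norm x 0).trans hx
    have e1 := (abs_apply_le_norm x 1).trans hx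
    rw [inner_frame_field]
    simp only [b]
    generalize inner ℝ (C.frame j) (v + A C.center) = c
    generalize inner ℝ (C.frame j) (A (C.frame 0)) = a₀
    generalize inner ℝ (C.frame j) (A (C.frame 1)) = a₁
    generalize inner ℝ (C.frame j) (A (C.frame 2)) = a₂
    calc |c + x 0 * a₀ + x 1 * a₁ + z * a₂| ≤ |c| + |x 0| * |a₀| + |x 1| * |a₁| + |z| * |a₂| := by
          rw [← abs_mul, ← abs_mul, ← abs_mul]
          exact (abs_add_le _ _).trans (add_le_add_left (abs_add_three _ _ _) _)
      _ ≤ |c| * R + (7 * R) * |a₀| + (7 * R) * |a₁| + (7 * R) * |a₂| := by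
          have : |c| ≤ |c| * R := le_mul_of_one_le_right (abs_nonneg _) hR
          gcongr <;> linarith
      _ = _ := by ring
  have h2 : ∀ (x : Plane) (z z' : ℝ) (j), |inner ℝ (C.frame j) (v + A (C.point x z))
      - inner ℝ (C.frame j) (v + A (C.point x z'))| ≤ b j * |z - z'| := by
    intro x z z' j
    rw [inner_frame_field, inner_frame_field, add_sub_add_left_eq_sub, ← sub_mul, abs_mul, mul_comm]
    refine mul_le_mul_of_nonneg_right ?_ (abs_nonneg _)
    simp only [b]
    have e0 := abs_nonneg (inner ℝ (C.frame j) (v + A C.center))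
    have e1 := abs_nonneg (inner ℝ (C.frame j) (A (C.frame 0)))
    have e2 := abs_nonneg (inner ℝ (C.frame j) (A (C.frame 1)))
    have e3 := abs_nonneg (inner ℝ (C.frame j) (A (C.frame 2)))
    linarith
  have hb : ∀ j, 0 ≤ b j := fun j => by positivity
  refine ⟨b 0 + b 1 + b 2, by linarith [hb 0, hb 1, hb 2], fun R hR x z hx hz => ?_,
    fun x z z' => ?_⟩
  · have := h1 R hR x z hx hz
    linarith [this 0, this 1, this 2]
  · have := h2 x z z'
    linarith [this 0, this 1, this 2]

end Catenoid

end

/-! ### Comparison of an asymptotic end with its catenoid. -/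

section

open MeasureTheory Filter

/-- The energy of the difference of two minimal graphs in an annulus, in terms of a bound for this
difference. -/
theorem integral_annularCutoff_gradientDefect_le {u h : Plane → ℝ} {R r δ L : ℝ} (hR : 0 < R)
    (hrR : r < R / 2)
    (hu : ContDiffOn ℝ ∞ u (exterior r)) (hh : ContDiffOn ℝ ∞ h (exterior r))
    (hu' : IsWeakMinimalGraph u r) (hh' : IsWeakMinimalGraph h r)
    (hL : ∀ x i, |scalarPartial (annularCutoff R) i x| ≤ L / R)
    (hw : ∀ x, R / 2 ≤ ‖x‖ → |u x - h x| ≤ 2 * δ / R) :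
    Integrable (fun x => annularCutoff R x ^ 2 * gradientDefect (scalarPartial u 0 x)
      (scalarPartial u 1 x) (scalarPartial h 0 x) (scalarPartial h 1 x)) ∧
    ∫ x, annularCutoff R x ^ 2 * gradientDefect (scalarPartial u 0 x) (scalarPartial u 1 x)
      (scalarPartial h 0 x) (scalarPartial h 1 x)
    ≤ 512 * (δ ^ 2 / R ^ 2) * (L ^ 2 * volume.real (Metric.closedBall (0 : Plane) 1)) := by
  have hts := tsupport_annularCutoff_subset hR
  have hann : annulus (R / 2) (4 * R) ⊆ exterior r := annulus_subset_exterior hrR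
  have hcs : HasCompactSupport (annularCutoff R) :=
    (isCompact_annulus _ _).of_isClosed_subset (isClosed_tsupport _) hts
  obtain ⟨hi, hle⟩ := integral_gradientDefect_le hu hh hu' hh' (contDiff_annularCutoff R) hcs
    (hts.trans hann)
  refine ⟨hi, hle.trans ?_⟩
  have hm : MeasurableSet (annulus (R / 2) (4 * R)) := (isCompact_annulus _ _).measurableSet
  have hbound : ∀ x, (u x - h x) ^ 2 * (scalarPartial (annularCutoff R) 0 x ^ 2
      + scalarPartial (annularCutoff R) 1 x ^ 2)
      ≤ (annulus (R / 2) (4 * R)).indicator (fun _ => 8 * (δ ^ 2 / R ^ 2) * (L ^ 2 / R ^ 2)) x := by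
    intro x
    by_cases hx : x ∈ annulus (R / 2) (4 * R)
    · rw [Set.indicator_of_mem hx]
      have h1 : (u x - h x) ^ 2 ≤ (2 * δ / R) ^ 2 := sq_le_sq' (abs_le.1 (hw x hx.1)).1
        (abs_le.1 (hw x hx.1)).2
      have h2 : ∀ i, scalarPartial (annularCutoff R) i x ^ 2 ≤ (L / R) ^ 2 := fun i =>
        sq_le_sq' (abs_le.1 (hL x i)).1 (abs_le.1 (hL x i)).2
      calc _ ≤ (2 * δ / R) ^ 2 * ((L / R) ^ 2 + (L / R) ^ 2) := by
            exact mul_le_mul h1 (add_le_add (h2 0) (h2 1)) (by positivity) (by positivity)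
        _ = _ := by ring
    · rw [Set.indicator_of_notMem hx]
      have h0 : ∀ i, scalarPartial (annularCutoff R) i x = 0 := fun i => by
        unfold scalarPartial
        rw [fderiv_of_notMem_tsupport ℝ fun h => hx (hts h)]; rfl
      rw [h0, h0]
      simp
  have hint : ∫ x, (u x - h x) ^ 2 * (scalarPartial (annularCutoff R) 0 x ^ 2
      + scalarPartial (annularCutoff R) 1 x ^ 2)
      ≤ 8 * (δ ^ 2 / R ^ 2) * (L ^ 2 / R ^ 2) * volume.real (annulus (R / 2) (4 * R)) := by
    refine (integral_mono_of_nonneg (Eventually.of_forall fun x => by positivity)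
      ((integrable_indicator_iff hm).2 (integrableOn_const (isCompact_annulus _ _).measure_lt_top.ne))
      (Eventually.of_forall hbound)).trans_eq ?_
    rw [integral_indicator hm, setIntegral_const, smul_eq_mul, mul_comm]
  calc _ ≤ 4 * (8 * (δ ^ 2 / R ^ 2) * (L ^ 2 / R ^ 2) * ((4 * R) ^ 2
        * volume.real (Metric.closedBall (0 : Plane) 1))) := by
        refine mul_le_mul_of_nonneg_left (hint.trans ?_) (by norm_num)
        exact mul_le_mul_of_nonneg_left (volume_annulus_le (by positivity)) (by positivity)
    _ = _ := by field_simp; ring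

namespace Catenoid

variable (C : Catenoid)

/-- The gradient of the cutoff is of order `1 / R`, the field of order `R` and the area of the
annulus of order `R ^ 2`. Replacing the gradient of `u` thus costs `∫ (√T + T)`, where Caccioppoli
bounds `∫ T` by a multiple of `δ ^ 2 / R ^ 2`. Replacing `u` inside the field costs `δ / R` times `1
/ R` per unit area. Both are of order `δ` exactly because the height difference is of order `δ / R`.
-/
theorem abs_integral_graphFlux_sub_le {A : Space →L[ℝ] Space} (v : Space) {u : Plane → ℝ} {r : ℝ}
    (hr : 2 * C.waist ≤ r) (hu : ContDiffOn ℝ ∞ u (exterior r)) (hu' : IsWeakMinimalGraph u r) :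
    ∃ K : ℝ, 0 ≤ K ∧ ∀ δ R, 0 < δ → δ ≤ 1 → 1 ≤ R → r < R / 2 →
      (∀ x, R / 2 ≤ ‖x‖ → |u x - C.height x| ≤ 2 * δ / R) →
      (∀ x, R ≤ ‖x‖ → |u x - C.height x| ≤ 1) →
      |(∫ x, C.graphFlux (fun y => v + A y) u (radialCutoff R) x)
        - ∫ x, C.graphFlux (fun y => v + A y) C.height (radialCutoff R) x| ≤ K * δ := by
  obtain ⟨L, hL0, hL⟩ := exists_abs_scalarPartial_radialCutoff_le
  obtain ⟨L', hL'0, hL'⟩ := exists_abs_scalarPartial_annularCutoff_le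
  obtain ⟨B, hB0, hB1, hB2⟩ := C.exists_field_bound v A
  set V := volume.real (Metric.closedBall (0 : Plane) 1) with hV
  have hV0 : 0 ≤ V := measureReal_nonneg
  have hc := C.waist_pos
  have hh : ContDiffOn ℝ ∞ C.height (exterior r) :=
    C.contDiffOn_height.mono fun x hx => lt_of_le_of_lt (by linarith) (show r < ‖x‖ from hx)
  have hh' : IsWeakMinimalGraph C.height r := fun ψ h1 h2 h3 =>
    C.isWeakMinimalGraph_height ψ h1 h2
      (h3.trans fun x hx => lt_of_le_of_lt (by linarith) (show r < ‖x‖ from hx))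
  refine ⟨128 * L * B * 512 * (L' ^ 2 * V) + (64 * L * B + 8 * L * B) * 4 * V, by positivity, ?_⟩
  intro δ R hδ hδ1 hR1 hrR hw hw1
  have hR : 0 < R := by linarith
  obtain ⟨iT, eT⟩ := integral_annularCutoff_gradientDefect_le hR hrR hu hh hu' hh' (hL' R hR) hw
  have iu := C.integrable_graphFlux (k := fun y => v + A y) (by fun_prop) hu hR (by linarith)
  have ih := C.integrable_graphFlux (k := fun y => v + A y) (by fun_prop) hh hR (by linarith)
  rw [← integral_sub iu ih]
  set T : Plane → ℝ := fun x => gradientDefect (scalarPartial u 0 x) (scalarPartial u 1 x)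
      (scalarPartial C.height 0 x) (scalarPartial C.height 1 x) with hT
  have hm : MeasurableSet (annulus R (2 * R)) := (isCompact_annulus _ _).measurableSet
  have hpt : ∀ x, ‖C.graphFlux (fun y => v + A y) u (radialCutoff R) x
      - C.graphFlux (fun y => v + A y) C.height (radialCutoff R) x‖
      ≤ 128 * L * B * (R ^ 2 / δ) * (annularCutoff R x ^ 2 * T x)
        + (annulus R (2 * R)).indicator (fun _ => (64 * L * B + 8 * L * B) * (δ / R ^ 2)) x := by
    intro x
    have hTx : 0 ≤ T x := gradientDefect_nonneg _ _ _ _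
    by_cases hx : x ∈ annulus R (2 * R)
    · rw [Set.indicator_of_mem hx, annularCutoff_eq_one hR hx, one_pow, one_mul, Real.norm_eq_abs]
      have hxR : R ≤ ‖x‖ := hx.1
      have hq := C.graphArea_height_le (x := x) (by linarith)
      have hhx := C.height_nonneg_le (x := x) (by linarith)
      have hl0 := hL R hR x 0
      have hl1 := hL R hR x 1
      have hz : |u x| ≤ 3 * R := by
        have h1 := hw1 x hxR
        have h2 : ‖x‖ ≤ 2 * R := hx.2
        rw [abs_le] at h1 ⊢
        constructor <;> linarith
      have hk := hB1 R hR1 x (u x) hx.2 hz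
      have hk' := hB2 x (u x) (C.height x)
      have hwx := hw x (by linarith)
      have e1 := abs_graphForm_sub_le (p₀ := scalarPartial u 0 x) (p₁ := scalarPartial u 1 x)
        (scalarPartial (radialCutoff R) 0 x) (scalarPartial (radialCutoff R) 1 x)
        (inner ℝ (C.frame 0) (v + A (C.point x (u x))))
        (inner ℝ (C.frame 1) (v + A (C.point x (u x))))
        (inner ℝ (C.frame 2) (v + A (C.point x (u x)))) hq
      have e2 := abs_graphForm_le
        (scalarPartial (radialCutoff R) 0 x) (scalarPartial (radialCutoff R) 1 x)
        (inner ℝ (C.frame 0) (v + A (C.point x (u x)))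
          - inner ℝ (C.frame 0) (v + A (C.point x (C.height x))))
        (inner ℝ (C.frame 1) (v + A (C.point x (u x)))
          - inner ℝ (C.frame 1) (v + A (C.point x (C.height x))))
        (inner ℝ (C.frame 2) (v + A (C.point x (u x)))
          - inner ℝ (C.frame 2) (v + A (C.point x (C.height x)))) hq
      rw [← graphForm_sub_field] at e2
      have hsum : |scalarPartial (radialCutoff R) 0 x| + |scalarPartial (radialCutoff R) 1 x|
          ≤ 2 * L / R := by
        have : 2 * L / R = L / R + L / R := by ring
        linarith
      have hRδ : 1 ≤ R ^ 2 / δ := by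
        rw [one_le_div hδ]; nlinarith
      -- The weight `R ^ 2 / δ` balances the two terms: after integration over the annulus each is
      -- of order `δ`.
      have hsq : √(T x) ≤ R ^ 2 / δ * T x + δ / R ^ 2 := by
        have h1 := Real.sq_sqrt hTx
        have h2 := Real.sqrt_nonneg (T x)
        have h3 : 0 < R ^ 2 / δ := by positivity
        have h4 : δ / R ^ 2 = (R ^ 2 / δ)⁻¹ := by rw [inv_div]
        rw [h4, ← sub_nonneg]
        set y := √(T x)
        set a := R ^ 2 / δ
        have : a * T x + a⁻¹ - y = a⁻¹ * ((a * y - 1 / 2) ^ 2 + 3 / 4) := by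
          rw [← h1]; field_simp; ring
        rw [this]
        positivity
      have hTle : T x ≤ R ^ 2 / δ * T x := le_mul_of_one_le_left hTx hRδ
      have f1 : 32 * (√(T x) + T x)
          * (|scalarPartial (radialCutoff R) 0 x| + |scalarPartial (radialCutoff R) 1 x|)
          * (|inner ℝ (C.frame 0) (v + A (C.point x (u x)))|
            + |inner ℝ (C.frame 1) (v + A (C.point x (u x)))|
            + |inner ℝ (C.frame 2) (v + A (C.point x (u x)))|)
          ≤ 32 * (R ^ 2 / δ * T x + δ / R ^ 2 + R ^ 2 / δ * T x) * (2 * L / R) * (B * R) := by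
        gcongr
      have f2 : 2 * (|scalarPartial (radialCutoff R) 0 x| + |scalarPartial (radialCutoff R) 1 x|)
          * (|inner ℝ (C.frame 0) (v + A (C.point x (u x)))
              - inner ℝ (C.frame 0) (v + A (C.point x (C.height x)))|
            + |inner ℝ (C.frame 1) (v + A (C.point x (u x)))
              - inner ℝ (C.frame 1) (v + A (C.point x (C.height x)))|
            + |inner ℝ (C.frame 2) (v + A (C.point x (u x)))
              - inner ℝ (C.frame 2) (v + A (C.point x (C.height x)))|)
          ≤ 2 * (2 * L / R) * (B * (2 * δ / R)) := by
        gcongr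
        exact hk'.trans (by gcongr)
      refine (abs_sub_le _ (graphForm (scalarPartial C.height 0 x) (scalarPartial C.height 1 x)
        (scalarPartial (radialCutoff R) 0 x) (scalarPartial (radialCutoff R) 1 x)
        (inner ℝ (C.frame 0) (v + A (C.point x (u x))))
        (inner ℝ (C.frame 1) (v + A (C.point x (u x))))
        (inner ℝ (C.frame 2) (v + A (C.point x (u x))))) _).trans ?_
      refine (add_le_add (e1.trans f1) (e2.trans f2)).trans_eq ?_
      field_simp
      ring
    · rw [Set.indicator_of_notMem hx, C.graphFlux_eq_zero hR hx, C.graphFlux_eq_zero hR hx,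
        sub_zero, norm_zero, add_zero]
      positivity
  have i2 : Integrable ((annulus R (2 * R)).indicator
      (fun _ => (64 * L * B + 8 * L * B) * (δ / R ^ 2))) :=
    (integrable_indicator_iff hm).2 (integrableOn_const (isCompact_annulus _ _).measure_lt_top.ne)
  rw [← Real.norm_eq_abs]
  refine (norm_integral_le_of_norm_le ((iT.const_mul _).add i2) (Eventually.of_forall hpt)).trans ?_
  simp only [Pi.add_apply]
  rw [integral_add (iT.const_mul _) i2, integral_const_mul, integral_indicator hm,
    setIntegral_const, smul_eq_mul]
  have hvol := volume_annulus_le (a := R) (b := 2 * R) (by positivity)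
  calc _ ≤ 128 * L * B * (R ^ 2 / δ) * (512 * (δ ^ 2 / R ^ 2) * (L' ^ 2 * V))
        + (2 * R) ^ 2 * V * ((64 * L * B + 8 * L * B) * (δ / R ^ 2)) := by gcongr
    _ = _ := by field_simp; ring

/-- The flux of a Killing field through an end that is asymptotic to a catenoid. -/
theorem tendsto_integral_graphFlux {A : Space →L[ℝ] Space} (hA : ∀ x, inner ℝ x (A x) = 0)
    (v : Space) {u : Plane → ℝ} {r : ℝ}
    (hr : 2 * C.waist ≤ r) (hu : ContDiffOn ℝ ∞ u (exterior r)) (hu' : IsWeakMinimalGraph u r)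
    (has : (fun x => u x - C.height x) =o[Bornology.cobounded Plane] fun x => ‖x‖⁻¹) :
    Tendsto (fun R => ∫ x, C.graphFlux (fun y => v + A y) u (radialCutoff R) x) atTop
      (𝓝 (C.waist * inner ℝ (C.frame 2) (v + A C.center) * ∫ x, radialSlope 1 x)) := by
  obtain ⟨K, hK0, hK⟩ := C.abs_integral_graphFlux_sub_le (A := A) v hr hu hu'
  have hc := C.waist_pos
  rw [Metric.tendsto_atTop]
  intro ε hε
  -- With this choice the error `K * δ` is at most `ε / 2`; `K + 1` keeps the denominator positive.
  let δ : ℝ := min 1 (ε / (K + 1) / 2)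
  have hδ : 0 < δ := by positivity
  have hev := has.def hδ
  rw [← comap_norm_atTop, eventually_comap] at hev
  obtain ⟨N, hN⟩ := eventually_atTop.1 hev
  have hw : ∀ x : Plane, max N 1 ≤ ‖x‖ → |u x - C.height x| ≤ δ / ‖x‖ := fun x hx => by
    have := hN ‖x‖ ((le_max_left _ _).trans hx) x rfl
    rwa [Real.norm_eq_abs, norm_inv, norm_norm, ← div_eq_mul_inv] at this
  refine ⟨2 * (max N 1 + r + 1), fun R hR => ?_⟩
  have hN1 : 1 ≤ max N 1 := le_max_right _ _
  have hR1 : 1 ≤ R := by linarith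
  have hR0 : 0 < R := by linarith
  have h1 := hK δ R hδ (min_le_left _ _) hR1 (by linarith) (fun x hx => by
    refine (hw x (by linarith)).trans ?_
    rw [show 2 * δ / R = δ / (R / 2) by field_simp]
    gcongr) (fun x hx => by
    refine (hw x (by linarith)).trans ?_
    rw [div_le_one (by linarith)]
    have : δ ≤ 1 := min_le_left _ _
    linarith)
  rw [C.integral_graphFlux_height hA v (by linarith)] at h1
  rw [Real.dist_eq]
  refine h1.trans_lt ?_
  have h2 : δ ≤ ε / (K + 1) / 2 := min_le_right _ _
  calc K * δ ≤ (K + 1) * (ε / (K + 1) / 2) := by gcongr; linarith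
    _ = ε / 2 := by field_simp
    _ < ε := by linarith

end Catenoid

end

/-! ### Ends that are graphs. -/

section

open MeasureTheory Filter

/-- The chart `e` presents a part of the surface `X` as the graph of `u` outside the disk of
radius `r` in the frame of `C`. -/
structure IsGraphEnd {M : Type*} [TopologicalSpace M] [ChartedSpace Plane M] (X : M → Space)
    (C : Catenoid) (e : OpenPartialHomeomorph M Plane) (u : Plane → ℝ) (r : ℝ) : Prop where
  pos : 0 < r
  mem_maximalAtlas : e ∈ IsManifold.maximalAtlas 𝓘(ℝ, Plane) ∞ M
  subset_target : {x | r ≤ ‖x‖} ⊆ e.target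
  apply_symm : ∀ x, r < ‖x‖ → X (e.symm x) = C.point x (u x)

theorem Catenoid.inner_frame_two_point (C : Catenoid) (x : Plane) (z : ℝ) :
    inner ℝ (C.frame 2) (C.point x z - C.center) = z := by
  have h : ∀ i j, inner ℝ (C.frame i) (C.frame j) = if i = j then (1 : ℝ) else 0 :=
    orthonormal_iff_ite.1 C.frame.orthonormal
  unfold Catenoid.point
  simp only [add_sub_cancel_left, inner_add_right, real_inner_smul_right, h]
  simp only [Fin.reduceEq, if_true, if_false]
  ring

theorem Catenoid.norm_le_norm_point_sub (C : Catenoid) (x : Plane) (z : ℝ) :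
    ‖x‖ ≤ ‖C.point x z - C.center‖ := by
  have h : ∀ i j, inner ℝ (C.frame i) (C.frame j) = if i = j then (1 : ℝ) else 0 :=
    orthonormal_iff_ite.1 C.frame.orthonormal
  refine le_of_sq_le_sq ?_ (norm_nonneg _)
  rw [← real_inner_self_eq_norm_sq (C.point x z - C.center), Catenoid.norm_sq_plane]
  unfold Catenoid.point
  simp only [add_sub_cancel_left, inner_add_right, inner_add_left, real_inner_smul_right,
    real_inner_smul_left, h]
  simp only [Fin.reduceEq, if_true, if_false]
  nlinarith [sq_nonneg z]

theorem Catenoid.partialDeriv_graph (C : Catenoid) {u : Plane → ℝ} {x : Plane}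
    (hu : DifferentiableAt ℝ u x) :
    partialDeriv (fun x => C.point x (u x)) 0 x = C.frame 0 + scalarPartial u 0 x • C.frame 2 ∧
    partialDeriv (fun x => C.point x (u x)) 1 x = C.frame 1 + scalarPartial u 1 x • C.frame 2 := by
  have hp : ∀ i : Fin 2, HasFDerivAt (fun x : Plane => x i) (EuclideanSpace.proj i : Plane →L[ℝ] ℝ) x :=
    fun i => (EuclideanSpace.proj i : Plane →L[ℝ] ℝ).hasFDerivAt
  have h := ((((hp 0).smul_const (C.frame 0)).add ((hp 1).smul_const (C.frame 1))).add
    (hu.hasFDerivAt.smul_const (C.frame 2))).const_add C.center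
  have h' : HasFDerivAt (fun x => C.point x (u x)) _ x := h
  unfold partialDeriv scalarPartial
  rw [h'.fderiv]
  constructor <;> simp

theorem symm_mem_image_iff {M : Type*} [TopologicalSpace M]
    {e : OpenPartialHomeomorph M Plane} {S : Set Plane} (hS : S ⊆ e.target) {y : Plane} (hy : y ∈ e.target) :
    e.symm y ∈ e.symm '' S ↔ y ∈ S :=
  ⟨fun ⟨_, hx, hxy⟩ => e.symm.injOn (hS hx) hy hxy ▸ hx, fun hy => ⟨y, hy, rfl⟩⟩

namespace IsGraphEnd

variable {M : Type*} [TopologicalSpace M] [ChartedSpace Plane M] {X : M → Space} {C : Catenoid}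
  {e : OpenPartialHomeomorph M Plane} {u : Plane → ℝ} {r : ℝ}

theorem mono (h : IsGraphEnd X C e u r) {R : ℝ} (hR : r ≤ R) : IsGraphEnd X C e u R where
  pos := h.pos.trans_le hR
  mem_maximalAtlas := h.mem_maximalAtlas
  subset_target := fun _ hx => h.subset_target (hR.trans hx)
  apply_symm := fun x hx => h.apply_symm x (hR.trans_lt hx)

theorem exterior_subset (h : IsGraphEnd X C e u r) : exterior r ⊆ e.target :=
  fun x hx => h.subset_target (show r ≤ ‖x‖ from le_of_lt hx)

theorem norm_le (h : IsGraphEnd X C e u r) (x : Plane) (hx : r < ‖x‖) :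
    ‖x‖ ≤ ‖X (e.symm x) - C.center‖ := by
  rw [h.apply_symm x hx]
  exact C.norm_le_norm_point_sub x (u x)

/-- The function `u` is the coordinate of the smooth map `X ∘ e.symm` along the axis. -/
theorem contDiffOn (h : IsGraphEnd X C e u r) (hX : ContMDiff 𝓘(ℝ, Plane) 𝓘(ℝ, Space) ∞ X) :
    ContDiffOn ℝ ∞ u (exterior r) := by
  have h1 := (contDiffOn_comp_symm hX h.mem_maximalAtlas).mono h.exterior_subset
  refine (contDiffOn_const.inner ℝ (h1.sub contDiffOn_const) :
    ContDiffOn ℝ ∞ (fun x => inner ℝ (C.frame 2) ((X ∘ e.symm) x - C.center)) _).congr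
    fun x hx => ?_
  rw [Function.comp_apply, h.apply_symm x hx, C.inner_frame_two_point]

theorem isOpen_image (h : IsGraphEnd X C e u r) : IsOpen (e.symm '' exterior r) :=
  e.symm.isOpen_image_of_subset_source (isOpen_exterior r) h.exterior_subset

theorem image_subset_source (h : IsGraphEnd X C e u r) : e.symm '' exterior r ⊆ e.source := by
  rintro _ ⟨x, hx, rfl⟩
  exact e.map_target (h.exterior_subset hx)

theorem chartFlux_eq (h : IsGraphEnd X C e u r) (hX : ContMDiff 𝓘(ℝ, Plane) 𝓘(ℝ, Space) ∞ X)
    {k : Space → Space} {φ : M → ℝ} {ψ : Plane → ℝ} (hφ : ∀ x ∈ exterior r, φ (e.symm x) = ψ x)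
    (h0 : ∀ x ∉ exterior r, C.graphFlux k u ψ x = 0) :
    chartFlux X k ((e.symm '' exterior r).indicator fun _ => 1) φ e
      = ∫ x, C.graphFlux k u ψ x := by
  unfold chartFlux
  rw [setIntegral_eq_of_subset_of_forall_sdiff_eq_zero e.open_target.measurableSet
    h.exterior_subset fun y hy => ?_, ← setIntegral_eq_integral_of_forall_compl_eq_zero h0]
  · refine setIntegral_congr_fun (isOpen_exterior r).measurableSet fun y hy => ?_
    have hy' := (isOpen_exterior r).mem_nhds hy
    rw [Set.indicator_of_mem (Set.mem_image_of_mem e.symm hy), one_mul]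
    unfold chartDensity
    rw [fluxDensity_congr (Y' := fun x => C.point x (u x)) (f' := ψ)
      (k' := fun x => k (C.point x (u x)))]
    · obtain ⟨e1, e2⟩ := C.partialDeriv_graph
        (((h.contDiffOn hX).contDiffAt hy').differentiableAt (by simp))
      unfold fluxDensity Catenoid.graphFlux
      rw [e1, e2, fluxForm_graph]
    · filter_upwards [hy'] with x hx using h.apply_symm x hx
    · filter_upwards [hy'] with x hx using hφ x hx
    · rw [h.apply_symm y hy]
  · rw [Set.indicator_of_notMem, zero_mul]
    rw [symm_mem_image_iff h.exterior_subset hy.1]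
    exact hy.2

end IsGraphEnd

section Manifold

variable {M : Type*} [TopologicalSpace M] [ChartedSpace Plane M]

/-- Extension by zero of a function given in a chart. -/
theorem contMDiff_indicator_comp {e : OpenPartialHomeomorph M Plane}
    (he : e ∈ IsManifold.maximalAtlas 𝓘(ℝ, Plane) ∞ M) {ψ : Plane → ℝ} (hψ : ContDiff ℝ ∞ ψ)
    {S : Set Plane} (hS : S ⊆ e.target) (hcl : IsClosed (e.symm '' S)) (h0 : ∀ x ∉ S, ψ x = 0) :
    ContMDiff 𝓘(ℝ, Plane) 𝓘(ℝ, ℝ) ∞ (e.source.indicator (ψ ∘ e)) := by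
  intro m
  by_cases hm : m ∈ e.source
  · have h1 : ContMDiffAt 𝓘(ℝ, Plane) 𝓘(ℝ, ℝ) ∞ (ψ ∘ e) m :=
      hψ.contMDiff.contMDiffAt.comp m (contMDiffAt_of_mem_maximalAtlas he hm)
    refine h1.congr_of_eventuallyEq ?_
    filter_upwards [e.open_source.mem_nhds hm] with y hy
    exact Set.indicator_of_mem hy _
  · refine (contMDiffAt_const (c := (0 : ℝ))).congr_of_eventuallyEq ?_
    have hmS : m ∉ e.symm '' S := by
      rintro ⟨x, hx, rfl⟩
      exact hm (e.map_target (hS hx))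
    filter_upwards [hcl.isOpen_compl.mem_nhds hmS] with y hy
    by_cases hye : y ∈ e.source
    · rw [Set.indicator_of_mem hye]
      exact h0 _ fun h => hy ⟨_, h, e.left_inv hye⟩
    · exact Set.indicator_of_notMem hye _

variable {X : M → Space} {C : Catenoid} {e : OpenPartialHomeomorph M Plane} {u : Plane → ℝ} {r : ℝ}

/-- The weak equation is flux balancing for the translation along the axis, tested with a function
supported in the end. Passing through the global balance is needed since `e` lies only in the
maximal atlas, while zero mean curvature is given in the charts of the atlas. -/
theorem IsGraphEnd.isWeakMinimalGraph [T2Space M] [SecondCountableTopology M]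
    [IsManifold 𝓘(ℝ, Plane) ∞ M] (h : IsGraphEnd X C e u r)
    (hX : IsMinimalImmersion X) : IsWeakMinimalGraph u r := by
  intro ψ hψ hψc hψs
  have hS : tsupport ψ ⊆ e.target := hψs.trans h.exterior_subset
  have hSc : IsCompact (e.symm '' tsupport ψ) :=
    hψc.isCompact.image_of_continuousOn (e.continuousOn_symm.mono hS)
  have hz : ∀ x ∉ tsupport ψ, ψ x = 0 := fun x hx => image_eq_zero_of_notMem_tsupport hx
  have hφ := contMDiff_indicator_comp h.mem_maximalAtlas hψ hS hSc.isClosed hz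
  have hφ0 : ∀ m ∉ e.symm '' tsupport ψ, e.source.indicator (ψ ∘ e) m = 0 := fun m hm => by
    by_cases hme : m ∈ e.source
    · rw [Set.indicator_of_mem hme]
      exact hz _ fun h => hm ⟨_, h, e.left_inv hme⟩
    · exact Set.indicator_of_notMem hme _
  have key := hX.sum_chartFlux_eq_zero (A := 0) (by simp) (C.frame 2) hφ
    (HasCompactSupport.intro hSc hφ0) (ι := Unit) (e := fun _ => e)
    (fun _ => h.mem_maximalAtlas) (V := fun _ => e.symm '' exterior r) (fun _ => h.isOpen_image)
    (fun _ => h.image_subset_source) (fun i j hij => absurd rfl hij) (fun m hm => by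
      have hm' : m ∉ e.symm '' tsupport ψ := fun h' => hm () (Set.image_mono hψs h')
      filter_upwards [hSc.isClosed.isOpen_compl.mem_nhds hm'] with y hy
      rw [hφ0 y hy, hφ0 m hm'])
  rw [Fintype.sum_unique, h.chartFlux_eq hX.contMDiff (ψ := ψ) (fun x hx => by
    have hx' := h.exterior_subset hx
    rw [Set.indicator_of_mem (e.map_target hx'), Function.comp_apply, e.right_inv hx'])
    (fun x hx => by
      have h0 : ∀ i, scalarPartial ψ i x = 0 := fun i => by
        unfold scalarPartial
        rw [fderiv_of_notMem_tsupport ℝ fun h => hx (hψs h)]; rfl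
      unfold Catenoid.graphFlux graphForm
      rw [h0, h0]
      ring)] at key
  have ho : ∀ i j, inner ℝ (C.frame i) (C.frame j) = if i = j then (1 : ℝ) else 0 :=
    orthonormal_iff_ite.1 C.frame.orthonormal
  refine (integral_congr_ae (Eventually.of_forall fun x => ?_)).trans key
  simp [Catenoid.graphFlux, ho]

end Manifold

end

/-! ### Balancing of forces and torques of the ends. -/

section

open MeasureTheory Filter

/-- Balancing of forces and torques: the fluxes of a Killing field of Euclidean space through the
ends of a minimal surface add up to zero. -/
theorem sum_waist_mul_inner_eq_zero {M : Type*} [TopologicalSpace M] [T2Space M]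
    [SecondCountableTopology M] [ConnectedSpace M] [ChartedSpace Plane M]
    [IsManifold 𝓘(ℝ, Plane) ∞ M] {X : M → Space} (hX : IsMinimalImmersion X)
    [Fintype (TopologicalEnd M)] {C : TopologicalEnd M → Catenoid}
    (hC : ∀ ε, IsAsymptoticTo X ε (C ε)) {A : Space →L[ℝ] Space} (hA : ∀ x, inner ℝ x (A x) = 0)
    (v : Space) :
    ∑ ε, (C ε).waist * inner ℝ ((C ε).frame 2) (v + A (C ε).center) = 0 := by
  have : LocallyCompactSpace M := ChartedSpace.locallyCompactSpace Plane M
  have : LocallyConnectedSpace M := ChartedSpace.locallyConnectedSpace Plane M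
  choose r e K u hr he hsub hcomp hXe has using hC
  have hXc : Continuous X := hX.contMDiff.continuous
  have hend : ∀ ε, IsGraphEnd X (C ε) (e ε) (u ε) (r ε) := fun ε =>
    ⟨hr ε, he ε, hsub ε, hXe ε⟩
  -- the far parts of different ends are disjoint
  have hdisj : ∀ᶠ R in atTop, ∀ ε ε', ε ≠ ε' →
      Disjoint ((e ε).symm '' exterior R) ((e ε').symm '' exterior R) := by
    rw [eventually_all]
    intro ε
    rw [eventually_all]
    intro ε'
    by_cases hne : ε = ε'
    · exact Eventually.of_forall fun R h => absurd hne h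
    obtain ⟨L, hL⟩ := TopologicalEnd.exists_disjoint_component hne
    obtain ⟨R₁, hR₁⟩ := ε.exists_image_exterior_subset_component hXc (hr ε) (hsub ε)
      (hend ε).norm_le (hcomp ε) L
    obtain ⟨R₂, hR₂⟩ := ε'.exists_image_exterior_subset_component hXc (hr ε') (hsub ε')
      (hend ε').norm_le (hcomp ε') L
    filter_upwards [eventually_ge_atTop R₁, eventually_ge_atTop R₂] with R h1 h2 _
    exact hL.mono (hR₁ R h1) (hR₂ R h2)
  have hlarge : ∀ᶠ R in atTop, ∀ ε, r ε < R ∧ 2 * (C ε).waist ≤ R := by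
    rw [eventually_all]
    intro ε
    exact (eventually_gt_atTop _).and (eventually_ge_atTop _)
  obtain ⟨R₀, hd₀, hl₀⟩ := (hdisj.and hlarge).exists
  have hend₀ : ∀ ε, IsGraphEnd X (C ε) (e ε) (u ε) R₀ := fun ε => (hend ε).mono (hl₀ ε).1.le
  have hu : ∀ ε, ContDiffOn ℝ ∞ (u ε) (exterior R₀) := fun ε => (hend₀ ε).contDiffOn hX.contMDiff
  set k : Space → Space := fun y => v + A y with hk
  have hzero : ∀ R, R₀ < R → 0 < R →
      ∑ ε, ∫ x, (C ε).graphFlux k (u ε) (radialCutoff R) x = 0 := by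
    intro R hR hR0
    let g : TopologicalEnd M → M → ℝ := fun ε =>
      (e ε).source.indicator (radialCutoff R ∘ e ε)
    let S : Set Plane := {x | R ≤ ‖x‖}
    have hSe : S ⊆ exterior R₀ := fun x hx => hR.trans_le hx
    have hSt : ∀ ε, S ⊆ (e ε).target := fun ε => hSe.trans (hend₀ ε).exterior_subset
    have hScl : ∀ ε, IsClosed ((e ε).symm '' S) := fun ε =>
      isClosed_image_exterior hXc (hend₀ ε).subset_target (hend₀ ε).norm_le hR
    have hψ0 : ∀ x ∉ S, radialCutoff R x = 0 := fun x hx =>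
      radialCutoff_eq_zero hR0 (le_of_lt (not_le.1 hx))
    have hg : ∀ ε, ContMDiff 𝓘(ℝ, Plane) 𝓘(ℝ, ℝ) ∞ (g ε) := fun ε =>
      contMDiff_indicator_comp (he ε) (contDiff_radialCutoff R) (hSt ε) (hScl ε) hψ0
    have hg0 : ∀ ε, ∀ m ∉ (e ε).symm '' S, g ε m = 0 := fun ε m hm => by
      by_cases hme : m ∈ (e ε).source
      · refine (Set.indicator_of_mem hme _).trans ?_
        exact hψ0 _ fun h => hm ⟨_, h, (e ε).left_inv hme⟩
      · exact Set.indicator_of_notMem hme _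
    have hge : ∀ ε, ∀ x ∈ exterior R₀, g ε ((e ε).symm x) = radialCutoff R x := fun ε x hx => by
      have hx' := (hend₀ ε).exterior_subset hx
      refine (Set.indicator_of_mem ((e ε).map_target hx') _).trans ?_
      rw [Function.comp_apply, (e ε).right_inv hx']
    have hsum : ∀ ε, ∀ m ∈ (e ε).symm '' exterior R₀, ∑ ε', g ε' m = g ε m := fun ε m hm => by
      refine Finset.sum_eq_single ε (fun ε' _ hne => hg0 ε' m fun h => ?_)
        fun h => absurd (Finset.mem_univ ε) h
      exact Set.disjoint_left.1 (hd₀ ε' ε hne) (Set.image_mono hSe h) hm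
    -- This function is `1` on the core and drops to `0` along each end; its differential lives on
    -- the annuli of radii `R` and `2 * R`.
    let φ : M → ℝ := fun m => 1 - ∑ ε, g ε m
    have hφ : ContMDiff 𝓘(ℝ, Plane) 𝓘(ℝ, ℝ) ∞ φ :=
      contMDiff_const.sub (contMDiff_finsetSum fun ε _ => hg ε)
    have hann : ∀ ε, IsCompact ((e ε).symm '' annulus (r ε) (2 * R)) := fun ε =>
      (isCompact_annulus _ _).image_of_continuousOn
        ((e ε).continuousOn_symm.mono fun x hx => hsub ε hx.1)
    have hφc : HasCompactSupport φ := by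
      -- The support lies in the complement of the given neighbourhoods of the ends, together with
      -- the compact parts of these neighbourhoods up to radius `2 * R`.
      refine HasCompactSupport.intro
        ((isCompact_compl_iUnion_component K).union (isCompact_iUnion hann)) fun m hm => ?_
      rw [Set.mem_union, not_or, Set.notMem_compl_iff, Set.mem_iUnion, Set.mem_iUnion,
        not_exists] at hm
      obtain ⟨⟨ε, hε⟩, hm⟩ := hm
      rw [hcomp ε] at hε
      obtain ⟨x, hx, rfl⟩ := hε
      have hxR : 2 * R < ‖x‖ := by
        by_contra! h
        exact hm ε ⟨x, ⟨le_of_lt hx, h⟩, rfl⟩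
      have hx₀ : x ∈ exterior R₀ := show R₀ < ‖x‖ by linarith
      simp only [φ]
      rw [hsum ε _ ⟨x, hx₀, rfl⟩, hge ε x hx₀, radialCutoff_eq_one hR0 hxR.le, sub_self]
    have key := hX.sum_chartFlux_eq_zero hA v hφ hφc (e := e) he
      (V := fun ε => (e ε).symm '' exterior R₀) (fun ε => (hend₀ ε).isOpen_image)
      (fun ε => (hend₀ ε).image_subset_source) (fun ε ε' h => hd₀ ε ε' h) (fun m hm => by
        have h1 : ∀ m', (∀ ε, m' ∉ (e ε).symm '' S) → φ m' = 1 := fun m' h => by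
          simp only [φ]
          rw [Finset.sum_eq_zero fun ε _ => hg0 ε m' (h ε), sub_zero]
        have h2 : ∀ ε, m ∉ (e ε).symm '' S := fun ε h => hm ε (Set.image_mono hSe h)
        have h3 : ∀ᶠ m' in 𝓝 m, ∀ ε, m' ∉ (e ε).symm '' S := by
          rw [eventually_all]
          exact fun ε => (hScl ε).isOpen_compl.mem_nhds (h2 ε)
        filter_upwards [h3] with m' hm'
        rw [h1 m' hm', h1 m h2])
    have hneg : ∀ ε x, (C ε).graphFlux k (u ε) (fun y => 1 - radialCutoff R y) x
        = - (C ε).graphFlux k (u ε) (radialCutoff R) x := fun ε x => by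
      unfold Catenoid.graphFlux graphForm
      rw [scalarPartial_const_sub, scalarPartial_const_sub]
      ring
    have hflux : ∀ ε, chartFlux X k (((e ε).symm '' exterior R₀).indicator fun _ => 1) φ (e ε)
        = - ∫ x, (C ε).graphFlux k (u ε) (radialCutoff R) x := fun ε => by
      rw [(hend₀ ε).chartFlux_eq hX.contMDiff (ψ := fun y => 1 - radialCutoff R y)
        (fun x hx => by
          simp only [φ]
          rw [hsum ε _ ⟨x, hx, rfl⟩, hge ε x hx]) (fun x hx => by
          rw [hneg, (C ε).graphFlux_eq_zero hR0 fun h =>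
            hx (annulus_subset_exterior hR h), neg_zero])]
      simp_rw [hneg]
      rw [integral_neg]
    rw [Finset.sum_congr rfl fun ε _ => hflux ε, Finset.sum_neg_distrib, neg_eq_zero] at key
    exact key
  -- The sum of the fluxes is zero at every large radius, hence so is the sum of their limits.
  have hlim := tendsto_finsetSum Finset.univ fun ε _ =>
    (C ε).tendsto_integral_graphFlux hA v (hl₀ ε).2 (hu ε) ((hend₀ ε).isWeakMinimalGraph hX)
      (has ε)
  have hlim0 : Tendsto (fun R => ∑ ε, ∫ x, (C ε).graphFlux k (u ε) (radialCutoff R) x) atTop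
      (𝓝 0) := by
    refine tendsto_const_nhds.congr' ?_
    filter_upwards [eventually_gt_atTop R₀, eventually_gt_atTop 0] with R h1 h2
    exact (hzero R h1 h2).symm
  have hfin := tendsto_nhds_unique hlim hlim0
  rw [← Finset.sum_mul] at hfin
  exact (mul_eq_zero.1 hfin).resolve_right integral_radialSlope_one_pos.ne'

end

/-! ### Statics of three forces. -/

/-- The line through `o` in the direction of `F`. -/
def lineThrough (o F : Space) : AffineSubspace ℝ Space :=
  AffineSubspace.mk' o (Submodule.span ℝ {F})

theorem mem_lineThrough {o F p : Space} : p ∈ lineThrough o F ↔ ∃ t : ℝ, p = o + t • F := by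
  rw [lineThrough, AffineSubspace.mem_mk', Submodule.mem_span_singleton]
  simp only [vsub_eq_sub, eq_sub_iff_add_eq', eq_comm]

theorem lineThrough_parallel {o o' F F' : Space} {t : ℝ} (ht : t ≠ 0) (h : F' = t • F) :
    (lineThrough o F).Parallel (lineThrough o' F') := by
  rw [AffineSubspace.parallel_iff_direction_eq_and_eq_bot_iff_eq_bot]
  have hb : ∀ o F, lineThrough o F ≠ ⊥ := fun o F h0 => by
    have : o ∈ lineThrough o F := AffineSubspace.self_mem_mk' _ _
    rw [h0] at this
    exact this
  refine ⟨?_, by simp [hb]⟩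
  rw [lineThrough, lineThrough, AffineSubspace.direction_mk', AffineSubspace.direction_mk', h,
    Submodule.span_singleton_smul_eq ht.isUnit]

theorem coplanar_of_forall_eq_add {s : Set Space} {o a b : Space}
    (h : ∀ p ∈ s, ∃ x y : ℝ, p = o + x • a + y • b) : Coplanar ℝ s := by
  have hs : s ⊆ (AffineSubspace.mk' o (Submodule.span ℝ {a, b}) : Set Space) := fun p hp => by
    obtain ⟨x, y, rfl⟩ := h p hp
    rw [SetLike.mem_coe, AffineSubspace.mem_mk', Submodule.mem_span_pair]
    exact ⟨x, y, by simp only [vsub_eq_sub]; abel⟩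
  refine Coplanar.subset hs ?_
  rw [Coplanar, ← AffineSubspace.direction_eq_vectorSpan, AffineSubspace.direction_mk']
  exact (rank_span_le _).trans ((Cardinal.mk_insert_le).trans (by simp [one_add_one_eq_two]))

/-- The skew-symmetric map `x ↦ ⟪a, x⟫ b - ⟪b, x⟫ a`. -/
def wedgeMap (a b : Space) : Space →L[ℝ] Space :=
  (innerSL ℝ a).smulRight b - (innerSL ℝ b).smulRight a

theorem wedgeMap_apply (a b x : Space) :
    wedgeMap a b x = inner ℝ a x • b - inner ℝ b x • a := rfl

theorem inner_wedgeMap_self (a b x : Space) : inner ℝ x (wedgeMap a b x) = 0 := by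
  rw [wedgeMap_apply, inner_sub_right, real_inner_smul_right, real_inner_smul_right,
    real_inner_comm a x, real_inner_comm b x]
  ring

theorem exists_inner_eq_zero_and_inner_eq_one {a b : Space} (h : LinearIndependent ℝ ![a, b]) :
    ∃ w : Space, inner ℝ w a = 0 ∧ inner ℝ w b = 1 := by
  have hG := gram_pos h
  refine ⟨(inner ℝ a a * inner ℝ b b - inner ℝ a b ^ 2)⁻¹ • (inner ℝ a a • b - inner ℝ a b • a),
    ?_, ?_⟩
  · simp only [real_inner_smul_left, inner_sub_left]
    rw [real_inner_comm a b]; ring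
  · simp only [real_inner_smul_left, inner_sub_left]
    rw [← pow_two, inv_mul_cancel₀ hG.ne']

/-- Lines of action of three forces in equilibrium, of which two are linearly independent, meet
in a point of the plane spanned by the forces. -/
theorem exists_common_point_of_balanced {o₀ o₁ o₂ F₀ F₁ F₂ : Space}
    (hlin : LinearIndependent ℝ ![F₀, F₁]) (hF : F₀ + F₁ + F₂ = 0)
    (hm : ∀ a b, inner ℝ F₀ (wedgeMap a b o₀) + inner ℝ F₁ (wedgeMap a b o₁)
      + inner ℝ F₂ (wedgeMap a b o₂) = 0) :
    ∃ P, P ∈ lineThrough o₀ F₀ ∧ P ∈ lineThrough o₁ F₁ ∧ P ∈ lineThrough o₂ F₂ := by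
  have hF₂ : F₂ = -F₀ - F₁ := by rw [eq_neg_of_add_eq_zero_right hF]; abel
  obtain ⟨w, hw₀, hw₁⟩ := exists_inner_eq_zero_and_inner_eq_one hlin
  obtain ⟨w', hw₁', hw₀'⟩ := exists_inner_eq_zero_and_inner_eq_one (a := F₁) (b := F₀) (by
    rw [LinearIndependent.pair_iff] at hlin ⊢
    exact fun s t hst => (hlin t s (by rw [add_comm]; exact hst)).symm)
  -- Eliminating `F₂` turns the torque balance into the equality of bivectors `(o₁ - o₂) ∧ F₁ = (o₂
  -- - o₀) ∧ F₀`. Contraction with the dual vectors `w`, `w'` expresses both differences in `F₀`,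
  -- `F₁` with a shared coefficient `β`.
  have key : ∀ a b, inner ℝ a (o₁ - o₂) * inner ℝ b F₁ - inner ℝ b (o₁ - o₂) * inner ℝ a F₁
      = inner ℝ a (o₂ - o₀) * inner ℝ b F₀ - inner ℝ b (o₂ - o₀) * inner ℝ a F₀ := by
    intro a b
    have := hm a b
    simp only [hF₂, wedgeMap_apply, inner_sub_left, inner_sub_right, inner_neg_left,
      real_inner_smul_right] at this ⊢
    rw [real_inner_comm a F₀, real_inner_comm b F₀, real_inner_comm a F₁,
      real_inner_comm b F₁] at this
    linarith
  set α := inner ℝ w (o₁ - o₂) with hα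
  set β := inner ℝ w (o₂ - o₀) with hβ
  set γ := inner ℝ w' (o₂ - o₀) with hγ
  have hx : o₁ - o₂ = α • F₁ - β • F₀ := ext_inner_left ℝ fun a => by
    have := key a w
    rw [hw₀, hw₁] at this
    rw [inner_sub_right a (α • F₁), real_inner_smul_right, real_inner_smul_right]
    linarith
  have hβ' : inner ℝ w' (o₁ - o₂) = -β := by
    rw [hx, inner_sub_right, real_inner_smul_right, real_inner_smul_right, hw₀', hw₁']
    ring
  have hy : o₂ - o₀ = γ • F₀ + β • F₁ := ext_inner_left ℝ fun a => by
    have := key a w'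
    rw [hw₀', hw₁', hβ'] at this
    rw [inner_add_right, real_inner_smul_right, real_inner_smul_right]
    linarith
  -- The shared `β` makes this point work: `F₂ = -F₀ - F₁` cancels the component along the other
  -- force in both expressions.
  refine ⟨o₂ + β • F₂, mem_lineThrough.2 ⟨γ - β, ?_⟩, mem_lineThrough.2 ⟨-α - β, ?_⟩,
    mem_lineThrough.2 ⟨β, rfl⟩⟩
  · rw [hF₂, eq_add_of_sub_eq hy]; module
  · rw [hF₂, eq_add_of_sub_eq hx]; module

/-- Lines of action of three forces in equilibrium are coplanar, and parallel or concurrent. -/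
theorem coplanar_and_parallel_or_concurrent_of_balanced {o F : Fin 3 → Space} (h0 : ∀ i, F i ≠ 0)
    (hF : ∑ i, F i = 0) (hm : ∀ a b, ∑ i, inner ℝ (F i) (wedgeMap a b (o i)) = 0) :
    Coplanar ℝ (⋃ i, (lineThrough (o i) (F i) : Set Space)) ∧
      ((∀ i j, (lineThrough (o i) (F i)).Parallel (lineThrough (o j) (F j))) ∨
        ∃ P, ∀ i, P ∈ lineThrough (o i) (F i)) := by
  simp only [Fin.sum_univ_three] at hF hm
  have hF₂ : F 2 = -F 0 - F 1 := by rw [eq_neg_of_add_eq_zero_right hF]; abel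
  by_cases hlin : LinearIndependent ℝ ![F 0, F 1]
  · obtain ⟨P, hP₀, hP₁, hP₂⟩ := exists_common_point_of_balanced hlin hF hm
    have hP : ∀ i, P ∈ lineThrough (o i) (F i) := by
      intro i; fin_cases i <;> assumption
    refine ⟨coplanar_of_forall_eq_add (o := P) (a := F 0) (b := F 1) fun p hp => ?_,
      Or.inr ⟨P, hP⟩⟩
    obtain ⟨i, hi⟩ := Set.mem_iUnion.1 hp
    obtain ⟨t, ht⟩ := mem_lineThrough.1 hi
    obtain ⟨s, hs⟩ := mem_lineThrough.1 (hP i)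
    have hp' : p = P + (t - s) • F i := by rw [ht, hs]; module
    rw [hp']
    fin_cases i
    · exact ⟨t - s, 0, by simp⟩
    · exact ⟨0, t - s, by simp⟩
    · exact ⟨-(t - s), -(t - s), by simp only [Fin.reduceFinMk, hF₂]; module⟩
  · obtain ⟨t, ht⟩ : ∃ t : ℝ, t • F 0 = F 1 := by
      rw [LinearIndependent.pair_iff' (h0 0)] at hlin
      push Not at hlin
      exact hlin
    have ht0 : t ≠ 0 := fun h => h0 1 (by rw [← ht, h, zero_smul])
    have hF₂' : F 2 = (-(1 + t)) • F 0 := by rw [hF₂, ← ht]; module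
    have ht1 : 1 + t ≠ 0 := fun h => h0 2 (by rw [hF₂', h, neg_zero, zero_smul])
    obtain ⟨τ, hτ0, hτ⟩ : ∃ τ : Fin 3 → ℝ, (∀ i, τ i ≠ 0) ∧ ∀ i, F i = τ i • F 0 := by
      refine ⟨![1, t, -(1 + t)], fun i => ?_, fun i => ?_⟩
      · fin_cases i
        · simp
        · simpa using ht0
        · simpa using neg_ne_zero.2 ht1
      · fin_cases i
        · simp
        · simpa using ht.symm
        · simpa using hF₂'
    have hn : inner ℝ (F 0) (F 0) ≠ 0 := fun h => h0 0 (inner_self_eq_zero.1 h)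
    set l := inner ℝ (F 0) (o 0 + t • o 1 - (1 + t) • o 2) / inner ℝ (F 0) (F 0) with hl
    -- All forces are multiples of `F 0`, so the torque balance says that this combination of base
    -- points wedges to zero with `F 0`; taking `b = F 0` extracts the factor.
    have hs : o 0 + t • o 1 - (1 + t) • o 2 = l • F 0 := ext_inner_left ℝ fun a => by
      have := hm a (F 0)
      rw [hF₂', ← ht] at this
      rw [hl]
      simp only [wedgeMap_apply, inner_sub_right, inner_add_right,
        real_inner_smul_left, real_inner_smul_right] at this ⊢
      rw [real_inner_comm a (F 0)] at this
      field_simp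
      linarith
    -- Since `F 2 ≠ 0` gives `1 + t ≠ 0`, the third base point lies in the plane through `o 0`
    -- spanned by `o 1 - o 0` and `F 0`.
    have ho : o 2 = o 0 + (t / (1 + t)) • (o 1 - o 0) - (l / (1 + t)) • F 0 := by
      have h2 : (1 + t) • o 2 = o 0 + t • o 1 - l • F 0 := by rw [← hs]; abel
      have h3 : o 2 = (1 + t)⁻¹ • (o 0 + t • o 1 - l • F 0) := by
        rw [← h2, inv_smul_smul₀ ht1]
      rw [h3]
      match_scalars <;> field_simp
      ring
    obtain ⟨x, y, hxy⟩ : ∃ x y : Fin 3 → ℝ, ∀ i, o i = o 0 + x i • (o 1 - o 0) + y i • F 0 := by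
      refine ⟨![0, 1, t / (1 + t)], ![0, 0, -(l / (1 + t))], fun i => ?_⟩
      fin_cases i
      · simp
      · simp
      · simpa [sub_eq_add_neg] using ho
    refine ⟨coplanar_of_forall_eq_add (o := o 0) (a := o 1 - o 0) (b := F 0) fun p hp => ?_,
      Or.inl fun i j => lineThrough_parallel (div_ne_zero (hτ0 j) (hτ0 i)) ?_⟩
    · obtain ⟨i, hi⟩ := Set.mem_iUnion.1 hp
      obtain ⟨s, rfl⟩ := mem_lineThrough.1 hi
      refine ⟨x i, y i + s * τ i, ?_⟩
      conv_lhs => rw [hxy i, hτ i]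
      module
    · rw [hτ i, smul_smul, div_mul_cancel₀ _ (hτ0 i)]
      exact hτ j

theorem Catenoid.axis_eq_lineThrough (C : Catenoid) :
    C.axis = lineThrough C.center (C.waist • C.frame 2) := by
  rw [lineThrough, Submodule.span_singleton_smul_eq C.waist_pos.ne'.isUnit]
  rfl

end

theorem proposition6p4 {M : Type*} [TopologicalSpace M] [T2Space M]
    [SecondCountableTopology M] [ConnectedSpace M] [ChartedSpace Plane M]
    [IsManifold 𝓘(ℝ, Plane) ∞ M]
    (X : M → Space) (hX : IsMinimalImmersion X)
    (hcurv : totalAbsCurvature X < ⊤)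
    (hends : Nat.card (TopologicalEnd M) = 3)
    (C : TopologicalEnd M → Catenoid) (hC : ∀ ε, IsAsymptoticTo X ε (C ε)) :
    Coplanar ℝ (⋃ ε, ((C ε).axis : Set Space)) ∧
      ((∀ ε ε', (C ε).axis.Parallel (C ε').axis) ∨ ∃ P, ∀ ε, P ∈ (C ε).axis) := by
  have := Nat.finite_of_card_ne_zero (α := TopologicalEnd M) (by rw [hends]; norm_num)
  have := Fintype.ofFinite (TopologicalEnd M)
  rw [Nat.card_eq_fintype_card] at hends
  let e : Fin 3 ≃ TopologicalEnd M := (Fintype.equivFinOfCardEq hends).symm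
  have hbal := fun {A : Space →L[ℝ] Space} (hA : ∀ x, inner ℝ x (A x) = 0) (v : Space) =>
    (e.sum_comp _).trans (sum_waist_mul_inner_eq_zero hX hC hA v)
  -- Force balance is the case `A = 0` with arbitrary `v`; torque balance is the case `v = 0` with
  -- `A` a `wedgeMap`.
  have hres := coplanar_and_parallel_or_concurrent_of_balanced
    (o := fun i => (C (e i)).center) (F := fun i => (C (e i)).waist • (C (e i)).frame 2)
    (fun i => smul_ne_zero (C (e i)).waist_pos.ne' ((C (e i)).frame.orthonormal.ne_zero 2))
    (ext_inner_right ℝ fun v => by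
      simpa [sum_inner, real_inner_smul_left] using hbal (A := 0) (by simp) v)
    (fun a b => by
      simpa [real_inner_smul_left] using hbal (inner_wedgeMap_self a b) 0)
  simp only [← Catenoid.axis_eq_lineThrough] at hres
  refine ⟨?_, hres.2.imp (fun h ε ε' => ?_) fun ⟨P, hP⟩ => ⟨P, fun ε => ?_⟩⟩
  · rw [← e.surjective.iUnion_comp]
    exact hres.1
  · simpa using h (e.symm ε) (e.symm ε')
  · simpa using hP (e.symm ε)
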